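/- Let $N\ge 3$ and $2^*=\frac{2N}{N-2}$. For an open set $\Omega\subset\mathbb{R}^N$ let $D^{1,2}(\Omega)=\{u\in L^{2^*}(\Omega):\nabla u\in L^2(\Omega,\mathbb{R}^N)\}$ (real-valued functions, weak gradient, functions equal almost everywhere identified), and put $$J_\Omega(u)=\frac12\int_\Omega|\nabla u|^2-\frac1{2^*}\int_\Omega|u|^{2^*},\qquad \mathcal N(\Omega)=\Big\{u\in D^{1,2}(\Omega): u\ne0,\ \int_\Omega|\nabla u|^2=\int_\Omega|u|^{2^*}\Big\}.$$ Let $\mathcal N^{\mathrm{rad}}(\Omega)$ be the set of those $u\in\mathcal N(\Omega)$ that are radial, i.e. $u(x)=f(|x|)$ for some $f$ and almost every $x\in\Omega$, and set $c^{\mathrm{rad}}_\Omega=\inf_{\mathcal N^{\mathrm{rad}}(\Omega)}J_\Omega$ and $c_\infty=\inf_{\mathcal N(\mathbb{R}^N)}J_{\mathbb{R}^N}$. For $\varepsilon>0$ let $$U_\varepsilon(x)=a_N\Big(\frac{\varepsilon}{\varepsilon^2+|x|^2}\Big)^{\frac{N-2}2},\qquad a_N=(N(N-2))^{\frac{N-2}4}.$$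 Let $\omega$ be any nonempty, connected, relatively open subset of the unit sphere $\mathbb{S}^{N-1}$ (for instance one with smooth boundary), and let $\Sigma_\omega=\{tx:x\in\omega,\ t>0\}$ and $\Lambda_\omega=\{tx:x\in\omega,\ 0<t<1\}$. A solution of the Neumann problem $$-\Delta u=|u|^{2^*-2}u\ \text{ in }\Sigma_\omega,\qquad \frac{\partial u}{\partial\nu}=0\ \text{ on }\partial\Sigma_\omega\qquad(*)$$ is a function $u\in D^{1,2}(\Sigma_\omega)$ with $\int_{\Sigma_\omega}\nabla u\cdot\nabla\varphi=\int_{\Sigma_\omega}|u|^{2^*-2}u\varphi$ for all $\varphi\in D^{1,2}(\Sigma_\omega)$. Then: 1. For every $\varepsilon>0$, the restriction of $U_\varepsilon$ to $\Sigma_\omega$ belongs to $\mathcal N^{\mathrm{rad}}(\Sigma_\omega)$ and minimizes $J_{\Sigma_\omega}$ on $\mathcal N^{\mathrm{rad}}(\Sigma_\omega)$. 2. The nontrivial radial solutions of $(*)$ are exactly the restrictions to $\Sigma_\omega$ of $U_\varepsilon$ and $-U_\varepsilon$, $\varepsilon>0$. 3. $c^{\mathrm{rad}}_{\Sigma_\omega}=b_N|\Lambda_\omega|$,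 where $b_N=\frac{c_\infty}{|B_1(0)|}$, $B_1(0)$ is the unit ball of $\mathbb{R}^N$ and $|X|$ denotes Lebesgue measure. In particular, $c^{\mathrm{rad}}_{\Sigma_\omega}$ increases strictly with $|\Lambda_\omega|$: if $|\Lambda_{\omega_1}|<|\Lambda_{\omega_2}|$ for two such sets $\omega_1,\omega_2$, then $c^{\mathrm{rad}}_{\Sigma_{\omega_1}}<c^{\mathrm{rad}}_{\Sigma_{\omega_2}}$. -/

import Mathlib

open MeasureTheory Set

noncomputable section

namespace CriticalCone

/-- The critical Sobolev exponent `2* = 2N / (N - 2)`. -/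
def critExp (N : ℕ) : ℝ := 2 * (N : ℝ) / ((N : ℝ) - 2)

/-- `G` is a weak (distributional) gradient of `u` in the open set `Ω`. -/
structure IsWeakGradient {N : ℕ} (Ω : Set (EuclideanSpace ℝ (Fin N)))
    (u : EuclideanSpace ℝ (Fin N) → ℝ)
    (G : EuclideanSpace ℝ (Fin N) → EuclideanSpace ℝ (Fin N)) : Prop where
  locallyIntegrable_fun : LocallyIntegrableOn u Ω
  locallyIntegrable_grad : LocallyIntegrableOn G Ω
  integral_by_parts : ∀ φ : EuclideanSpace ℝ (Fin N) → ℝ, ContDiff ℝ ((⊤ : ℕ∞) : WithTop ℕ∞) φ → HasCompactSupport φ →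
    tsupport φ ⊆ Ω → ∀ v : EuclideanSpace ℝ (Fin N),
      ∫ x in Ω, u x * fderiv ℝ φ x v = - ∫ x in Ω, inner ℝ (G x) v * φ x

/-- Two weak gradients of the same function agree almost everywhere. -/
theorem IsWeakGradient.ae_eq {N : ℕ} {Ω : Set (EuclideanSpace ℝ (Fin N))} (hΩ : IsOpen Ω)
    {u : EuclideanSpace ℝ (Fin N) → ℝ}
    {G H : EuclideanSpace ℝ (Fin N) → EuclideanSpace ℝ (Fin N)}
    (hG : IsWeakGradient Ω u G) (hH : IsWeakGradient Ω u H) :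
    G =ᵐ[volume.restrict Ω] H := by
  have hd : LocallyIntegrableOn (fun x => G x - H x) Ω :=
    hG.locallyIntegrable_grad.sub hH.locallyIntegrable_grad
  have key : ∀ᵐ x ∂(volume : Measure (EuclideanSpace ℝ (Fin N))), x ∈ Ω → G x - H x = 0 := by
    refine hΩ.ae_eq_zero_of_integral_contDiff_smul_eq_zero hd ?_
    intro φ hφ hc hs
    have hint : ∀ K : EuclideanSpace ℝ (Fin N) → EuclideanSpace ℝ (Fin N),
        LocallyIntegrableOn K Ω → Integrable (fun x => φ x • K x) := by
      intro K hK
      have h1 : IntegrableOn (fun x => φ x • K x) (tsupport φ) :=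
        (hK.integrableOn_compact_subset hs hc).continuousOn_smul hφ.continuous.continuousOn hc
      refine (integrableOn_iff_integrable_of_support_subset ?_).1 h1
      intro x hx
      refine subset_closure ?_
      intro h
      exact hx (by simp [h])
    have hset : ∀ K : EuclideanSpace ℝ (Fin N) → EuclideanSpace ℝ (Fin N), ∀ v,
        LocallyIntegrableOn K Ω →
        ∫ x in Ω, inner ℝ (K x) v * φ x = inner ℝ (∫ x, φ x • K x) v := by
      intro K v hK
      rw [real_inner_comm, ← integral_inner (hint K hK) v]
      rw [← setIntegral_eq_integral_of_forall_compl_eq_zero (s := Ω)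
        (f := fun x => inner ℝ v (φ x • K x))]
      · refine integral_congr_ae (Filter.Eventually.of_forall fun x => ?_)
        simp only [inner_smul_right]
        rw [real_inner_comm]; ring
      · intro x hx
        have : φ x = 0 := by
          by_contra h
          exact hx (hs (subset_closure h))
        simp [this]
    have e : ∫ x, φ x • G x = ∫ x, φ x • H x := by
      refine ext_inner_right ℝ fun v => ?_
      rw [← hset G v hG.locallyIntegrable_grad, ← hset H v hH.locallyIntegrable_grad]
      have a := hG.integral_by_parts φ hφ hc hs v
      have b := hH.integral_by_parts φ hφ hc hs v
      linarith
    simp only [smul_sub]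
    rw [integral_sub (hint G hG.locallyIntegrable_grad) (hint H hH.locallyIntegrable_grad), e,
      sub_self]
  rw [Filter.EventuallyEq, ae_restrict_iff' hΩ.measurableSet]
  filter_upwards [key] with x hx hxΩ
  exact sub_eq_zero.1 (hx hxΩ)

open Classical in
/-- The weak gradient of `u` in `Ω` (determined almost everywhere in `Ω`; zero if `u` has none). -/
def weakGrad {N : ℕ} (Ω : Set (EuclideanSpace ℝ (Fin N))) (u : EuclideanSpace ℝ (Fin N) → ℝ) :
    EuclideanSpace ℝ (Fin N) → EuclideanSpace ℝ (Fin N) :=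
  if h : ∃ G, IsWeakGradient Ω u G then h.choose else 0

/-- The space `D^{1,2}(Ω) = {u ∈ L^{2*}(Ω) : ∇u ∈ L²(Ω, ℝ^N)}`. Its elements are represented by
functions on the whole of `ℝ^N`, of which only the almost-everywhere class in `Ω` matters. -/
def D12 {N : ℕ} (Ω : Set (EuclideanSpace ℝ (Fin N))) : Set (EuclideanSpace ℝ (Fin N) → ℝ) :=
  {u | MemLp u (ENNReal.ofReal (critExp N)) (volume.restrict Ω) ∧
    (∃ G, IsWeakGradient Ω u G) ∧ MemLp (weakGrad Ω u) 2 (volume.restrict Ω)}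

/-- `J_Ω(u) = 1/2 ∫_Ω |∇u|² - 1/2* ∫_Ω |u|^{2*}`. -/
def energy {N : ℕ} (Ω : Set (EuclideanSpace ℝ (Fin N))) (u : EuclideanSpace ℝ (Fin N) → ℝ) : ℝ :=
  1 / 2 * (∫ x in Ω, ‖weakGrad Ω u x‖ ^ 2) - 1 / critExp N * ∫ x in Ω, |u x| ^ critExp N

/-- `u ≠ 0` as an element of `D^{1,2}(Ω)`. -/
def Nontrivial {N : ℕ} (Ω : Set (EuclideanSpace ℝ (Fin N)))
    (u : EuclideanSpace ℝ (Fin N) → ℝ) : Prop :=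
  ¬ u =ᵐ[volume.restrict Ω] 0

/-- The Nehari manifold of `J_Ω`. -/
def nehari {N : ℕ} (Ω : Set (EuclideanSpace ℝ (Fin N))) : Set (EuclideanSpace ℝ (Fin N) → ℝ) :=
  {u | u ∈ D12 Ω ∧ Nontrivial Ω u ∧
    ∫ x in Ω, ‖weakGrad Ω u x‖ ^ 2 = ∫ x in Ω, |u x| ^ critExp N}

/-- `u` is (almost everywhere) radial in `Ω`. -/
def IsRadialOn {N : ℕ} (Ω : Set (EuclideanSpace ℝ (Fin N)))
    (u : EuclideanSpace ℝ (Fin N) → ℝ) : Prop :=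
  ∃ f : ℝ → ℝ, ∀ᵐ x ∂(volume.restrict Ω), u x = f ‖x‖

/-- The radial functions in the Nehari manifold. -/
def radialNehari {N : ℕ} (Ω : Set (EuclideanSpace ℝ (Fin N))) :
    Set (EuclideanSpace ℝ (Fin N) → ℝ) :=
  {u | u ∈ nehari Ω ∧ IsRadialOn Ω u}

/-- `c_Ω`, the infimum of `J_Ω` on the Nehari manifold. -/
def leastEnergy {N : ℕ} (Ω : Set (EuclideanSpace ℝ (Fin N))) : ℝ :=
  sInf (energy Ω '' nehari Ω)

/-- `c_Ω^rad`, the infimum of `J_Ω` on the radial functions in the Nehari manifold. -/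
def radialLeastEnergy {N : ℕ} (Ω : Set (EuclideanSpace ℝ (Fin N))) : ℝ :=
  sInf (energy Ω '' radialNehari Ω)

/-- `c_∞ = c_{ℝ^N}`. -/
def cInfty (N : ℕ) : ℝ := leastEnergy (univ : Set (EuclideanSpace ℝ (Fin N)))

/-- `b_N = c_∞ / |B_1(0)|`. -/
def bConst (N : ℕ) : ℝ :=
  cInfty N / volume.real (Metric.ball (0 : EuclideanSpace ℝ (Fin N)) 1)

/-- `u` is a weak solution in `D^{1,2}(Ω)` of `-Δu = |u|^{2*-2}u` in `Ω`, `∂u/∂ν = 0` on `∂Ω`,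
that is, a critical point of `J_Ω` on `D^{1,2}(Ω)`. The test functions are not required to vanish
on `∂Ω`, which encodes the Neumann condition. -/
def IsNeumannSolution {N : ℕ} (Ω : Set (EuclideanSpace ℝ (Fin N)))
    (u : EuclideanSpace ℝ (Fin N) → ℝ) : Prop :=
  u ∈ D12 Ω ∧ ∀ φ ∈ D12 Ω,
    ∫ x in Ω, inner ℝ (weakGrad Ω u x) (weakGrad Ω φ x) =
      ∫ x in Ω, |u x| ^ (critExp N - 2) * u x * φ x

/-- The rescaled standard bubble
`U_ε(x) = a_N (ε / (ε² + |x|²))^{(N-2)/2}`, with `a_N = (N(N-2))^{(N-2)/4}`. -/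
def bubble {N : ℕ} (ε : ℝ) (x : EuclideanSpace ℝ (Fin N)) : ℝ :=
  ((N : ℝ) * ((N : ℝ) - 2)) ^ (((N : ℝ) - 2) / 4) *
    (ε / (ε ^ 2 + ‖x‖ ^ 2)) ^ (((N : ℝ) - 2) / 2)

/-- `ω` is a domain in the unit sphere: nonempty, connected and relatively open. -/
structure IsSphereDomain {N : ℕ} (ω : Set (EuclideanSpace ℝ (Fin N))) : Prop where
  isConnected : IsConnected ω
  isOpen_in_sphere : ∃ O : Set (EuclideanSpace ℝ (Fin N)), IsOpen O ∧ ω = O ∩ Metric.sphere 0 1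

/-- The unbounded cone `Σ_ω = {tx : x ∈ ω, t > 0}`. -/
def openCone {N : ℕ} (ω : Set (EuclideanSpace ℝ (Fin N))) : Set (EuclideanSpace ℝ (Fin N)) :=
  {y | ∃ x ∈ ω, ∃ t : ℝ, 0 < t ∧ y = t • x}

/-- The bounded cone `Λ_ω = {tx : x ∈ ω, 0 < t < 1}`. -/
def boundedCone {N : ℕ} (ω : Set (EuclideanSpace ℝ (Fin N))) : Set (EuclideanSpace ℝ (Fin N)) :=
  {y | ∃ x ∈ ω, ∃ t : ℝ, 0 < t ∧ t < 1 ∧ y = t • x}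

end CriticalCone

end

/-!
The proof rests on two independent facts: the sharp Sobolev inequality, which gives the minimality of
the bubbles, and the integrability of the radial equation, which gives the classification.

The sharp inequality `S (∫ |u|^{2*})^{2/2*} ≤ ∫ |∇u|²` on `ℝ^N` is proved by mass transport. The
Knothe map (`exists_isTriangularTransport`) is a triangular map with increasing diagonal components
carrying the density `f^{2*}` to a multiple of `(1 + |x|²)^{-N}`, the critical power of the bubble
profile. The arithmetic-geometric mean inequality for its diagonal derivatives, an integration by
parts and Young's inequality give `transport_estimate`, in which every step is an equality for the
bubbles. No regularity theory of transport is needed, since each component is explicitly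
differentiable in its own variable, and this is the only derivative that occurs. Adding a small
multiple of the bubble inside a square root makes any compactly supported `C¹` function admissible
(`sobolev_of_hasCompactSupport`). Truncation and mollification extend the inequality to
`D^{1,2}(ℝ^N)` (`sobolev_of_isWeakGradient`), so that `c_∞` is the energy of a bubble (`cInfty_eq`).

In polar coordinates, integrals of radial functions over the cone `Σ_ω` are one-dimensional
integrals against `r^{N-1} dr`, multiplied by the area of `ω`; this area is `N |Λ_ω|`. The only
property of the cone which matters is that the fields `g(|x|) x` are tangent to its boundary:
integration by parts against them produces no boundary terms (`integral_div_radial`), without any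
regularity of `ω`. For the field `∇U_ε` this is the weak form of the Neumann problem
(`isNeumannSolution_bubble`). For general `g` it shows that the profile `f` of a radial function `u`
in `D^{1,2}(Σ_ω)` is a primitive of the angular mean `H` of the radial component of `∇u`
(`exists_radial_data`), and Jensen's inequality bounds `|ω| ∫ H² r^{N-1} dr` by `∫ |∇u|²`. The
inequality on `ℝ^N`, applied to radial functions, becomes an inequality between `f` and `H` in which
`ω` does not appear (`radial_sobolev`). It gives the minimality of the bubbles on the radial Nehari
manifold of any cone, and the value of the level, which is proportional to the area of `ω`.

A radial solution of the Neumann problem solves the radial Emden-Fowler equation on the half-line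
(`IsNeumannSolution.exists_radialSolution`). Its Pohozaev quantity is constant, and finite energy
forces the constant to be zero (`pohozaev_eq_zero`). At the zero level, `f^{-2/(N-2)}` is a
quadratic polynomial in `r` wherever `f > 0`; by connectedness of the half-line a solution which is
positive somewhere is a bubble (`IsRadialSolution.eq_bubbleProfile`).
-/

noncomputable section

namespace CriticalCone

open Filter Topology

/-! ### Monotone rearrangement of densities on the line -/

/-- The normalised distribution function of a density `p` on the line. -/
def distrib (p : ℝ → ℝ) (t : ℝ) : ℝ := (∫ s in Iic t, p s) / ∫ s, p s

/-- A continuous, positive and integrable density on the line. -/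
structure LineDensity (p : ℝ → ℝ) : Prop where
  continuous : Continuous p
  pos : ∀ t, 0 < p t
  integrable : Integrable p

namespace LineDensity

variable {p q : ℝ → ℝ}

theorem integral_pos (hp : LineDensity p) : 0 < ∫ s, p s := by
  rw [integral_pos_iff_support_of_nonneg (fun t => (hp.pos t).le) hp.integrable]
  have : Function.support p = univ := by
    ext t; simp [(hp.pos t).ne']
  simp [this]

theorem hasDerivAt_distrib (hp : LineDensity p) (t : ℝ) :
    HasDerivAt (distrib p) (p t / ∫ s, p s) t := by
  refine HasDerivAt.div_const ?_ _
  have h : ∀ t, ∫ s in Iic t, p s = (∫ s in (0 : ℝ)..t, p s) + ∫ s in Iic 0, p s := by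
    intro t
    rw [← intervalIntegral.integral_Iic_sub_Iic hp.integrable.integrableOn
      hp.integrable.integrableOn]
    ring
  rw [funext h]
  exact (intervalIntegral.integral_hasDerivAt_right (hp.continuous.intervalIntegrable _ _)
    hp.continuous.aestronglyMeasurable.stronglyMeasurableAtFilter
    hp.continuous.continuousAt).add_const _

theorem continuous_distrib (hp : LineDensity p) : Continuous (distrib p) :=
  continuous_iff_continuousAt.2 fun t => (hp.hasDerivAt_distrib t).continuousAt

theorem strictMono_distrib (hp : LineDensity p) : StrictMono (distrib p) :=
  strictMono_of_deriv_pos fun t => by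
    rw [(hp.hasDerivAt_distrib t).deriv]
    exact div_pos (hp.pos t) hp.integral_pos

theorem distrib_lt_one (hp : LineDensity p) (t : ℝ) : distrib p t < 1 := by
  refine (hp.strictMono_distrib (lt_add_one t)).trans_le ?_
  rw [distrib, div_le_one hp.integral_pos]
  exact setIntegral_le_integral hp.integrable (ae_of_all _ fun t => (hp.pos t).le)

theorem distrib_pos (hp : LineDensity p) (t : ℝ) : 0 < distrib p t := by
  refine lt_of_le_of_lt ?_ (hp.strictMono_distrib (sub_one_lt t))
  exact div_nonneg (setIntegral_nonneg measurableSet_Iic fun t _ => (hp.pos t).le)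
    hp.integral_pos.le

theorem tendsto_distrib_atTop (hp : LineDensity p) : Tendsto (distrib p) atTop (𝓝 1) := by
  have h := (aecover_Iic (μ := (volume : Measure ℝ)) (tendsto_id (α := ℝ)
    (x := atTop))).integral_tendsto_of_countably_generated hp.integrable
  have h2 := h.div_const (∫ s, p s)
  rwa [div_self hp.integral_pos.ne'] at h2

theorem tendsto_distrib_atBot (hp : LineDensity p) : Tendsto (distrib p) atBot (𝓝 0) := by
  have h := (aecover_Ioi (μ := (volume : Measure ℝ)) (tendsto_id (α := ℝ)
    (x := atBot))).integral_tendsto_of_countably_generated hp.integrable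
  have h2 : ∀ t, distrib p t = 1 - (∫ s in Ioi t, p s) / ∫ s, p s := by
    intro t
    have e := integral_add_compl (measurableSet_Iic (a := t)) hp.integrable
    rw [compl_Iic] at e
    rw [distrib, eq_sub_iff_add_eq, ← add_div, e, div_self hp.integral_pos.ne']
  simp_rw [funext h2]
  simpa [hp.integral_pos.ne'] using (h.div_const (∫ s, p s)).const_sub 1

theorem exists_distrib_eq (hp : LineDensity p) {c : ℝ} (h0 : 0 < c) (h1 : c < 1) :
    ∃ t, distrib p t = c := by
  refine mem_range_of_exists_le_of_exists_ge hp.continuous_distrib ?_ ?_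
  · exact ((hp.tendsto_distrib_atBot.eventually (gt_mem_nhds h0)).exists).imp fun _ h => h.le
  · exact ((hp.tendsto_distrib_atTop.eventually (lt_mem_nhds h1)).exists).imp fun _ h => h.le

end LineDensity

/-- The monotone rearrangement, which transports the normalised density `p` to the
normalised density `q`. -/
def rearr (p q : ℝ → ℝ) (t : ℝ) : ℝ := Function.invFun (distrib q) (distrib p t)

section rearr

variable {p q : ℝ → ℝ}

theorem distrib_rearr (hp : LineDensity p) (hq : LineDensity q) (t : ℝ) :
    distrib q (rearr p q t) = distrib p t :=
  Function.invFun_eq (hq.exists_distrib_eq (hp.distrib_pos t) (hp.distrib_lt_one t))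

theorem rearr_le_iff (hp : LineDensity p) (hq : LineDensity q) (t s : ℝ) :
    rearr p q t ≤ s ↔ distrib p t ≤ distrib q s := by
  rw [← hq.strictMono_distrib.le_iff_le, distrib_rearr hp hq]

theorem strictMono_rearr (hp : LineDensity p) (hq : LineDensity q) :
    StrictMono (rearr p q) := fun s t h => by
  rw [← hq.strictMono_distrib.lt_iff_lt, distrib_rearr hp hq, distrib_rearr hp hq]
  exact hp.strictMono_distrib h

theorem surjective_rearr (hp : LineDensity p) (hq : LineDensity q) :
    Function.Surjective (rearr p q) := fun s => by
  obtain ⟨t, ht⟩ := hp.exists_distrib_eq (hq.distrib_pos s) (hq.distrib_lt_one s)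
  exact ⟨t, hq.strictMono_distrib.injective (by rw [distrib_rearr hp hq, ht])⟩

theorem continuous_rearr (hp : LineDensity p) (hq : LineDensity q) : Continuous (rearr p q) :=
  (strictMono_rearr hp hq).monotone.continuous_of_surjective (surjective_rearr hp hq)

theorem hasDerivAt_rearr (hp : LineDensity p) (hq : LineDensity q) (t : ℝ) :
    HasDerivAt (rearr p q) ((p t / ∫ s, p s) / (q (rearr p q t) / ∫ s, q s)) t := by
  have hq0 : q (rearr p q t) / ∫ s, q s ≠ 0 := (div_pos (hq.pos _) hq.integral_pos).ne'
  have hp0 : p t / ∫ s, p s ≠ 0 := (div_pos (hp.pos _) hp.integral_pos).ne'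
  -- the inverse of the rearrangement is the rearrangement in the opposite direction
  have hinv : ∀ s, rearr q p (rearr p q s) = s := fun s =>
    hp.strictMono_distrib.injective (by rw [distrib_rearr hq hp, distrib_rearr hp hq])
  set h : ℝ → ℝ := rearr p q with hdef
  have e : distrib q ∘ h = distrib p := funext fun t => distrib_rearr hp hq t
  have hd := hp.hasDerivAt_distrib t
  rw [hasDerivAt_iff_tendsto_slope] at hd ⊢
  have hdq := hq.hasDerivAt_distrib (h t)
  rw [hasDerivAt_iff_tendsto_slope] at hdq
  have hcont : Tendsto h (𝓝[≠] t) (𝓝[≠] (h t)) :=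
    tendsto_nhdsWithin_of_tendsto_nhds_of_eventually_within _
      ((continuous_rearr hp hq).continuousAt.tendsto.mono_left nhdsWithin_le_nhds)
      (eventually_nhdsWithin_of_forall fun s hs => (strictMono_rearr hp hq).injective.ne hs)
  refine (hd.div (hdq.comp hcont) hq0).congr' ?_
  filter_upwards [self_mem_nhdsWithin] with s hs
  have h1 : h s - h t ≠ 0 := sub_ne_zero.2 ((strictMono_rearr hp hq).injective.ne hs)
  have h2 : s - t ≠ 0 := sub_ne_zero.2 hs
  have h3 : distrib p s - distrib p t ≠ 0 :=
    sub_ne_zero.2 (hp.strictMono_distrib.injective.ne hs)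
  simp only [Pi.div_apply, Function.comp, slope_def_field]
  rw [distrib_rearr hp hq, distrib_rearr hp hq]
  field_simp

theorem lintegral_comp_rearr (hp : LineDensity p) (hq : LineDensity q) (g : ℝ → ENNReal) :
    ∫⁻ t, g (rearr p q t) * ENNReal.ofReal (p t / ∫ s, p s) =
      ∫⁻ s, g s * ENNReal.ofReal (q s / ∫ s, q s) := by
  have h := lintegral_image_eq_lintegral_abs_deriv_mul MeasurableSet.univ
    (fun t _ => (hasDerivAt_rearr hp hq t).hasDerivWithinAt)
    (strictMono_rearr hp hq).injective.injOn
    (fun s => g s * ENNReal.ofReal (q s / ∫ s, q s))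
  rw [image_univ, (surjective_rearr hp hq).range_eq] at h
  simp only [Measure.restrict_univ] at h
  rw [h]
  refine lintegral_congr fun t => ?_
  have h1 := div_pos (hp.pos t) hp.integral_pos
  have h2 := div_pos (hq.pos (rearr p q t)) hq.integral_pos
  rw [abs_of_pos (div_pos h1 h2), mul_left_comm, ← ENNReal.ofReal_mul (div_pos h1 h2).le,
    div_mul_cancel₀ _ h2.ne']

end rearr

/-! ### The Knothe map -/

/-- A continuous positive density on `ℝ^k` dominated by a product of Cauchy densities. The bound
passes to the marginals and makes them continuous, by dominated convergence. -/
structure KnotheDensity {k : ℕ} (F : (Fin k → ℝ) → ℝ) : Prop where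
  continuous : Continuous F
  pos : ∀ x, 0 < F x
  bound : ∃ C : ℝ, ∀ x, F x ≤ C * ∏ i, (1 + x i ^ 2)⁻¹

/-- The density of the last `k` coordinates. -/
def marginal {k : ℕ} (F : (Fin (k + 1) → ℝ) → ℝ) (x : Fin k → ℝ) : ℝ :=
  ∫ t, F (Fin.cons t x)

namespace KnotheDensity

variable {k : ℕ}

theorem integrable {F : (Fin k → ℝ) → ℝ} (hF : KnotheDensity F) : Integrable F := by
  obtain ⟨C, hC⟩ := hF.bound
  refine Integrable.mono' (g := fun x => C * ∏ i, (1 + x i ^ 2)⁻¹) ?_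
    hF.continuous.aestronglyMeasurable (ae_of_all _ fun x => ?_)
  · exact (Integrable.fintype_prod (𝕜 := ℝ) (f := fun _ t => (1 + t ^ 2)⁻¹)
      (μ := fun _ : Fin k => volume) fun _ => integrable_inv_one_add_sq).const_mul C
  · rw [Real.norm_of_nonneg (hF.pos x).le]
    exact hC x

theorem continuous_cons : Continuous fun z : ℝ × (Fin k → ℝ) =>
    (Fin.cons z.1 z.2 : Fin (k + 1) → ℝ) := by
  refine continuous_pi fun i => ?_
  refine Fin.cases ?_ (fun i => ?_) i
  · simpa using continuous_fst
  · simp only [Fin.cons_succ]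
    fun_prop

theorem bound_cons {F : (Fin (k + 1) → ℝ) → ℝ} (hF : KnotheDensity F) :
    ∃ C : ℝ, 0 ≤ C ∧ ∀ t x, F (Fin.cons t x) ≤ C * (∏ i, (1 + x i ^ 2)⁻¹) * (1 + t ^ 2)⁻¹ := by
  obtain ⟨C, hC⟩ := hF.bound
  refine ⟨C, ?_, fun t x => ?_⟩
  · have h := (hF.pos 0).trans_le (hC 0)
    simpa using h.le
  · refine (hC _).trans_eq ?_
    rw [Fin.prod_univ_succ]
    simp only [Fin.cons_zero, Fin.cons_succ]
    ring

theorem lineDensity {F : (Fin (k + 1) → ℝ) → ℝ} (hF : KnotheDensity F) (x : Fin k → ℝ) :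
    LineDensity fun t => F (Fin.cons t x) := by
  have hc : Continuous fun t : ℝ => F (Fin.cons t x) :=
    hF.continuous.comp (continuous_cons.comp (by fun_prop : Continuous fun t : ℝ => (t, x)))
  obtain ⟨C, -, hC⟩ := hF.bound_cons
  refine ⟨hc, fun t => hF.pos _, ?_⟩
  refine Integrable.mono' (integrable_inv_one_add_sq.const_mul (C * ∏ i, (1 + x i ^ 2)⁻¹))
    hc.aestronglyMeasurable (ae_of_all _ fun t => ?_)
  rw [Real.norm_of_nonneg (hF.pos _).le]
  exact hC t x

theorem marginal {F : (Fin (k + 1) → ℝ) → ℝ} (hF : KnotheDensity F) :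
    KnotheDensity (marginal F) := by
  obtain ⟨C, hC0, hC⟩ := hF.bound_cons
  refine ⟨?_, fun x => (hF.lineDensity x).integral_pos, C * ∫ t : ℝ, (1 + t ^ 2)⁻¹, fun x => ?_⟩
  · refine continuous_of_dominated (bound := fun t => C * (1 + t ^ 2)⁻¹)
      (fun x => (hF.lineDensity x).continuous.aestronglyMeasurable)
      (fun x => ae_of_all _ fun t => ?_) (integrable_inv_one_add_sq.const_mul C)
      (ae_of_all _ fun t => ?_)
    · rw [Real.norm_of_nonneg (hF.pos _).le]
      refine (hC t x).trans ?_
      gcongr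
      refine mul_le_of_le_one_right hC0 (Finset.prod_le_one (fun i _ => by positivity) fun i _ => ?_)
      exact inv_le_one_of_one_le₀ (by nlinarith [sq_nonneg (x i)])
    · exact hF.continuous.comp (continuous_cons.comp (by fun_prop : Continuous fun x => (t, x)))
  · calc CriticalCone.marginal F x ≤ ∫ t : ℝ, C * (∏ i, (1 + x i ^ 2)⁻¹) * (1 + t ^ 2)⁻¹ :=
        integral_mono (hF.lineDensity x).integrable (integrable_inv_one_add_sq.const_mul _)
          fun t => hC t x
      _ = _ := by rw [integral_const_mul]; ring

end KnotheDensity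

theorem piFinSuccAbove_zero_symm_apply {k : ℕ} (t : ℝ) (x : Fin k → ℝ) :
    (MeasurableEquiv.piFinSuccAbove (fun _ : Fin (k + 1) => ℝ) 0).symm (t, x) = Fin.cons t x := by
  rw [MeasurableEquiv.symm_apply_eq]
  refine Prod.ext ?_ (funext fun i => ?_) <;> rfl

theorem lintegral_cons {k : ℕ} (g : (Fin (k + 1) → ℝ) → ENNReal) (hg : Measurable g) :
    ∫⁻ z, g z = ∫⁻ x : Fin k → ℝ, ∫⁻ t : ℝ, g (Fin.cons t x) := by
  have h := (volume_preserving_piFinSuccAbove (fun _ : Fin (k + 1) => ℝ) 0).symm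
  rw [← h.lintegral_comp hg, Measure.volume_eq_prod,
    lintegral_prod_symm (fun z => g ((MeasurableEquiv.piFinSuccAbove (fun _ => ℝ) 0).symm z))
      (hg.comp h.measurable).aemeasurable]
  simp only [piFinSuccAbove_zero_symm_apply]

theorem integral_marginal {k : ℕ} {F : (Fin (k + 1) → ℝ) → ℝ} (hF : KnotheDensity F) :
    ∫ x, marginal F x = ∫ z, F z := by
  have h := (volume_preserving_piFinSuccAbove (fun _ : Fin (k + 1) => ℝ) 0).symm
  have hi := (h.integrable_comp_emb (MeasurableEquiv.measurableEmbedding _)).2 hF.integrable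
  rw [← h.integral_comp' F]
  rw [Measure.volume_eq_prod] at hi ⊢
  rw [integral_prod_symm (fun z => F ((MeasurableEquiv.piFinSuccAbove (fun _ => ℝ) 0).symm z)) hi]
  simp only [piFinSuccAbove_zero_symm_apply]
  rfl

/-- A triangular transport map `T` from the density `F` to the density `G`: `D i` is the derivative of
the `i`-th component in the `i`-th variable. The transport property is recorded twice, as the
Monge-Ampère equation `prod_deriv` and in the integrated form `lintegral_comp`, since without
differentiability in the other variables neither follows from the other. Triangularity itself is
built into the construction and need not be recorded. -/
structure IsTriangularTransport {k : ℕ} (F G : (Fin k → ℝ) → ℝ)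
    (T : (Fin k → ℝ) → Fin k → ℝ) (D : Fin k → (Fin k → ℝ) → ℝ) : Prop where
  measurable : Measurable T
  measurable_deriv : ∀ i, Measurable (D i)
  deriv_pos : ∀ i x, 0 < D i x
  hasDerivAt : ∀ i x, HasDerivAt (fun t => T (Function.update x i t) i) (D i x) (x i)
  continuous_deriv : ∀ i x, Continuous fun t => D i (Function.update x i t)
  prod_deriv : ∀ x, (∏ i, D i x) * G (T x) = F x
  lintegral_comp : ∀ h : (Fin k → ℝ) → ENNReal, Measurable h →
    ∫⁻ x, h (T x) * ENNReal.ofReal (F x) = ∫⁻ y, h y * ENNReal.ofReal (G y)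

theorem measurable_distrib_param {X : Type*} [MeasurableSpace X] {P : X → ℝ → ℝ}
    (hP : Measurable (Function.uncurry P)) :
    Measurable fun z : X × ℝ => distrib (P z.1) z.2 := by
  refine Measurable.div ?_ ?_
  · have h1 : ∀ z : X × ℝ, ∫ s in Iic z.2, P z.1 s =
        ∫ s, {w : (X × ℝ) × ℝ | w.2 ≤ w.1.2}.indicator (fun w => P w.1.1 w.2) (z, s) := by
      intro z
      rw [← integral_indicator measurableSet_Iic]
      rfl
    simp_rw [h1]
    refine (StronglyMeasurable.integral_prod_right (ν := volume) (f := fun z s =>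
      {w : (X × ℝ) × ℝ | w.2 ≤ w.1.2}.indicator (fun w => P w.1.1 w.2) (z, s)) ?_).measurable
    refine Measurable.stronglyMeasurable ?_
    refine Measurable.indicator (f := fun w : (X × ℝ) × ℝ => P w.1.1 w.2) ?_
      (measurableSet_le measurable_snd (measurable_snd.comp measurable_fst))
    exact hP.comp ((measurable_fst.comp measurable_fst).prodMk measurable_snd)
  · have : Measurable fun x => ∫ s, P x s :=
      (StronglyMeasurable.integral_prod_right (ν := volume) hP.stronglyMeasurable).measurable
    exact this.comp measurable_fst

/-- The inductive step of the Knothe construction: a transport of the marginals is completed by the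
monotone rearrangement of the conditional densities in the new variable. -/
theorem isTriangularTransport_cons {k : ℕ} {F G : (Fin (k + 1) → ℝ) → ℝ} (hF : KnotheDensity F)
    (hG : KnotheDensity G) {T : (Fin k → ℝ) → Fin k → ℝ} {D : Fin k → (Fin k → ℝ) → ℝ}
    (hT : IsTriangularTransport (marginal F) (marginal G) T D) :
    ∃ T' D', IsTriangularTransport F G T' D' := by
  set τ : (Fin k → ℝ) → ℝ → ℝ := fun x =>
    rearr (fun t => F (Fin.cons t x)) (fun s => G (Fin.cons s (T x))) with hτ
  have hFc : Measurable (Function.uncurry fun (x : Fin k → ℝ) (t : ℝ) => F (Fin.cons t x)) :=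
    (hF.continuous.comp (KnotheDensity.continuous_cons.comp
      (continuous_snd.prodMk continuous_fst))).measurable
  have hGc : Measurable (Function.uncurry fun (x : Fin k → ℝ) (t : ℝ) => G (Fin.cons t x)) :=
    (hG.continuous.comp (KnotheDensity.continuous_cons.comp
      (continuous_snd.prodMk continuous_fst))).measurable
  have hτm : Measurable fun z : (Fin k → ℝ) × ℝ => τ z.1 z.2 := by
    refine measurable_of_Iic fun s => ?_
    have : (fun z : (Fin k → ℝ) × ℝ => τ z.1 z.2) ⁻¹' Iic s =
        {z | distrib (fun t => F (Fin.cons t z.1)) z.2 ≤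
          distrib (fun t => G (Fin.cons t (T z.1))) s} := by
      ext z
      exact rearr_le_iff (hF.lineDensity z.1) (hG.lineDensity (T z.1)) z.2 s
    rw [this]
    refine measurableSet_le (measurable_distrib_param hFc) ?_
    exact (measurable_distrib_param hGc).comp
      ((hT.measurable.comp measurable_fst).prodMk measurable_const)
  have hm0 : Measurable fun x : Fin (k + 1) → ℝ => x 0 := measurable_pi_apply 0
  have hmt : Measurable fun x : Fin (k + 1) → ℝ => (Fin.tail x : Fin k → ℝ) :=
    measurable_pi_lambda _ fun i => measurable_pi_apply _
  have hτ' : Measurable fun x : Fin (k + 1) → ℝ => τ (Fin.tail x) (x 0) :=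
    hτm.comp (hmt.prodMk hm0)
  have hdτ : ∀ x t, HasDerivAt (τ x) ((F (Fin.cons t x) / marginal F x) /
      (G (Fin.cons (τ x t) (T x)) / marginal G (T x))) t := fun x t =>
    hasDerivAt_rearr (hF.lineDensity x) (hG.lineDensity (T x)) t
  set T' : (Fin (k + 1) → ℝ) → Fin (k + 1) → ℝ := fun x =>
    Fin.cons (τ (Fin.tail x) (x 0)) (T (Fin.tail x)) with hT'
  have hT'm : Measurable T' := by
    refine measurable_pi_lambda _ fun i => ?_
    refine Fin.cases ?_ (fun i => ?_) i
    · simpa [hT'] using hτ'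
    · simp only [hT', Fin.cons_succ]
      exact (measurable_pi_apply i).comp (hT.measurable.comp hmt)
  set d0 : (Fin (k + 1) → ℝ) → ℝ := fun x => (F x / marginal F (Fin.tail x)) /
    (G (T' x) / marginal G (T (Fin.tail x))) with hd0
  refine ⟨T', Fin.cons d0 fun i x => D i (Fin.tail x), hT'm, ?_, ?_, ?_, ?_, ?_, ?_⟩
  · refine Fin.cases ?_ fun i => ?_
    · simp only [Fin.cons_zero, hd0]
      exact (hF.continuous.measurable.div (hF.marginal.continuous.measurable.comp hmt)).div
        ((hG.continuous.measurable.comp hT'm).div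
          (hG.marginal.continuous.measurable.comp (hT.measurable.comp hmt)))
    · simp only [Fin.cons_succ]
      exact (hT.measurable_deriv i).comp hmt
  · refine Fin.cases ?_ fun i => ?_
    · intro x
      simp only [Fin.cons_zero, hd0]
      exact div_pos (div_pos (hF.pos _) (hF.marginal.pos _))
        (div_pos (hG.pos _) (hG.marginal.pos _))
    · intro x
      simpa using hT.deriv_pos i (Fin.tail x)
  · refine Fin.cases ?_ fun i => ?_
    · intro x
      have h := hdτ (Fin.tail x) (x 0)
      simpa [hT', hd0] using h
    · intro x
      have h := hT.hasDerivAt i (Fin.tail x)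
      simp only [hT', Fin.tail_update_succ, Fin.cons_succ]
      exact h
  · refine Fin.cases ?_ fun i => ?_
    · intro x
      have hu : Continuous fun t => Function.update x 0 t := continuous_const.update 0 continuous_id
      have h1 : Continuous fun t => F (Function.update x 0 t) := hF.continuous.comp hu
      have h2 : Continuous fun t => G (T' (Function.update x 0 t)) := by
        refine hG.continuous.comp ?_
        simp only [hT', Fin.tail_update_zero, Function.update_self]
        exact KnotheDensity.continuous_cons.comp
          ((continuous_rearr (hF.lineDensity _) (hG.lineDensity _)).prodMk continuous_const)
      simp only [Fin.cons_zero, hd0, Fin.tail_update_zero]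
      exact (h1.div_const _).div (h2.div_const _)
        fun t => (div_pos (hG.pos _) (hG.marginal.pos _)).ne'
    · intro x
      simpa [Fin.tail_update_succ] using hT.continuous_deriv i (Fin.tail x)
  · intro x
    rw [Fin.prod_univ_succ]
    simp only [Fin.cons_zero, Fin.cons_succ]
    have h := hT.prod_deriv (Fin.tail x)
    have h1 := (hG.pos (T' x)).ne'
    have h2 := (hG.marginal.pos (T (Fin.tail x))).ne'
    have h3 := (hF.marginal.pos (Fin.tail x)).ne'
    simp only [hd0]
    have h4 : (∏ i, D i (Fin.tail x)) ≠ 0 := Finset.prod_ne_zero_iff.2 fun i _ =>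
      (hT.deriv_pos i _).ne'
    rw [← h]
    field_simp
  · intro h hh
    have hcm : ∀ (P : (Fin (k + 1) → ℝ) → ℝ), KnotheDensity P → ∀ x : Fin k → ℝ, ∀ g : ℝ → ENNReal,
        Measurable g → ∫⁻ t, g t * ENNReal.ofReal (P (Fin.cons t x)) =
        (∫⁻ t, g t * ENNReal.ofReal (P (Fin.cons t x) / ∫ s, P (Fin.cons s x))) *
          ENNReal.ofReal (marginal P x) := by
      intro P hP x g hg
      have hm := (hP.lineDensity x).continuous.measurable
      have hm2 : Measurable fun t => g t *
          ENNReal.ofReal (P (Fin.cons t x) / ∫ s, P (Fin.cons s x)) :=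
        hg.mul (hm.div_const _).ennreal_ofReal
      rw [← lintegral_mul_const _ hm2]
      refine lintegral_congr fun t => ?_
      have h1 := (hP.marginal.pos x)
      rw [mul_assoc, ← ENNReal.ofReal_mul (div_pos (hP.pos _) (hP.lineDensity x).integral_pos).le]
      congr 2
      exact (div_mul_cancel₀ _ h1.ne').symm
    have hcons : Measurable fun z : ℝ × (Fin k → ℝ) => h (Fin.cons z.1 z.2) :=
      hh.comp KnotheDensity.continuous_cons.measurable
    rw [lintegral_cons (fun x => h (T' x) * ENNReal.ofReal (F x))
        ((hh.comp hT'm).mul hF.continuous.measurable.ennreal_ofReal),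
      lintegral_cons (fun x => h x * ENNReal.ofReal (G x))
        (hh.mul hG.continuous.measurable.ennreal_ofReal)]
    have e1 : ∀ x : Fin k → ℝ, ∫⁻ t, h (T' (Fin.cons t x)) * ENNReal.ofReal (F (Fin.cons t x)) =
        (∫⁻ s, h (Fin.cons s (T x)) * ENNReal.ofReal (G (Fin.cons s (T x)) /
          ∫ s, G (Fin.cons s (T x)))) * ENNReal.ofReal (marginal F x) := by
      intro x
      simp only [hT', Fin.tail_cons, Fin.cons_zero]
      rw [hcm F hF x (fun t => h (Fin.cons (τ x t) (T x)))
        (hcons.comp ((continuous_rearr (hF.lineDensity x)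
          (hG.lineDensity (T x))).measurable.prodMk measurable_const))]
      rw [lintegral_comp_rearr (hF.lineDensity x) (hG.lineDensity (T x))
        (fun s => h (Fin.cons s (T x)))]
    simp_rw [e1]
    rw [hT.lintegral_comp (fun y => ∫⁻ s, h (Fin.cons s y) * ENNReal.ofReal (G (Fin.cons s y) /
          ∫ s, G (Fin.cons s y)))]
    · refine lintegral_congr fun y => ?_
      rw [hcm G hG y (fun s => h (Fin.cons s y)) (hcons.comp measurable_prodMk_right)]
    · refine Measurable.lintegral_prod_right' (ν := volume) (f := fun z : (Fin k → ℝ) × ℝ =>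
        h (Fin.cons z.2 z.1) * ENNReal.ofReal (G (Fin.cons z.2 z.1) /
          ∫ s, G (Fin.cons s z.1))) ?_
      refine (hcons.comp measurable_swap).mul (Measurable.ennreal_ofReal ?_)
      exact Measurable.div hGc (hG.marginal.continuous.measurable.comp measurable_fst)

/-- Existence of the Knothe map. -/
theorem exists_isTriangularTransport : ∀ {k : ℕ} {F G : (Fin k → ℝ) → ℝ}, KnotheDensity F →
    KnotheDensity G → ∫ x, F x = ∫ y, G y → ∃ T D, IsTriangularTransport F G T D := by
  intro k
  induction k with
  | zero =>
    intro F G _ _ h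
    have e : F = G := by
      have h' : ∀ P : (Fin 0 → ℝ) → ℝ, ∫ x, P x = P default := fun P => by
        simp only [Measure.volume_pi_eq_dirac (default : Fin 0 → ℝ), integral_dirac]
      rw [h', h'] at h
      funext x
      rwa [Subsingleton.elim x default]
    subst e
    exact ⟨id, fun i => i.elim0, measurable_id, fun i => i.elim0, fun i => i.elim0,
      fun i => i.elim0, fun i => i.elim0, fun x => by simp, fun _ _ => rfl⟩
  | succ k ih =>
    intro F G hF hG h
    obtain ⟨T, D, hT⟩ := ih hF.marginal hG.marginal
      (by rw [integral_marginal hF, integral_marginal hG, h])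
    exact isTriangularTransport_cons hF hG hT

/-! ### Integration by parts against an increasing function -/

/-- A smooth cutoff function on the line: it takes values in `[0, 1]` and equals `1` near `0`. -/
theorem exists_line_cutoff : ∃ χ : ℝ → ℝ, ContDiff ℝ 1 χ ∧ HasCompactSupport χ ∧
    (∀ t, 0 ≤ χ t) ∧ (∀ t, χ t ≤ 1) ∧ (∀ t, |t| ≤ 1 → χ t = 1) ∧ ∃ C, ∀ t, |deriv χ t| ≤ C := by
  let b : ContDiffBump (0 : ℝ) := ⟨1, 2, one_pos, one_lt_two⟩
  have hd : ContDiff ℝ 1 b := b.contDiff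
  refine ⟨b, hd, b.hasCompactSupport, fun _ => b.nonneg, fun _ => b.le_one, fun t ht => ?_, ?_⟩
  · exact b.one_of_mem_closedBall (by simpa using ht)
  · have hc : Continuous (deriv b) := hd.continuous_deriv le_rfl
    obtain ⟨C, hC⟩ := hc.bounded_above_of_compact_support b.hasCompactSupport.deriv
    exact ⟨C, fun t => hC t⟩

/-- For an increasing `S` and a nonnegative weight `w`, integration by parts has no boundary terms
as soon as `S * w` and `S * w'` are integrable, and `S' * w` is then integrable too. -/
theorem lintegral_deriv_mul_le {S D w w' : ℝ → ℝ} (hS : ∀ t, HasDerivAt S (D t) t)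
    (hD : Continuous D) (hD0 : ∀ t, 0 ≤ D t) (hw : ∀ t, HasDerivAt w (w' t) t)
    (hw' : Continuous w') (hw0 : ∀ t, 0 ≤ w t) (h1 : Integrable fun t => S t * w t)
    (h2 : Integrable fun t => S t * w' t) :
    0 ≤ ∫ t, -(S t * w' t) ∧
      ∫⁻ t, ENNReal.ofReal (D t * w t) ≤ ENNReal.ofReal (∫ t, -(S t * w' t)) := by
  obtain ⟨χ, hχ, hχc, hχ0, hχ1, hχone, C, hC⟩ := exists_line_cutoff
  have hSc : Continuous S := continuous_iff_continuousAt.2 fun t => (hS t).continuousAt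
  have hwc : Continuous w := continuous_iff_continuousAt.2 fun t => (hw t).continuousAt
  set a : ℕ → ℝ := fun k => ((k : ℝ) + 1)⁻¹ with ha
  have ha0 : ∀ k, 0 < a k := fun k => by positivity
  have ha1 : ∀ k, a k ≤ 1 := fun k => inv_le_one_of_one_le₀ (by simp)
  have halim : Tendsto a atTop (𝓝 0) := by
    simpa [ha] using tendsto_one_div_add_atTop_nhds_zero_nat (𝕜 := ℝ)
  set g : ℕ → ℝ → ℝ := fun k t => χ (t * a k) with hg
  have hgd : ∀ k t, HasDerivAt (g k) (deriv χ (t * a k) * a k) t := by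
    intro k t
    have := (hχ.differentiable one_ne_zero (t * a k)).hasDerivAt.comp t
      ((hasDerivAt_id t).mul_const (a k))
    rw [one_mul] at this
    exact this
  have hgc : ∀ k, Continuous (g k) := fun k => hχ.continuous.comp (by fun_prop)
  have hgdc : ∀ k, Continuous fun t => deriv χ (t * a k) * a k := fun k =>
    ((hχ.continuous_deriv le_rfl).comp (by fun_prop)).mul continuous_const
  have hgs : ∀ k, HasCompactSupport (g k) := fun k =>
    hχc.comp_homeomorph (Homeomorph.mulRight₀ (a k) (ha0 k).ne')
  have hgds : ∀ k, HasCompactSupport fun t => deriv χ (t * a k) * a k := fun k =>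
    (hχc.deriv.comp_homeomorph (Homeomorph.mulRight₀ (a k) (ha0 k).ne')).mul_right
  have hone : ∀ t, ∀ᶠ k in atTop, |t * a k| ≤ 1 := by
    intro t
    have : Tendsto (fun k => |t * a k|) atTop (𝓝 0) := by
      simpa using (halim.const_mul t).abs
    exact (this.eventually (gt_mem_nhds one_pos)).mono fun _ h => h.le
  -- integration by parts against the truncated weight
  have hparts : ∀ k, ∫ t, D t * (g k t * w t) =
      ∫ t, (-(S t * w' t) * g k t - S t * w t * (deriv χ (t * a k) * a k)) := by
    intro k
    have hv : ∀ t, HasDerivAt (fun t => g k t * w t)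
        (deriv χ (t * a k) * a k * w t + g k t * w' t) t := fun t => (hgd k t).mul (hw t)
    have hsupp : HasCompactSupport fun t => g k t * w t := (hgs k).mul_right
    have hsupp' : HasCompactSupport fun t =>
        deriv χ (t * a k) * a k * w t + g k t * w' t :=
      ((hgds k).mul_right (f' := w)).add ((hgs k).mul_right (f' := w'))
    have e := integral_mul_deriv_eq_deriv_mul_of_integrable (u := S) (u' := D)
      (v := fun t => g k t * w t) (v' := fun t => deriv χ (t * a k) * a k * w t + g k t * w' t)
      (fun t _ => hS t) (fun t _ => hv t)
      ((hSc.mul (((hgdc k).mul hwc).add ((hgc k).mul hw'))).integrable_of_hasCompactSupport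
        hsupp'.mul_left)
      ((hD.mul ((hgc k).mul hwc)).integrable_of_hasCompactSupport hsupp.mul_left)
      ((hSc.mul ((hgc k).mul hwc)).integrable_of_hasCompactSupport hsupp.mul_left)
    rw [← neg_inj, ← e, ← integral_neg]
    refine integral_congr_ae (ae_of_all _ fun t => ?_)
    ring
  have hlim : Tendsto (fun k => ∫ t, D t * (g k t * w t)) atTop (𝓝 (∫ t, -(S t * w' t))) := by
    simp_rw [hparts]
    refine tendsto_integral_of_dominated_convergence
      (fun t => |S t * w' t| + |S t * w t| * C) ?_ (h2.abs.add (h1.abs.mul_const C)) ?_ ?_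
    · intro k
      exact ((((hSc.mul hw').neg).mul (hgc k)).sub ((hSc.mul hwc).mul
        (hgdc k))).aestronglyMeasurable
    · intro k
      refine ae_of_all _ fun t => ?_
      rw [Real.norm_eq_abs]
      refine (abs_sub _ _).trans (add_le_add ?_ ?_)
      · rw [abs_mul, abs_neg]
        refine mul_le_of_le_one_right (abs_nonneg _) ?_
        rw [abs_of_nonneg (hχ0 _)]
        exact hχ1 _
      · rw [abs_mul]
        refine mul_le_mul_of_nonneg_left ?_ (abs_nonneg _)
        rw [abs_mul, abs_of_pos (ha0 k)]
        calc |deriv χ (t * a k)| * a k ≤ |deriv χ (t * a k)| * 1 :=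
              mul_le_mul_of_nonneg_left (ha1 k) (abs_nonneg _)
          _ ≤ C := by rw [mul_one]; exact hC _
    · refine ae_of_all _ fun t => ?_
      have e1 : Tendsto (fun k => g k t) atTop (𝓝 1) :=
        tendsto_const_nhds.congr' ((hone t).mono fun k hk => (hχone _ hk).symm)
      have e2 : Tendsto (fun k => deriv χ (t * a k) * a k) atTop (𝓝 0) := by
        refine squeeze_zero_norm (fun k => ?_) (by simpa using halim.const_mul C)
        rw [Real.norm_eq_abs, abs_mul, abs_of_pos (ha0 k)]
        exact mul_le_mul_of_nonneg_right (hC _) (ha0 k).le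
      simpa using (e1.const_mul (-(S t * w' t))).sub (e2.const_mul (S t * w t))
  refine ⟨ge_of_tendsto' hlim fun k => integral_nonneg fun t =>
    mul_nonneg (hD0 t) (mul_nonneg (hχ0 _) (hw0 t)), ?_⟩
  calc ∫⁻ t, ENNReal.ofReal (D t * w t)
      ≤ ∫⁻ t, liminf (fun k => ENNReal.ofReal (D t * (g k t * w t))) atTop := by
        refine lintegral_mono fun t => ?_
        refine (Tendsto.liminf_eq ?_).ge
        refine tendsto_const_nhds.congr' ((hone t).mono fun k hk => ?_)
        simp only [hg, hχone _ hk, one_mul]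
    _ ≤ liminf (fun k => ∫⁻ t, ENNReal.ofReal (D t * (g k t * w t))) atTop :=
        lintegral_liminf_le fun k => (hD.mul ((hgc k).mul hwc)).measurable.ennreal_ofReal
    _ = ENNReal.ofReal (∫ t, -(S t * w' t)) := by
        refine Tendsto.liminf_eq ?_
        refine (ENNReal.tendsto_ofReal hlim).congr fun k => ?_
        rw [ofReal_integral_eq_lintegral_ofReal]
        · exact (hD.mul ((hgc k).mul hwc)).integrable_of_hasCompactSupport
            ((hgs k).mul_right (f' := w)).mul_left
        · exact ae_of_all _ fun t => mul_nonneg (hD0 t) (mul_nonneg (hχ0 _) (hw0 t))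

/-- Integration by parts in one of several variables, for a function increasing in it. -/
theorem lintegral_lintegral_deriv_mul_le {X : Type*} [MeasurableSpace X] {μ : Measure X}
    [SFinite μ] {S D w w' : X → ℝ → ℝ} (hS : ∀ x t, HasDerivAt (S x) (D x t) t)
    (hD : ∀ x, Continuous (D x)) (hD0 : ∀ x t, 0 ≤ D x t) (hw : ∀ x t, HasDerivAt (w x) (w' x t) t)
    (hw' : ∀ x, Continuous (w' x)) (hw0 : ∀ x t, 0 ≤ w x t)
    (h1 : ∀ᵐ x ∂μ, Integrable fun t => S x t * w x t)
    (h2 : Integrable (fun z : ℝ × X => S z.2 z.1 * w' z.2 z.1) (volume.prod μ)) :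
    0 ≤ ∫ z : ℝ × X, -(S z.2 z.1 * w' z.2 z.1) ∂(volume.prod μ) ∧
    ∫⁻ x, (∫⁻ t, ENNReal.ofReal (D x t * w x t)) ∂μ ≤
      ENNReal.ofReal (∫ z : ℝ × X, -(S z.2 z.1 * w' z.2 z.1) ∂(volume.prod μ)) := by
  have hle : ∀ᵐ x ∂μ, 0 ≤ ∫ t, -(S x t * w' x t) ∧ ∫⁻ t, ENNReal.ofReal (D x t * w x t) ≤
      ENNReal.ofReal (∫ t, -(S x t * w' x t)) := by
    filter_upwards [h1, h2.prod_left_ae] with x hx1 hx2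
    exact lintegral_deriv_mul_le (hS x) (hD x) (hD0 x) (hw x) (hw' x) (hw0 x) hx1 hx2
  have hn : Integrable (fun z : ℝ × X => -(S z.2 z.1 * w' z.2 z.1)) (volume.prod μ) := h2.neg
  refine ⟨?_, (lintegral_mono_ae (hle.mono fun x h => h.2)).trans_eq ?_⟩
  · rw [integral_prod_symm _ hn]
    exact integral_nonneg_of_ae (hle.mono fun x h => h.1)
  rw [integral_prod_symm _ hn, ofReal_integral_eq_lintegral_ofReal hn.integral_prod_right]
  exact hle.mono fun x h => h.1

theorem update_insertNth_self {m : ℕ} (i : Fin (m + 1)) (s t : ℝ) (x : Fin m → ℝ) :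
    Function.update (i.insertNth s x : Fin (m + 1) → ℝ) i t = i.insertNth t x := by
  ext j
  refine Fin.succAboveCases i ?_ (fun j => ?_) j <;> simp

theorem lintegral_coord_succ_deriv_mul_le {m : ℕ} (i : Fin (m + 1)) {S D w w' : (Fin (m + 1) → ℝ) → ℝ}
    (hS : ∀ x, HasDerivAt (fun t => S (Function.update x i t)) (D x) (x i))
    (hDm : Measurable D) (hwm : Measurable w)
    (hD : ∀ x, Continuous fun t => D (Function.update x i t)) (hD0 : ∀ x, 0 ≤ D x)
    (hw : ∀ x, HasDerivAt (fun t => w (Function.update x i t)) (w' x) (x i))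
    (hw' : ∀ x, Continuous fun t => w' (Function.update x i t)) (hw0 : ∀ x, 0 ≤ w x)
    (h1 : ∀ᵐ x : Fin m → ℝ, Integrable fun t : ℝ => S (i.insertNth t x) * w (i.insertNth t x))
    (h2 : Integrable fun x => S x * w' x) :
    0 ≤ ∫ x, -(S x * w' x) ∧
      ∫⁻ x, ENNReal.ofReal (D x * w x) ≤ ENNReal.ofReal (∫ x, -(S x * w' x)) := by
  have hmp := (volume_preserving_piFinSuccAbove (fun _ : Fin (m + 1) => ℝ) i).symm
  have happ : ∀ z : ℝ × (Fin m → ℝ),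
      (MeasurableEquiv.piFinSuccAbove (fun _ : Fin (m + 1) => ℝ) i).symm z =
      i.insertNth z.1 z.2 := fun z => rfl
  have hm : Measurable fun x => ENNReal.ofReal (D x * w x) := (hDm.mul hwm).ennreal_ofReal
  have h2' := (hmp.integrable_comp_emb (MeasurableEquiv.measurableEmbedding _)).2 h2
  rw [← hmp.lintegral_comp hm, ← hmp.integral_comp' (fun x => -(S x * w' x))]
  rw [Measure.volume_eq_prod] at h2' ⊢
  rw [lintegral_prod_symm (fun z => ENNReal.ofReal
    (D ((MeasurableEquiv.piFinSuccAbove (fun _ : Fin (m + 1) => ℝ) i).symm z) *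
      w ((MeasurableEquiv.piFinSuccAbove (fun _ : Fin (m + 1) => ℝ) i).symm z)))
    (hm.comp hmp.measurable).aemeasurable]
  have hd : ∀ (P P' : (Fin (m + 1) → ℝ) → ℝ),
      (∀ x, HasDerivAt (fun t => P (Function.update x i t)) (P' x) (x i)) →
      ∀ (x : Fin m → ℝ) (t : ℝ), HasDerivAt (fun t => P (i.insertNth t x : Fin (m + 1) → ℝ))
        (P' (i.insertNth t x : Fin (m + 1) → ℝ)) t := by
    intro P P' h x t
    have := h (i.insertNth t x : Fin (m + 1) → ℝ)
    simpa only [update_insertNth_self, Fin.insertNth_apply_same] using this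
  have hc : ∀ (P : (Fin (m + 1) → ℝ) → ℝ),
      (∀ x, Continuous (fun t => P (Function.update x i t))) →
      ∀ (x : Fin m → ℝ), Continuous (fun t : ℝ => P (i.insertNth t x : Fin (m + 1) → ℝ)) := by
    intro P h x
    have := h (i.insertNth 0 x : Fin (m + 1) → ℝ)
    simpa only [update_insertNth_self] using this
  exact lintegral_lintegral_deriv_mul_le (μ := (volume : Measure (Fin m → ℝ)))
    (S := fun x t => S (i.insertNth t x)) (D := fun x t => D (i.insertNth t x))
    (w := fun x t => w (i.insertNth t x)) (w' := fun x t => w' (i.insertNth t x))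
    (hd S D hS) (hc D hD) (fun x t => hD0 _) (hd w w' hw) (hc w' hw') (fun x t => hw0 _) h1 h2'

/-- Integration by parts in the `i`-th coordinate of `ℝ^n`, for a function `S` increasing in it and
a weight `w = v * f`, where `S * v` is square integrable and so is `f` on lines. -/
theorem lintegral_coord_deriv_mul_le {n : ℕ} (i : Fin n) {S D w w' v f : (Fin n → ℝ) → ℝ}
    (hS : ∀ x, HasDerivAt (fun t => S (Function.update x i t)) (D x) (x i))
    (hDm : Measurable D) (hwm : Measurable w)
    (hD : ∀ x, Continuous fun t => D (Function.update x i t)) (hD0 : ∀ x, 0 ≤ D x)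
    (hw : ∀ x, HasDerivAt (fun t => w (Function.update x i t)) (w' x) (x i))
    (hw' : ∀ x, Continuous fun t => w' (Function.update x i t)) (hw0 : ∀ x, 0 ≤ w x)
    (hwv : ∀ x, w x = v x * f x) (h1 : Integrable fun x => (S x * v x) ^ 2)
    (hf : ∀ x, Integrable fun t => f (Function.update x i t) ^ 2)
    (h2 : Integrable fun x => S x * w' x) :
    0 ≤ ∫ x, -(S x * w' x) ∧
      ∫⁻ x, ENNReal.ofReal (D x * w x) ≤ ENNReal.ofReal (∫ x, -(S x * w' x)) := by
  cases n with
  | zero => exact i.elim0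
  | succ m =>
    refine lintegral_coord_succ_deriv_mul_le i hS hDm hwm hD hD0 hw hw' hw0 ?_ h2
    have hmp := (volume_preserving_piFinSuccAbove (fun _ : Fin (m + 1) => ℝ) i).symm
    have h1' := (hmp.integrable_comp_emb (MeasurableEquiv.measurableEmbedding _)).2 h1
    rw [Measure.volume_eq_prod] at h1'
    filter_upwards [h1'.prod_left_ae] with x hx
    have hx' : Integrable fun t : ℝ => (S (i.insertNth t x) * v (i.insertNth t x)) ^ 2 := hx
    have hfx : Integrable fun t : ℝ => f (i.insertNth t x) ^ 2 := by
      have := hf (i.insertNth 0 x : Fin (m + 1) → ℝ)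
      simpa only [update_insertNth_self] using this
    have hSc : Continuous fun t : ℝ => S (i.insertNth t x) := by
      refine continuous_iff_continuousAt.2 fun t => ?_
      have := (hS (i.insertNth t x : Fin (m + 1) → ℝ)).continuousAt
      simpa only [update_insertNth_self, Fin.insertNth_apply_same] using this
    have hwc : Continuous fun t : ℝ => w (i.insertNth t x) := by
      refine continuous_iff_continuousAt.2 fun t => ?_
      have := (hw (i.insertNth t x : Fin (m + 1) → ℝ)).continuousAt
      simpa only [update_insertNth_self, Fin.insertNth_apply_same] using this
    refine Integrable.mono' (hx'.add hfx) (hSc.mul hwc).aestronglyMeasurable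
      (ae_of_all _ fun t => ?_)
    rw [hwv, Real.norm_eq_abs, ← mul_assoc, abs_le]
    simp only [Pi.add_apply]
    generalize S (i.insertNth t x) * v (i.insertNth t x) = a
    generalize f (i.insertNth t x) = b
    constructor <;> nlinarith [sq_nonneg (a + b), sq_nonneg (a - b), sq_nonneg a, sq_nonneg b]

/-! ### Integrals of powers of `1 + ‖x‖²` -/

theorem integrable_inv_one_add_sq_pow {n k : ℕ} (h : n < 2 * k) :
    Integrable fun x : EuclideanSpace ℝ (Fin n) => ((1 + ‖x‖ ^ 2) ^ k)⁻¹ := by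
  have := integrable_rpow_neg_one_add_norm_sq (E := EuclideanSpace ℝ (Fin n))
    (μ := volume) (r := 2 * k) (by simpa using (by exact_mod_cast h : (n : ℝ) < 2 * k))
  refine this.congr (ae_of_all _ fun x => ?_)
  simp only
  rw [neg_div, mul_div_cancel_left₀ _ two_ne_zero, Real.rpow_neg (by positivity),
    Real.rpow_natCast]

theorem one_add_sq_prod_le {n : ℕ} (y : Fin n → ℝ) :
    ∏ i, (1 + y i ^ 2) ≤ (1 + ‖(WithLp.toLp 2 y : EuclideanSpace ℝ (Fin n))‖ ^ 2) ^ n := by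
  calc ∏ i, (1 + y i ^ 2)
      ≤ ∏ _i : Fin n, (1 + ‖(WithLp.toLp 2 y : EuclideanSpace ℝ (Fin n))‖ ^ 2) := by
        refine Finset.prod_le_prod (fun i _ => by positivity) fun i _ => ?_
        rw [EuclideanSpace.norm_sq_eq]
        have := Finset.single_le_sum (f := fun j => ‖y j‖ ^ 2) (fun j _ => by positivity)
          (Finset.mem_univ i)
        simp only [Real.norm_eq_abs, sq_abs] at this ⊢
        linarith
    _ = _ := by simp

theorem hasDerivAt_comp_update {n : ℕ} {f : EuclideanSpace ℝ (Fin n) → ℝ} (hf : Differentiable ℝ f)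
    (i : Fin n) (x : Fin n → ℝ) :
    HasDerivAt (fun t => f (WithLp.toLp 2 (Function.update x i t)))
      (fderiv ℝ f (WithLp.toLp 2 x) (EuclideanSpace.single i 1)) (x i) := by
  have e : ∀ t : ℝ, (WithLp.toLp 2 (Function.update x i t) : EuclideanSpace ℝ (Fin n)) =
      WithLp.toLp 2 x + (t - x i) • EuclideanSpace.single i (1 : ℝ) := by
    intro t
    ext j
    by_cases h : j = i
    · subst h; simp
    · simp [h]
  simp_rw [e]
  have h1 : HasDerivAt (fun t : ℝ => (WithLp.toLp 2 x : EuclideanSpace ℝ (Fin n)) +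
      (t - x i) • EuclideanSpace.single i (1 : ℝ)) (EuclideanSpace.single i 1) (x i) := by
    have := (((hasDerivAt_id (x i)).sub_const (x i)).smul_const
      (EuclideanSpace.single i (1 : ℝ))).const_add (WithLp.toLp 2 x : EuclideanSpace ℝ (Fin n))
    simpa using this
  have h2 := (hf (WithLp.toLp 2 x + (x i - x i) • EuclideanSpace.single i (1 : ℝ))).hasFDerivAt
  have := h2.comp_hasDerivAt (x i) h1
  simp only [sub_self, zero_smul, add_zero] at this
  exact this

/-! ### The sharp Sobolev inequality by mass transport -/

/-- `∫ (1 + |x|²)^{-N}`. -/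
def bubbleMass (N : ℕ) : ℝ := ∫ x : EuclideanSpace ℝ (Fin N), ((1 + ‖x‖ ^ 2) ^ N)⁻¹

/-- `∫ |x|² (1 + |x|²)^{-N}`. -/
def bubbleMoment (N : ℕ) : ℝ := ∫ x : EuclideanSpace ℝ (Fin N), ‖x‖ ^ 2 * ((1 + ‖x‖ ^ 2) ^ N)⁻¹

section

variable {N : ℕ}

theorem integrable_bubbleMass (hN : 3 ≤ N) :
    Integrable fun x : EuclideanSpace ℝ (Fin N) => ((1 + ‖x‖ ^ 2) ^ N)⁻¹ :=
  integrable_inv_one_add_sq_pow (by omega)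

theorem sq_mul_inv_pow_eq (hN : 3 ≤ N) (x : EuclideanSpace ℝ (Fin N)) :
    ‖x‖ ^ 2 * ((1 + ‖x‖ ^ 2) ^ N)⁻¹ = ((1 + ‖x‖ ^ 2) ^ (N - 1))⁻¹ - ((1 + ‖x‖ ^ 2) ^ N)⁻¹ := by
  obtain ⟨m, rfl⟩ : ∃ m, N = m + 1 := ⟨N - 1, by omega⟩
  have : (1 + ‖x‖ ^ 2) ≠ 0 := by positivity
  simp only [Nat.add_sub_cancel, pow_succ (1 + ‖x‖ ^ 2)]
  field_simp
  ring

theorem integrable_bubbleMoment (hN : 3 ≤ N) :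
    Integrable fun x : EuclideanSpace ℝ (Fin N) => ‖x‖ ^ 2 * ((1 + ‖x‖ ^ 2) ^ N)⁻¹ := by
  simp_rw [sq_mul_inv_pow_eq hN]
  exact (integrable_inv_one_add_sq_pow (by omega)).sub (integrable_bubbleMass hN)

theorem integral_inv_one_add_sq_pow_pred (hN : 3 ≤ N) :
    ∫ x : EuclideanSpace ℝ (Fin N), ((1 + ‖x‖ ^ 2) ^ (N - 1))⁻¹ =
      bubbleMass N + bubbleMoment N := by
  have h : bubbleMoment N = (∫ x : EuclideanSpace ℝ (Fin N), ((1 + ‖x‖ ^ 2) ^ (N - 1))⁻¹) -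
      bubbleMass N := by
    rw [bubbleMoment, bubbleMass, ← integral_sub (integrable_inv_one_add_sq_pow (by omega))
      (integrable_bubbleMass hN)]
    simp_rw [sq_mul_inv_pow_eq hN]
  linarith

theorem bubbleMass_pos (hN : 3 ≤ N) : 0 < bubbleMass N := by
  rw [bubbleMass, integral_pos_iff_support_of_nonneg (fun x => by positivity)
    (integrable_bubbleMass hN)]
  have : (Function.support fun x : EuclideanSpace ℝ (Fin N) => ((1 + ‖x‖ ^ 2) ^ N)⁻¹) = univ := by
    ext x
    have : ((1 + ‖x‖ ^ 2) ^ N)⁻¹ ≠ 0 := by positivity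
    simpa using this
  rw [this]
  exact isOpen_univ.measure_pos _ univ_nonempty

/-- The derivative of `r^N (1 + r²)^{-(N-1)}`, integrated over the half-line, links the two
moments. -/
theorem bubbleMass_eq (hN : 3 ≤ N) : N * bubbleMass N = (N - 2) * bubbleMoment N := by
  have : _root_.Nontrivial (EuclideanSpace ℝ (Fin N)) := by
    have : Nonempty (Fin N) := ⟨⟨0, by omega⟩⟩
    infer_instance
  obtain ⟨m, rfl⟩ : ∃ m, N = m + 1 := ⟨N - 1, by omega⟩
  set g : ℝ → ℝ := fun r => ((m + 1 : ℕ) : ℝ) * ((1 + r ^ 2) ^ (m + 1))⁻¹ -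
    (((m + 1 : ℕ) : ℝ) - 2) * (r ^ 2 * ((1 + r ^ 2) ^ (m + 1))⁻¹) with hg
  have hgi : Integrable (fun x : EuclideanSpace ℝ (Fin (m + 1)) => g ‖x‖) :=
    ((integrable_bubbleMass hN).const_mul _).sub ((integrable_bubbleMoment hN).const_mul _)
  have e : ∫ x : EuclideanSpace ℝ (Fin (m + 1)), g ‖x‖ =
      ((m + 1 : ℕ) : ℝ) * bubbleMass (m + 1) -
        (((m + 1 : ℕ) : ℝ) - 2) * bubbleMoment (m + 1) := by
    simp only [hg]
    rw [integral_sub ((integrable_bubbleMass hN).const_mul _)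
      ((integrable_bubbleMoment hN).const_mul _), integral_const_mul, integral_const_mul]
    rfl
  suffices h : ∫ x : EuclideanSpace ℝ (Fin (m + 1)), g ‖x‖ = 0 by
    rw [e] at h; linarith
  have hgi2 := (integrable_fun_norm_addHaar (μ := volume)
    (E := EuclideanSpace ℝ (Fin (m + 1)))).1 hgi
  rw [integral_fun_norm_addHaar]
  simp only [finrank_euclideanSpace, Fintype.card_fin, Nat.add_sub_cancel, smul_eq_mul] at hgi2 ⊢
  have hd : ∀ r : ℝ, HasDerivAt (fun r : ℝ => r ^ (m + 1) * ((1 + r ^ 2) ^ m)⁻¹)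
      (r ^ m * g r) r := by
    intro r
    have hpos : (1 + r ^ 2) ≠ 0 := by positivity
    have h1 : HasDerivAt (fun r : ℝ => (1 + r ^ 2) ^ m) (m * (1 + r ^ 2) ^ (m - 1) * (2 * r)) r := by
      have := (((hasDerivAt_pow 2 r).const_add 1).fun_pow m)
      simpa using this
    have h2 := (hasDerivAt_pow (m + 1) r).fun_mul (h1.fun_inv (pow_ne_zero m hpos))
    refine h2.congr_deriv ?_
    simp only [hg]
    obtain ⟨l, rfl⟩ : ∃ l, m = l + 1 := ⟨m - 1, by omega⟩
    simp only [Nat.add_sub_cancel]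
    push_cast
    field_simp
    ring
  have hlim : Tendsto (fun r : ℝ => r ^ (m + 1) * ((1 + r ^ 2) ^ m)⁻¹) atTop (𝓝 0) := by
    refine squeeze_zero' (g := fun r : ℝ => r⁻¹) ?_ ?_ tendsto_inv_atTop_zero
    · filter_upwards [eventually_gt_atTop 0] with r hr
      positivity
    · filter_upwards [eventually_gt_atTop 1] with r hr
      have hr0 : 0 < r := by linarith
      rw [← div_eq_mul_inv, div_le_iff₀ (by positivity), inv_mul_eq_div, le_div_iff₀ hr0]
      calc r ^ (m + 1) * r = r ^ (m + 2) := by ring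
        _ ≤ r ^ (2 * m) := pow_le_pow_right₀ hr.le (by omega)
        _ = (r ^ 2) ^ m := by rw [pow_mul]
        _ ≤ (1 + r ^ 2) ^ m := by gcongr; linarith
  have := integral_Ioi_of_hasDerivAt_of_tendsto (a := 0) (m := 0) (f := fun r : ℝ => r ^ (m + 1) *
    ((1 + r ^ 2) ^ m)⁻¹) (hd 0).continuousAt.continuousWithinAt (fun r _ => hd r) hgi2 hlim
  rw [this]
  simp

theorem bubbleMoment_pos (hN : 3 ≤ N) : 0 < bubbleMoment N := by
  have h := bubbleMass_eq hN
  have h1 := bubbleMass_pos hN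
  have h3 : (3 : ℝ) ≤ N := by exact_mod_cast hN
  by_contra hc
  have : ((N : ℝ) - 2) * bubbleMoment N ≤ 0 :=
    mul_nonpos_of_nonneg_of_nonpos (by linarith) (not_lt.1 hc)
  nlinarith

theorem critExp_pos (hN : 3 ≤ N) : 0 < critExp N := by
  have h3 : (3 : ℝ) ≤ N := by exact_mod_cast hN
  exact div_pos (by linarith) (by linarith)

theorem two_lt_critExp (hN : 3 ≤ N) : 2 < critExp N := by
  have h3 : (3 : ℝ) ≤ N := by exact_mod_cast hN
  rw [critExp, lt_div_iff₀ (by linarith)]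
  linarith

/-- The bubble profile raised to the critical exponent. -/
theorem profile_rpow_critExp (hN : 3 ≤ N) {b : ℝ} (hb : 0 < b) :
    (b ^ (-((N : ℝ) - 2) / 2)) ^ critExp N = (b ^ N)⁻¹ := by
  have h3 : (3 : ℝ) ≤ N := by exact_mod_cast hN
  have : (N : ℝ) - 2 ≠ 0 := by linarith
  rw [← Real.rpow_mul hb.le, ← Real.rpow_natCast, ← Real.rpow_neg hb.le]
  congr 1
  rw [critExp]
  field_simp

/-- The transport estimate behind the sharp Sobolev inequality, before optimisation: it is the
arithmetic-geometric mean inequality for the diagonal derivatives of the Knothe map, followed by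
an integration by parts and Young's inequality with parameter `l`. -/
theorem transport_estimate (hN : 3 ≤ N) {f : EuclideanSpace ℝ (Fin N) → ℝ}
    (hf : ContDiff ℝ 1 f) (hpos : ∀ x, 0 < f x)
    {C : ℝ} (hC : ∀ x, f x ≤ C * (1 + ‖x‖ ^ 2) ^ (-((N : ℝ) - 2) / 2))
    (hgrad : Integrable fun x => ‖fderiv ℝ f x‖ ^ 2) {c : ℝ} (hc0 : 0 < c)
    (hc : ∫ x, f x ^ critExp N = c * bubbleMass N) {l : ℝ} (hl : 0 < l) :
    c ^ (1 - 1 / (N : ℝ)) * (bubbleMass N + bubbleMoment N) ≤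
      (1 / N) * (2 * ((N : ℝ) - 1) / ((N : ℝ) - 2)) *
        (l / 2 * (c * bubbleMoment N) + 1 / (2 * l) * ∫ x, ‖fderiv ℝ f x‖ ^ 2) := by
  have h3 : (3 : ℝ) ≤ N := by exact_mod_cast hN
  have hp := critExp_pos hN
  have hC0 : 0 < C := by
    have := (hpos 0).trans_le (hC 0)
    simpa using this
  set q : ℝ := 2 * ((N : ℝ) - 1) / ((N : ℝ) - 2) with hq
  have hq0 : 0 < q := div_pos (by linarith) (by linarith)
  have hqp : q = critExp N * (1 - 1 / N) := by
    rw [hq, critExp]; field_simp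
  have hq1 : 2 * (q - 1) = critExp N := by
    have : (N : ℝ) - 2 ≠ 0 := by linarith
    rw [hq, critExp]; field_simp; ring
  -- passage to coordinates
  set P : (Fin N → ℝ) → EuclideanSpace ℝ (Fin N) := WithLp.toLp 2 with hP
  have hPc : Continuous P := PiLp.continuous_toLp 2 _
  have hPint : ∀ g : EuclideanSpace ℝ (Fin N) → ℝ, ∫ y, g (P y) = ∫ x, g x := fun g =>
    (PiLp.volume_preserving_toLp (Fin N)).integral_comp
      (MeasurableEquiv.toLp 2 (Fin N → ℝ)).measurableEmbedding g
  have hPi : ∀ g : EuclideanSpace ℝ (Fin N) → ℝ, Integrable g → Integrable fun y => g (P y) :=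
    fun g hg => ((PiLp.volume_preserving_toLp (Fin N)).integrable_comp_emb
      (MeasurableEquiv.toLp 2 (Fin N → ℝ)).measurableEmbedding).2 hg
  set F : (Fin N → ℝ) → ℝ := fun y => f (P y) ^ critExp N with hF
  set G : (Fin N → ℝ) → ℝ := fun y => c * ((1 + ‖P y‖ ^ 2) ^ N)⁻¹ with hG
  have hβ : ∀ x : EuclideanSpace ℝ (Fin N), 0 < 1 + ‖x‖ ^ 2 := fun x => by positivity
  have hprod : ∀ y : Fin N → ℝ, ((1 + ‖P y‖ ^ 2) ^ N)⁻¹ ≤ ∏ i, (1 + y i ^ 2)⁻¹ := by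
    intro y
    rw [Finset.prod_inv_distrib]
    exact inv_anti₀ (Finset.prod_pos fun i _ => by positivity) (one_add_sq_prod_le y)
  have hGK : KnotheDensity G := by
    refine ⟨?_, fun y => by simp only [hG]; positivity, c, fun y => ?_⟩
    · refine continuous_const.mul (Continuous.inv₀ (by fun_prop) fun y => ?_)
      have := hβ (P y); positivity
    · exact mul_le_mul_of_nonneg_left (hprod y) hc0.le
  have hFK : KnotheDensity F := by
    refine ⟨?_, fun y => Real.rpow_pos_of_pos (hpos _) _, C ^ critExp N, fun y => ?_⟩
    · exact (hf.continuous.comp hPc).rpow_const fun y => Or.inl (hpos _).ne'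
    · calc F y ≤ (C * (1 + ‖P y‖ ^ 2) ^ (-((N : ℝ) - 2) / 2)) ^ critExp N :=
          Real.rpow_le_rpow (hpos _).le (hC _) hp.le
        _ = C ^ critExp N * ((1 + ‖P y‖ ^ 2) ^ N)⁻¹ := by
          rw [Real.mul_rpow hC0.le (Real.rpow_nonneg (hβ _).le _),
            profile_rpow_critExp hN (hβ _)]
        _ ≤ _ := mul_le_mul_of_nonneg_left (hprod y) (Real.rpow_nonneg hC0.le _)
  have hGint : ∫ y, G y = c * bubbleMass N := by
    simp only [hG]
    rw [hPint (fun x => c * ((1 + ‖x‖ ^ 2) ^ N)⁻¹), integral_const_mul]; rfl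
  have hFint : ∫ y, F y = c * bubbleMass N := by
    rw [← hc]; exact hPint (fun x => f x ^ critExp N)
  obtain ⟨T, D, hT⟩ := exists_isTriangularTransport hFK hGK (hFint.trans hGint.symm)
  -- the second moment of the transported density
  set A : (Fin N → ℝ) → ℝ := fun y => ‖P (T y)‖ ^ 2 * F y with hA
  have hAmeas : Measurable A :=
    ((hPc.measurable.comp hT.measurable).norm.pow_const 2).mul hFK.continuous.measurable
  have hA0 : ∀ y, 0 ≤ A y := fun y => mul_nonneg (by positivity) (hFK.pos y).le
  have hmomi : Integrable fun y => ‖P y‖ ^ 2 * G y := by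
    have := (hPi _ (integrable_bubbleMoment hN)).const_mul c
    refine this.congr (ae_of_all _ fun y => ?_)
    simp only [hG]; ring
  have hmom : ∫ y, ‖P y‖ ^ 2 * G y = c * bubbleMoment N := by
    rw [bubbleMoment, ← hPint, ← integral_const_mul]
    refine integral_congr_ae (ae_of_all _ fun y => ?_)
    simp only [hG]; ring
  have hAlint : ∫⁻ y, ENNReal.ofReal (A y) = ENNReal.ofReal (c * bubbleMoment N) := by
    rw [← hmom, ofReal_integral_eq_lintegral_ofReal hmomi
      (ae_of_all _ fun y => mul_nonneg (by positivity) (hGK.pos y).le)]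
    have := hT.lintegral_comp (fun y => ENNReal.ofReal (‖P y‖ ^ 2))
      (hPc.measurable.norm.pow_const 2).ennreal_ofReal
    simp only [← ENNReal.ofReal_mul (sq_nonneg _)] at this
    exact this
  have hAi : Integrable A :=
    ⟨hAmeas.aestronglyMeasurable, by
      rw [hasFiniteIntegral_iff_ofReal (ae_of_all _ hA0), hAlint]; exact ENNReal.ofReal_lt_top⟩
  have hAint : ∫ y, A y = c * bubbleMoment N := by
    rw [integral_eq_lintegral_of_nonneg_ae (ae_of_all _ hA0) hAmeas.aestronglyMeasurable, hAlint,
      ENNReal.toReal_ofReal (mul_nonneg hc0.le (bubbleMoment_pos hN).le)]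
  -- the weight and its gradient
  set w : (Fin N → ℝ) → ℝ := fun y => f (P y) ^ q with hw
  set w' : Fin N → (Fin N → ℝ) → ℝ := fun i y =>
    fderiv ℝ f (P y) (EuclideanSpace.single i 1) * q * f (P y) ^ (q - 1) with hw'
  set B : (Fin N → ℝ) → ℝ := fun y => ‖fderiv ℝ f (P y)‖ ^ 2 with hB
  have hBi : Integrable B := hPi _ hgrad
  have hBint : ∫ y, B y = ∫ x, ‖fderiv ℝ f x‖ ^ 2 := hPint (fun x => ‖fderiv ℝ f x‖ ^ 2)
  have hv2 : ∀ y, (f (P y) ^ (q - 1)) ^ 2 = F y := by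
    intro y
    rw [← Real.rpow_natCast, ← Real.rpow_mul (hpos _).le]
    simp only [hF]
    congr 1
    push_cast
    linarith
  have hwd : ∀ i y, HasDerivAt (fun t => w (Function.update y i t)) (w' i y) (y i) := by
    intro i y
    have h1 := hasDerivAt_comp_update (hf.differentiable one_ne_zero) i y
    have h2 := h1.rpow_const (p := q) (Or.inl (hpos _).ne')
    simpa only [Function.update_eq_self] using h2
  have hfd : Continuous fun y => fderiv ℝ f (P y) := (hf.continuous_fderiv one_ne_zero).comp hPc
  have hvc : ∀ r : ℝ, Continuous fun y => f (P y) ^ r := fun r =>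
    (hf.continuous.comp hPc).rpow_const fun y => Or.inl (hpos _).ne'
  have hw'c : ∀ i, Continuous (w' i) := fun i =>
    ((hfd.clm_apply continuous_const).mul continuous_const).mul (hvc _)
  -- Young's inequality
  have hyoung : ∀ (e : ℝ) (_ : 0 < e) (a b : ℝ), a * b ≤ e / 2 * a ^ 2 + 1 / (2 * e) * b ^ 2 := by
    intro e he a b
    have : e / 2 * a ^ 2 + 1 / (2 * e) * b ^ 2 - a * b = (e * a - b) ^ 2 / (2 * e) := by
      field_simp; ring
    have h2 : 0 ≤ (e * a - b) ^ 2 / (2 * e) := by positivity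
    linarith
  have hbound : ∀ y, ∀ v : EuclideanSpace ℝ (Fin N), ‖v‖ ≤ ‖P (T y)‖ →
      ∀ e, 0 < e → |fderiv ℝ f (P y) v * q * f (P y) ^ (q - 1)| ≤
        q * (e / 2 * A y + 1 / (2 * e) * B y) := by
    intro y v hv e he
    have hv0 : 0 ≤ f (P y) ^ (q - 1) := Real.rpow_nonneg (hpos _).le _
    calc |fderiv ℝ f (P y) v * q * f (P y) ^ (q - 1)|
        = q * (f (P y) ^ (q - 1) * |fderiv ℝ f (P y) v|) := by
          rw [abs_mul, abs_mul, abs_of_pos hq0, abs_of_nonneg hv0]; ring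
      _ ≤ q * ((f (P y) ^ (q - 1) * ‖P (T y)‖) * ‖fderiv ℝ f (P y)‖) := by
          refine mul_le_mul_of_nonneg_left ?_ hq0.le
          rw [mul_assoc]
          refine mul_le_mul_of_nonneg_left ?_ hv0
          have := (fderiv ℝ f (P y)).le_opNorm v
          rw [Real.norm_eq_abs] at this
          refine this.trans ?_
          rw [mul_comm]
          exact mul_le_mul_of_nonneg_right hv (norm_nonneg _)
      _ ≤ q * (e / 2 * (f (P y) ^ (q - 1) * ‖P (T y)‖) ^ 2 +
            1 / (2 * e) * ‖fderiv ℝ f (P y)‖ ^ 2) :=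
          mul_le_mul_of_nonneg_left (hyoung e he _ _) hq0.le
      _ = q * (e / 2 * A y + 1 / (2 * e) * B y) := by
          rw [mul_pow, hv2]; simp only [hA, hB]; ring
  have hTi : ∀ i y, ‖T y i • EuclideanSpace.single i (1 : ℝ)‖ ≤ ‖P (T y)‖ := by
    intro i y
    rw [norm_smul]
    simpa using PiLp.norm_apply_le (P (T y)) i
  have hTm : ∀ i, Measurable fun y => T y i := fun i =>
    (measurable_pi_apply i).comp hT.measurable
  have hTw'i : ∀ i, Integrable fun y => T y i * w' i y := by
    intro i
    refine Integrable.mono' (((hAi.const_mul (1 / 2)).add (hBi.const_mul (1 / (2 * 1)))).const_mul q)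
      ((hTm i).mul (hw'c i).measurable).aestronglyMeasurable (ae_of_all _ fun y => ?_)
    have := hbound y _ (hTi i y) 1 one_pos
    refine le_trans (le_of_eq ?_) this
    rw [Real.norm_eq_abs]
    congr 1
    simp only [hw', map_smul, smul_eq_mul]
    ring
  -- integration by parts in each coordinate
  have hfline : ∀ i y, Integrable fun t => f (P (Function.update y i t)) ^ 2 := by
    intro i y
    have hu : Continuous fun t : ℝ => P (Function.update y i t) :=
      hPc.comp (continuous_const.update i continuous_id)
    refine Integrable.mono' (integrable_inv_one_add_sq.const_mul (C ^ 2))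
      ((hf.continuous.comp hu).pow 2).aestronglyMeasurable (ae_of_all _ fun t => ?_)
    rw [Real.norm_of_nonneg (sq_nonneg _)]
    have ht : 1 + t ^ 2 ≤ 1 + ‖P (Function.update y i t)‖ ^ 2 := by
      have := PiLp.norm_apply_le (P (Function.update y i t)) i
      simp only [hP, Function.update_self, Real.norm_eq_abs] at this
      have := pow_le_pow_left₀ (abs_nonneg t) this 2
      rw [sq_abs] at this
      linarith
    set b := 1 + ‖P (Function.update y i t)‖ ^ 2 with hb
    have hb0 : 0 < b := hβ _
    have hb1 : 1 ≤ b := by rw [hb]; nlinarith [sq_nonneg ‖P (Function.update y i t)‖]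
    calc f (P (Function.update y i t)) ^ 2 ≤ (C * b ^ (-((N : ℝ) - 2) / 2)) ^ 2 :=
          pow_le_pow_left₀ (hpos _).le (hC _) 2
      _ = C ^ 2 * b ^ (-((N : ℝ) - 2)) := by
          rw [mul_pow, ← Real.rpow_natCast (b ^ _), ← Real.rpow_mul hb0.le]
          congr 2; push_cast; ring
      _ ≤ C ^ 2 * b ^ (-1 : ℝ) := by
          refine mul_le_mul_of_nonneg_left ?_ (sq_nonneg _)
          exact Real.rpow_le_rpow_of_exponent_le hb1 (by linarith)
      _ ≤ C ^ 2 * (1 + t ^ 2)⁻¹ := by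
          rw [Real.rpow_neg_one]
          exact mul_le_mul_of_nonneg_left (inv_anti₀ (by positivity) ht) (sq_nonneg _)
  have hibp : ∀ i, 0 ≤ ∫ y, -(T y i * w' i y) ∧ ∫⁻ y, ENNReal.ofReal (D i y * w y) ≤
      ENNReal.ofReal (∫ y, -(T y i * w' i y)) := by
    intro i
    refine lintegral_coord_deriv_mul_le i (S := fun y => T y i) (v := fun y => f (P y) ^ (q - 1))
      (f := fun y => f (P y))
      (hT.hasDerivAt i) (hT.measurable_deriv i) (hvc q).measurable (hT.continuous_deriv i)
      (fun y => (hT.deriv_pos i y).le) (hwd i)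
      (fun y => (hw'c i).comp (continuous_const.update i continuous_id))
      (fun y => Real.rpow_nonneg (hpos _).le _) (fun y => ?_) ?_ (hfline i) (hTw'i i)
    · simp only [hw]
      rw [← Real.rpow_add_one (hpos _).ne']
      congr 1; ring
    · refine Integrable.mono' hAi
        (((hTm i).mul (hvc _).measurable).pow_const 2).aestronglyMeasurable
        (ae_of_all _ fun y => ?_)
      rw [Real.norm_of_nonneg (sq_nonneg _), mul_pow, hv2]
      refine mul_le_mul_of_nonneg_right ?_ (hFK.pos y).le
      have := PiLp.norm_apply_le (P (T y)) i
      have := pow_le_pow_left₀ (norm_nonneg _) this 2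
      simpa [hP] using this
  -- the arithmetic-geometric mean inequality for the diagonal derivatives
  have hN0 : (N : ℝ) ≠ 0 := by positivity
  have hamgm : ∀ y, G (T y) ^ (-(1 / (N : ℝ))) * F y ≤ ∑ i, 1 / (N : ℝ) * (D i y * w y) := by
    intro y
    have hDp : 0 < ∏ i, D i y := Finset.prod_pos fun i _ => hT.deriv_pos i y
    have hGp := hGK.pos (T y)
    have e1 : G (T y) ^ (-(1 / (N : ℝ))) * F y = (∏ i, D i y) ^ (1 / (N : ℝ)) * w y := by
      have hw2 : w y = F y ^ (1 - 1 / (N : ℝ)) := by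
        simp only [hw, hF]
        rw [← Real.rpow_mul (hpos _).le, hqp]
      have hF2 : F y = F y ^ (1 / (N : ℝ)) * w y := by
        rw [hw2, ← Real.rpow_add (hFK.pos y)]
        simp
      calc G (T y) ^ (-(1 / (N : ℝ))) * F y
          = G (T y) ^ (-(1 / (N : ℝ))) * (F y ^ (1 / (N : ℝ)) * w y) := by rw [← hF2]
        _ = (∏ i, D i y) ^ (1 / (N : ℝ)) * w y := by
          rw [← hT.prod_deriv y, Real.mul_rpow hDp.le hGp.le]
          rw [Real.rpow_neg hGp.le]
          have := (Real.rpow_pos_of_pos hGp (1 / (N : ℝ))).ne'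
          field_simp
    rw [e1]
    have e2 := Real.geom_mean_le_arith_mean_weighted Finset.univ (fun _ : Fin N => 1 / (N : ℝ))
      (fun i => D i y) (fun i _ => by positivity) (by simp [hN0])
      (fun i _ => (hT.deriv_pos i y).le)
    rw [Real.finsetProd_rpow _ _ fun i _ => (hT.deriv_pos i y).le] at e2
    calc _ ≤ (∑ i, 1 / (N : ℝ) * D i y) * w y :=
          mul_le_mul_of_nonneg_right e2 (Real.rpow_nonneg (hpos _).le _)
      _ = _ := by rw [Finset.sum_mul]; exact Finset.sum_congr rfl fun i _ => by ring
  have hGpow : ∀ y, G y ^ (-(1 / (N : ℝ))) * G y =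
      c ^ (1 - 1 / (N : ℝ)) * ((1 + ‖P y‖ ^ 2) ^ (N - 1))⁻¹ := by
    intro y
    have hb := hβ (P y)
    simp only [hG]
    set b := 1 + ‖P y‖ ^ 2
    rw [← Real.rpow_add_one (by positivity), Real.mul_rpow hc0.le (by positivity)]
    congr 1
    · congr 1; ring
    · rw [← Real.rpow_natCast b N, ← Real.rpow_neg hb.le, ← Real.rpow_mul hb.le,
        ← Real.rpow_natCast, ← Real.rpow_neg hb.le]
      congr 1
      rw [Nat.cast_sub (by omega)]
      push_cast
      field_simp
      ring
  have hlow : ENNReal.ofReal (c ^ (1 - 1 / (N : ℝ)) * (bubbleMass N + bubbleMoment N)) =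
      ∫⁻ y, ENNReal.ofReal (G (T y) ^ (-(1 / (N : ℝ))) * F y) := by
    have h1 := hT.lintegral_comp (fun y => ENNReal.ofReal (G y ^ (-(1 / (N : ℝ)))))
      (hGK.continuous.measurable.pow_const _).ennreal_ofReal
    simp only [← ENNReal.ofReal_mul (Real.rpow_nonneg (hGK.pos _).le _)] at h1
    rw [h1]
    simp_rw [hGpow]
    rw [← ofReal_integral_eq_lintegral_ofReal, integral_const_mul,
      hPint fun x => ((1 + ‖x‖ ^ 2) ^ (N - 1))⁻¹, integral_inv_one_add_sq_pow_pred hN]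
    · exact (hPi _ (integrable_inv_one_add_sq_pow (by omega))).const_mul _
    · exact ae_of_all _ fun y => by positivity
  have hsum : ∑ i, ∫ y, -(T y i * w' i y) ≤
      q * (l / 2 * (c * bubbleMoment N) + 1 / (2 * l) * ∫ x, ‖fderiv ℝ f x‖ ^ 2) := by
    have hneg : ∀ i, Integrable fun y => -(T y i * w' i y) := fun i => (hTw'i i).neg
    rw [← integral_finsetSum _ fun i _ => hneg i]
    have hR : Integrable fun y => q * (l / 2 * A y + 1 / (2 * l) * B y) :=
      ((hAi.const_mul _).add (hBi.const_mul _)).const_mul q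
    have e : ∫ y, q * (l / 2 * A y + 1 / (2 * l) * B y) =
        q * (l / 2 * (c * bubbleMoment N) + 1 / (2 * l) * ∫ x, ‖fderiv ℝ f x‖ ^ 2) := by
      rw [integral_const_mul, integral_add (hAi.const_mul _) (hBi.const_mul _),
        integral_const_mul, integral_const_mul, hAint, hBint]
    rw [← e]
    refine integral_mono (integrable_finsetSum _ fun i _ => hneg i) hR fun y => ?_
    have hv : P (T y) = ∑ i, T y i • EuclideanSpace.single i (1 : ℝ) := by
      ext j
      simp [hP, Finset.sum_apply, Pi.single_apply]
    have e2 : ∑ i, -(T y i * w' i y) =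
        -(fderiv ℝ f (P y) (P (T y)) * q * f (P y) ^ (q - 1)) := by
      rw [hv, map_sum, Finset.sum_mul, Finset.sum_mul, Finset.sum_neg_distrib]
      congr 1
      refine Finset.sum_congr rfl fun i _ => ?_
      simp only [hw', map_smul, smul_eq_mul]
      ring
    simp only
    rw [e2]
    exact (neg_le_abs _).trans (hbound y (P (T y)) le_rfl l hl)
  have hfinal : ENNReal.ofReal (c ^ (1 - 1 / (N : ℝ)) * (bubbleMass N + bubbleMoment N)) ≤
      ENNReal.ofReal (1 / N * ∑ i, ∫ y, -(T y i * w' i y)) := by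
    rw [hlow]
    calc ∫⁻ y, ENNReal.ofReal (G (T y) ^ (-(1 / (N : ℝ))) * F y)
        ≤ ∫⁻ y, ∑ i, ENNReal.ofReal (1 / (N : ℝ)) * ENNReal.ofReal (D i y * w y) := by
          refine lintegral_mono fun y => (ENNReal.ofReal_le_ofReal (hamgm y)).trans_eq ?_
          rw [ENNReal.ofReal_sum_of_nonneg fun i _ => mul_nonneg (by positivity)
            (mul_nonneg (hT.deriv_pos i y).le (Real.rpow_nonneg (hpos _).le _))]
          exact Finset.sum_congr rfl fun i _ => ENNReal.ofReal_mul (by positivity)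
      _ = ∑ i, ENNReal.ofReal (1 / (N : ℝ)) * ∫⁻ y, ENNReal.ofReal (D i y * w y) := by
          have hm : ∀ i, Measurable fun y => ENNReal.ofReal (D i y * w y) := fun i =>
            ((hT.measurable_deriv i).mul (hvc q).measurable).ennreal_ofReal
          rw [lintegral_finsetSum _ fun i _ => (hm i).const_mul _]
          exact Finset.sum_congr rfl fun i _ => lintegral_const_mul _ (hm i)
      _ ≤ ∑ i, ENNReal.ofReal (1 / (N : ℝ)) * ENNReal.ofReal (∫ y, -(T y i * w' i y)) :=
          Finset.sum_le_sum fun i _ => mul_le_mul_right (hibp i).2 _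
      _ = _ := by
          rw [← Finset.mul_sum, ← ENNReal.ofReal_sum_of_nonneg fun i _ => (hibp i).1,
            ENNReal.ofReal_mul (by positivity)]
  have hnn : 0 ≤ 1 / (N : ℝ) * ∑ i, ∫ y, -(T y i * w' i y) :=
    mul_nonneg (by positivity) (Finset.sum_nonneg fun i _ => (hibp i).1)
  rw [ENNReal.ofReal_le_ofReal_iff hnn] at hfinal
  refine hfinal.trans ?_
  rw [mul_assoc]
  exact mul_le_mul_of_nonneg_left hsum (by positivity)

end

/-! ### The sharp Sobolev inequality for compactly supported functions -/

section

variable {N : ℕ}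

/-- The sharp constant in `S (∫ |u|^{2*})^{2/2*} ≤ ∫ |∇u|²`. -/
def sobolevConst (N : ℕ) : ℝ :=
  ((N : ℝ) - 2) ^ 2 * bubbleMoment N * (1 / bubbleMass N) ^ (2 / critExp N)

theorem sobolevConst_pos (hN : 3 ≤ N) : 0 < sobolevConst N := by
  have h3 : (3 : ℝ) ≤ N := by exact_mod_cast hN
  have : 0 < (N : ℝ) - 2 := by linarith
  have h1 := bubbleMoment_pos hN
  have h2 := bubbleMass_pos hN
  unfold sobolevConst
  positivity

/-- The sharp Sobolev inequality for positive functions decaying like the bubble. The factor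
`c` in `transport_estimate` normalises the mass, and the parameter `l` is optimised. -/
theorem sobolev_of_pos (hN : 3 ≤ N) {f : EuclideanSpace ℝ (Fin N) → ℝ}
    (hf : ContDiff ℝ 1 f) (hpos : ∀ x, 0 < f x)
    {C : ℝ} (hC : ∀ x, f x ≤ C * (1 + ‖x‖ ^ 2) ^ (-((N : ℝ) - 2) / 2))
    (hgrad : Integrable fun x => ‖fderiv ℝ f x‖ ^ 2) :
    Integrable (fun x => f x ^ critExp N) ∧
      sobolevConst N * (∫ x, f x ^ critExp N) ^ (2 / critExp N) ≤ ∫ x, ‖fderiv ℝ f x‖ ^ 2 := by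
  have h3 : (3 : ℝ) ≤ N := by exact_mod_cast hN
  have hp := critExp_pos hN
  have hI0 := bubbleMass_pos hN
  have hI2 := bubbleMoment_pos hN
  have hC0 : 0 < C := by
    have := (hpos 0).trans_le (hC 0)
    simpa using this
  have hcont : Continuous fun x => f x ^ critExp N :=
    hf.continuous.rpow_const fun x => Or.inl (hpos x).ne'
  have hfi : Integrable fun x => f x ^ critExp N := by
    refine Integrable.mono' ((integrable_bubbleMass hN).const_mul (C ^ critExp N))
      hcont.aestronglyMeasurable (ae_of_all _ fun x => ?_)
    have hb : 0 < 1 + ‖x‖ ^ 2 := by positivity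
    rw [Real.norm_of_nonneg (Real.rpow_nonneg (hpos x).le _)]
    calc f x ^ critExp N ≤ (C * (1 + ‖x‖ ^ 2) ^ (-((N : ℝ) - 2) / 2)) ^ critExp N :=
          Real.rpow_le_rpow (hpos _).le (hC _) hp.le
      _ = C ^ critExp N * ((1 + ‖x‖ ^ 2) ^ N)⁻¹ := by
          rw [Real.mul_rpow hC0.le (Real.rpow_nonneg hb.le _), profile_rpow_critExp hN hb]
  refine ⟨hfi, ?_⟩
  have hint : 0 < ∫ x, f x ^ critExp N := by
    rw [integral_pos_iff_support_of_nonneg (fun x => Real.rpow_nonneg (hpos x).le _) hfi]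
    have : (Function.support fun x => f x ^ critExp N) = univ := by
      ext x
      simpa using (Real.rpow_pos_of_pos (hpos x) (critExp N)).ne'
    rw [this]
    exact isOpen_univ.measure_pos _ univ_nonempty
  set c : ℝ := (∫ x, f x ^ critExp N) / bubbleMass N with hc
  have hc0 : 0 < c := div_pos hint hI0
  have hcm : ∫ x, f x ^ critExp N = c * bubbleMass N := by
    rw [hc, div_mul_cancel₀ _ hI0.ne']
  set B := ∫ x, ‖fderiv ℝ f x‖ ^ 2 with hB
  have hB0 : 0 ≤ B := integral_nonneg fun x => by positivity
  have key := fun l hl => transport_estimate hN hf hpos hC hgrad hc0 hcm (l := l) hl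
  rw [← hB] at key
  have hN2 : (0 : ℝ) < N - 2 := by linarith
  have hN1 : (0 : ℝ) < N - 1 := by linarith
  have hI : bubbleMass N + bubbleMoment N = 2 * ((N : ℝ) - 1) / N * bubbleMoment N := by
    have := bubbleMass_eq hN
    field_simp
    linarith
  rw [hI] at key
  set Y := c ^ (1 - 1 / (N : ℝ)) * (((N : ℝ) - 2) * bubbleMoment N) with hY
  have hcp : 0 < c ^ (1 - 1 / (N : ℝ)) := Real.rpow_pos_of_pos hc0 _
  have hY0 : 0 < Y := by positivity
  have key2 : ∀ l, 0 < l → Y ≤ l / 2 * (c * bubbleMoment N) + 1 / (2 * l) * B := by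
    intro l hl
    have h := key l hl
    have hk : 0 < 1 / (N : ℝ) * (2 * ((N : ℝ) - 1) / ((N : ℝ) - 2)) := by positivity
    refine le_of_mul_le_mul_left (le_trans (le_of_eq ?_) h) hk
    rw [hY]
    field_simp
  have hYB : Y ^ 2 ≤ c * bubbleMoment N * B := by
    have hA : 0 < c * bubbleMoment N := by positivity
    have h := key2 (Y / (c * bubbleMoment N)) (by positivity)
    have e : Y / (c * bubbleMoment N) / 2 * (c * bubbleMoment N) +
        1 / (2 * (Y / (c * bubbleMoment N))) * B = Y / 2 + c * bubbleMoment N * B / (2 * Y) := by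
      field_simp
    rw [e] at h
    have h' : Y / 2 ≤ c * bubbleMoment N * B / (2 * Y) := by linarith
    rw [le_div_iff₀ (by positivity)] at h'
    nlinarith
  have hexp : 2 / critExp N = 1 - 2 / (N : ℝ) := by
    rw [critExp]; field_simp
  have hS : sobolevConst N * (∫ x, f x ^ critExp N) ^ (2 / critExp N) =
      ((N : ℝ) - 2) ^ 2 * bubbleMoment N * c ^ (1 - 2 / (N : ℝ)) := by
    rw [sobolevConst, mul_assoc, ← Real.mul_rpow (by positivity) hint.le, one_div_mul_eq_div,
      ← hc, hexp]
  rw [hS]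
  have hY2 : Y ^ 2 = c * bubbleMoment N *
      (((N : ℝ) - 2) ^ 2 * bubbleMoment N * c ^ (1 - 2 / (N : ℝ))) := by
    have : (c ^ (1 - 1 / (N : ℝ))) ^ 2 = c * c ^ (1 - 2 / (N : ℝ)) := by
      rw [← Real.rpow_natCast, ← Real.rpow_mul hc0.le]
      nth_rw 2 [← Real.rpow_one c]
      rw [← Real.rpow_add hc0]
      congr 1
      push_cast
      ring
    rw [hY, mul_pow, this]
    ring
  rw [hY2] at hYB
  exact le_of_mul_le_mul_left hYB (by positivity)

theorem hasFDerivAt_comp_norm_sq {h : ℝ → ℝ} {h' : ℝ} {x : EuclideanSpace ℝ (Fin N)}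
    (hh : HasDerivAt h h' (‖x‖ ^ 2)) :
    HasFDerivAt (fun y : EuclideanSpace ℝ (Fin N) => h (‖y‖ ^ 2)) ((2 * h') • innerSL ℝ x) x := by
  have h1 := (hasStrictFDerivAt_norm_sq x).hasFDerivAt
  have h2 := hh.comp_hasFDerivAt x h1
  refine h2.congr_fderiv ?_
  ext v
  simp
  ring

theorem hasFDerivAt_profile (N : ℕ) (x : EuclideanSpace ℝ (Fin N)) :
    HasFDerivAt (fun y : EuclideanSpace ℝ (Fin N) => (1 + ‖y‖ ^ 2) ^ (-((N : ℝ) - 2) / 2))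
      ((-((N : ℝ) - 2) * (1 + ‖x‖ ^ 2) ^ (-(N : ℝ) / 2)) • innerSL ℝ x) x := by
  have hb : 1 + ‖x‖ ^ 2 ≠ 0 := by positivity
  have h1 : HasDerivAt (fun s : ℝ => (1 + s) ^ (-((N : ℝ) - 2) / 2))
      (1 * (-((N : ℝ) - 2) / 2) * (1 + ‖x‖ ^ 2) ^ (-((N : ℝ) - 2) / 2 - 1)) (‖x‖ ^ 2) :=
    ((hasDerivAt_id (‖x‖ ^ 2)).const_add 1).rpow_const (Or.inl hb)
  refine (hasFDerivAt_comp_norm_sq h1).congr_fderiv ?_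
  congr 1
  have : -((N : ℝ) - 2) / 2 - 1 = -(N : ℝ) / 2 := by ring
  rw [this]
  ring

theorem norm_fderiv_profile_sq (N : ℕ) (x : EuclideanSpace ℝ (Fin N)) :
    ‖fderiv ℝ (fun y : EuclideanSpace ℝ (Fin N) => (1 + ‖y‖ ^ 2) ^ (-((N : ℝ) - 2) / 2)) x‖ ^ 2 =
      ((N : ℝ) - 2) ^ 2 * (‖x‖ ^ 2 * ((1 + ‖x‖ ^ 2) ^ N)⁻¹) := by
  have hb : 0 < 1 + ‖x‖ ^ 2 := by positivity
  rw [(hasFDerivAt_profile N x).fderiv, norm_smul, innerSL_apply_norm, mul_pow, Real.norm_eq_abs,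
    sq_abs, mul_pow]
  have : ((1 + ‖x‖ ^ 2) ^ (-(N : ℝ) / 2)) ^ 2 = ((1 + ‖x‖ ^ 2) ^ N)⁻¹ := by
    generalize 1 + ‖x‖ ^ 2 = b at hb
    rw [← Real.rpow_natCast (_ ^ _), ← Real.rpow_mul hb.le, ← Real.rpow_natCast,
      ← Real.rpow_neg hb.le]
    congr 1
    push_cast
    ring
  rw [this]
  ring

theorem contDiff_profile (N : ℕ) :
    ContDiff ℝ 1 fun y : EuclideanSpace ℝ (Fin N) => (1 + ‖y‖ ^ 2) ^ (-((N : ℝ) - 2) / 2) := by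
  refine ContDiff.rpow_const_of_ne (contDiff_const.add (contDiff_norm_sq ℝ)) fun x => ?_
  positivity

/-- The sharp Sobolev inequality for compactly supported `C¹` functions. To apply the transport
estimate, `u` is replaced by the positive function `√(u² + d² V²)`, where `V` is the standard bubble
profile, whose gradient satisfies `|∇√(u² + d² V²)|² ≤ |∇u|² + d² |∇V|²`. -/
theorem sobolev_of_hasCompactSupport (hN : 3 ≤ N) {u : EuclideanSpace ℝ (Fin N) → ℝ}
    (hu : ContDiff ℝ 1 u) (hc : HasCompactSupport u) :
    sobolevConst N * (∫ x, |u x| ^ critExp N) ^ (2 / critExp N) ≤ ∫ x, ‖fderiv ℝ u x‖ ^ 2 := by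
  have h3 : (3 : ℝ) ≤ N := by exact_mod_cast hN
  have hp := critExp_pos hN
  set V : EuclideanSpace ℝ (Fin N) → ℝ := fun y => (1 + ‖y‖ ^ 2) ^ (-((N : ℝ) - 2) / 2) with hV
  have hVpos : ∀ x, 0 < V x := fun x => by positivity
  have hVc : ContDiff ℝ 1 V := contDiff_profile N
  set L := ∫ x, ‖fderiv ℝ V x‖ ^ 2 with hL
  have hVi : Integrable fun x => ‖fderiv ℝ V x‖ ^ 2 := by
    simp only [hV, norm_fderiv_profile_sq]
    exact (integrable_bubbleMoment hN).const_mul _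
  have hui : Integrable fun x => ‖fderiv ℝ u x‖ ^ 2 := by
    refine Continuous.integrable_of_hasCompactSupport
      ((hu.continuous_fderiv one_ne_zero).norm.pow 2) ?_
    exact (hc.fderiv ℝ).comp_left (g := fun l => ‖l‖ ^ 2) (by simp)
  have hL0 : 0 ≤ L := integral_nonneg fun x => by positivity
  obtain ⟨C, hC⟩ : ∃ C, ∀ x, ‖u x / V x‖ ≤ C := by
    refine Continuous.bounded_above_of_compact_support
      (hu.continuous.div hVc.continuous fun x => (hVpos x).ne') ?_
    simp_rw [div_eq_mul_inv]
    exact hc.mul_right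
  have hC0 : 0 ≤ C := (norm_nonneg _).trans (hC 0)
  have huV : ∀ x, |u x| ≤ C * V x := fun x => by
    have := hC x
    rwa [norm_div, Real.norm_eq_abs, Real.norm_of_nonneg (hVpos x).le, div_le_iff₀ (hVpos x)] at this
  have key : ∀ d : ℝ, 0 < d → sobolevConst N * (∫ x, |u x| ^ critExp N) ^ (2 / critExp N) ≤
      (∫ x, ‖fderiv ℝ u x‖ ^ 2) + d ^ 2 * L := by
    intro d hd
    set f : EuclideanSpace ℝ (Fin N) → ℝ := fun x => √(u x ^ 2 + d ^ 2 * V x ^ 2) with hf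
    have hrad : ∀ x, 0 < u x ^ 2 + d ^ 2 * V x ^ 2 := fun x => by
      have := hVpos x
      positivity
    have hfpos : ∀ x, 0 < f x := fun x => Real.sqrt_pos.2 (hrad x)
    have hfc : ContDiff ℝ 1 f :=
      ((hu.pow 2).add (contDiff_const.mul (hVc.pow 2))).sqrt fun x => (hrad x).ne'
    have hfsq : ∀ x, f x ^ 2 = u x ^ 2 + d ^ 2 * V x ^ 2 := fun x => Real.sq_sqrt (hrad x).le
    have hfb : ∀ x, f x ≤ (C + d) * (1 + ‖x‖ ^ 2) ^ (-((N : ℝ) - 2) / 2) := fun x => by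
      refine Real.sqrt_le_iff.2 ⟨by positivity, ?_⟩
      change _ ≤ ((C + d) * V x) ^ 2
      have h1 : u x ^ 2 ≤ (C * V x) ^ 2 := by
        rw [← sq_abs]; exact pow_le_pow_left₀ (abs_nonneg _) (huV x) 2
      have h2 : 0 ≤ C * d * V x ^ 2 := by positivity
      nlinarith
    have hfd : ∀ x, ‖fderiv ℝ f x‖ ^ 2 ≤ ‖fderiv ℝ u x‖ ^ 2 + d ^ 2 * ‖fderiv ℝ V x‖ ^ 2 := by
      intro x
      have h1 := (hu.differentiable one_ne_zero x).hasFDerivAt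
      have h2 := (hVc.differentiable one_ne_zero x).hasFDerivAt
      have h4 := (hfc.differentiable one_ne_zero x).hasFDerivAt
      have h5 : ∀ v, f x * fderiv ℝ f x v = u x * fderiv ℝ u x v +
          d ^ 2 * (V x * fderiv ℝ V x v) := by
        intro v
        have e1 := h4.pow 2
        have e2 := (h1.pow 2).add ((h2.pow 2).const_mul (d ^ 2))
        have e3 : (fun x => f x ^ 2) = fun x => u x ^ 2 + d ^ 2 * V x ^ 2 := funext hfsq
        rw [e3] at e1
        have e4 := DFunLike.congr_fun (e1.unique e2) v
        simp at e4
        linarith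
      set M := √(‖fderiv ℝ u x‖ ^ 2 + d ^ 2 * ‖fderiv ℝ V x‖ ^ 2) with hM
      have hMsq : M ^ 2 = ‖fderiv ℝ u x‖ ^ 2 + d ^ 2 * ‖fderiv ℝ V x‖ ^ 2 :=
        Real.sq_sqrt (by positivity)
      rw [← hMsq]
      refine pow_le_pow_left₀ (norm_nonneg _) ?_ 2
      refine ContinuousLinearMap.opNorm_le_bound _ (Real.sqrt_nonneg _) fun v => ?_
      have a1 := (fderiv ℝ u x).le_opNorm v
      have a2 := (fderiv ℝ V x).le_opNorm v
      rw [Real.norm_eq_abs] at a1 a2 ⊢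
      refine abs_le_of_sq_le_sq ?_ (mul_nonneg (Real.sqrt_nonneg _) (norm_nonneg _))
      have b1 : (fderiv ℝ u x v) ^ 2 ≤ (‖fderiv ℝ u x‖ * ‖v‖) ^ 2 := by
        rw [← sq_abs]; exact pow_le_pow_left₀ (abs_nonneg _) a1 2
      have b2 : (fderiv ℝ V x v) ^ 2 ≤ (‖fderiv ℝ V x‖ * ‖v‖) ^ 2 := by
        rw [← sq_abs]; exact pow_le_pow_left₀ (abs_nonneg _) a2 2
      -- Cauchy's inequality for the pairs `(u, d V)` and `(u', d V')`
      have hcs : (f x * fderiv ℝ f x v) ^ 2 ≤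
          f x ^ 2 * ((fderiv ℝ u x v) ^ 2 + d ^ 2 * (fderiv ℝ V x v) ^ 2) := by
        rw [h5, hfsq]
        nlinarith [sq_nonneg (d * (u x * fderiv ℝ V x v - V x * fderiv ℝ u x v))]
      rw [mul_pow] at hcs
      have := le_of_mul_le_mul_left hcs (pow_pos (hfpos x) 2)
      refine this.trans ?_
      rw [mul_pow, hMsq]
      nlinarith [sq_nonneg d]
    have hfdi : Integrable fun x => ‖fderiv ℝ f x‖ ^ 2 := by
      refine Integrable.mono' (hui.add (hVi.const_mul (d ^ 2)))
        ((hfc.continuous_fderiv one_ne_zero).norm.pow 2).aestronglyMeasurable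
        (ae_of_all _ fun x => ?_)
      rw [Real.norm_of_nonneg (sq_nonneg _)]
      exact hfd x
    obtain ⟨hfi, hfS⟩ := sobolev_of_pos hN hfc hfpos hfb hfdi
    have hmono : ∫ x, |u x| ^ critExp N ≤ ∫ x, f x ^ critExp N := by
      refine integral_mono_of_nonneg (ae_of_all _ fun x => by positivity) hfi
        (ae_of_all _ fun x => ?_)
      refine Real.rpow_le_rpow (abs_nonneg _) ?_ hp.le
      rw [← Real.sqrt_sq_eq_abs]
      refine Real.sqrt_le_sqrt ?_
      have : 0 ≤ d ^ 2 * V x ^ 2 := by positivity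
      linarith
    calc sobolevConst N * (∫ x, |u x| ^ critExp N) ^ (2 / critExp N)
        ≤ sobolevConst N * (∫ x, f x ^ critExp N) ^ (2 / critExp N) := by
          refine mul_le_mul_of_nonneg_left ?_ (sobolevConst_pos hN).le
          exact Real.rpow_le_rpow (integral_nonneg fun x => by positivity) hmono (by positivity)
      _ ≤ ∫ x, ‖fderiv ℝ f x‖ ^ 2 := hfS
      _ ≤ ∫ x, (‖fderiv ℝ u x‖ ^ 2 + d ^ 2 * ‖fderiv ℝ V x‖ ^ 2) :=
          integral_mono hfdi (hui.add (hVi.const_mul (d ^ 2))) hfd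
      _ = _ := by rw [integral_add hui (hVi.const_mul _), integral_const_mul]
  refine le_of_forall_pos_le_add fun e he => ?_
  refine (key (√(e / (1 + L))) (by positivity)).trans ?_
  rw [Real.sq_sqrt (by positivity)]
  have : e / (1 + L) * L ≤ e := by
    rw [div_mul_eq_mul_div, div_le_iff₀ (by positivity)]
    nlinarith
  linarith

end

/-! ### Polar coordinates on cones -/

section

variable {N : ℕ}

/-- The measure `r^{N-1} dr` on the half-line `(0, ∞)`. -/
def radMeas (N : ℕ) : Measure ℝ :=
  (volume.restrict (Ioi 0)).withDensity fun r => ENNReal.ofReal (r ^ (N - 1))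

/-- The surface measure of the part `ω` of the unit sphere, as a measure on `ℝ^N`. -/
def angMeas (ω : Set (EuclideanSpace ℝ (Fin N))) : Measure (EuclideanSpace ℝ (Fin N)) :=
  ((volume : Measure (EuclideanSpace ℝ (Fin N))).toSphere.restrict (Subtype.val ⁻¹' ω)).map
    Subtype.val

/-- The surface area of `ω`. -/
def angMass (ω : Set (EuclideanSpace ℝ (Fin N))) : ℝ := (angMeas ω).real univ

instance (ω : Set (EuclideanSpace ℝ (Fin N))) : IsFiniteMeasure (angMeas ω) := by
  unfold angMeas; infer_instance

theorem map_val_volumeIoiPow (k : ℕ) : (Measure.volumeIoiPow k).map Subtype.val =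
    (volume.restrict (Ioi (0 : ℝ))).withDensity fun r => ENNReal.ofReal (r ^ k) := by
  ext s hs
  rw [Measure.map_apply measurable_subtype_coe hs, Measure.volumeIoiPow,
    withDensity_apply _ (measurable_subtype_coe hs), withDensity_apply _ hs,
    ← (measurePreserving_subtype_coe measurableSet_Ioi).setLIntegral_comp_preimage hs (by fun_prop)]

instance : SFinite (radMeas N) := by
  unfold radMeas; infer_instance

theorem mem_openCone_iff {ω : Set (EuclideanSpace ℝ (Fin N))} (hω : ω ⊆ Metric.sphere 0 1)
    {x : EuclideanSpace ℝ (Fin N)} : x ∈ openCone ω ↔ x ≠ 0 ∧ ‖x‖⁻¹ • x ∈ ω := by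
  constructor
  · rintro ⟨y, hy, t, ht, rfl⟩
    have hy1 : ‖y‖ = 1 := by simpa using hω hy
    have hy0 : y ≠ 0 := by rintro rfl; simp at hy1
    refine ⟨smul_ne_zero ht.ne' hy0, ?_⟩
    rw [norm_smul, hy1, Real.norm_of_nonneg ht.le, mul_one, smul_smul, inv_mul_cancel₀ ht.ne',
      one_smul]
    exact hy
  · rintro ⟨h0, h⟩
    refine ⟨_, h, ‖x‖, norm_pos_iff.2 h0, ?_⟩
    rw [smul_smul, mul_inv_cancel₀ (norm_ne_zero_iff.2 h0), one_smul]

/-- A relatively open subset of the unit sphere. -/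
structure IsOpenInSphere (ω : Set (EuclideanSpace ℝ (Fin N))) : Prop where
  exists_isOpen : ∃ O : Set (EuclideanSpace ℝ (Fin N)), IsOpen O ∧ ω = O ∩ Metric.sphere 0 1

theorem isOpenInSphere_sphere : IsOpenInSphere (Metric.sphere (0 : EuclideanSpace ℝ (Fin N)) 1) :=
  ⟨univ, isOpen_univ, by simp⟩

namespace IsOpenInSphere

variable {ω : Set (EuclideanSpace ℝ (Fin N))}

theorem subset_sphere (h : IsOpenInSphere ω) : ω ⊆ Metric.sphere 0 1 := by
  obtain ⟨O, -, rfl⟩ := h.exists_isOpen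
  exact inter_subset_right

theorem measurableSet (h : IsOpenInSphere ω) : MeasurableSet ω := by
  obtain ⟨O, hO, rfl⟩ := h.exists_isOpen
  exact hO.measurableSet.inter Metric.isClosed_sphere.measurableSet

theorem isOpen_openCone (h : IsOpenInSphere ω) : IsOpen (openCone ω) := by
  have hs := h.subset_sphere
  obtain ⟨O, hO, hωO⟩ := h.exists_isOpen
  have e : openCone ω = {0}ᶜ ∩ (fun x : EuclideanSpace ℝ (Fin N) => ‖x‖⁻¹ • x) ⁻¹' O := by
    ext x
    rw [mem_openCone_iff hs, hωO]
    refine and_congr_right fun h0 => ?_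
    simp [norm_smul, norm_ne_zero_iff.2 h0]
  rw [e]
  refine ContinuousOn.isOpen_inter_preimage ?_ isOpen_compl_singleton hO
  exact (continuousOn_id.norm.inv₀ fun x hx => norm_ne_zero_iff.2 hx).smul continuousOn_id

end IsOpenInSphere

variable {ω : Set (EuclideanSpace ℝ (Fin N))}

theorem ae_angMeas (h : IsOpenInSphere ω) : ∀ᵐ θ ∂(angMeas ω), θ ∈ ω := by
  refine (ae_map_iff (p := fun θ => θ ∈ ω) measurable_subtype_coe.aemeasurable h.measurableSet).2 ?_
  exact ae_restrict_mem (measurable_subtype_coe h.measurableSet)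

theorem ae_radMeas (N : ℕ) : ∀ᵐ r ∂(radMeas N), r ∈ Ioi (0 : ℝ) :=
  (withDensity_absolutelyContinuous _ _).ae_le (ae_restrict_mem measurableSet_Ioi)

/-- Integration in polar coordinates on the cone over `ω`. -/
theorem measurePreserving_polar (h : IsOpenInSphere ω) :
    MeasurePreserving (fun p : ℝ × EuclideanSpace ℝ (Fin N) => p.1 • p.2)
      ((radMeas N).prod (angMeas ω)) (volume.restrict (openCone ω)) := by
  have hm : MeasurableSet (Subtype.val ⁻¹' ω : Set (Metric.sphere (0 : EuclideanSpace ℝ (Fin N)) 1)) :=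
    measurable_subtype_coe h.measurableSet
  set H := homeomorphUnitSphereProd (EuclideanSpace ℝ (Fin N)) with hH
  have h0 := (volume : Measure (EuclideanSpace ℝ (Fin N))).measurePreserving_homeomorphUnitSphereProd
  rw [finrank_euclideanSpace_fin] at h0
  have h1 := h0.restrict_preimage (hm.prod MeasurableSet.univ)
  rw [← Measure.prod_restrict, Measure.restrict_univ] at h1
  have h2 := MeasurePreserving.symm H.toMeasurableEquiv h1
  have h3 := (measurePreserving_subtype_coe (μa := (volume : Measure (EuclideanSpace ℝ (Fin N))))
    (measurableSet_singleton 0).compl).restrict_preimage h.isOpen_openCone.measurableSet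
  have e1 : (H ⁻¹' (Subtype.val ⁻¹' ω) ×ˢ univ) =
      (Subtype.val ⁻¹' (openCone ω) : Set ({0}ᶜ : Set (EuclideanSpace ℝ (Fin N)))) := by
    ext x
    simp only [mem_preimage, mem_prod, mem_univ, and_true]
    rw [mem_openCone_iff h.subset_sphere]
    simp [hH, show (x : EuclideanSpace ℝ (Fin N)) ≠ 0 from x.2]
  have e2 : (volume.restrict ({0}ᶜ : Set (EuclideanSpace ℝ (Fin N)))).restrict (openCone ω) =
      volume.restrict (openCone ω) := by
    refine Measure.restrict_restrict_of_subset fun x hx => ?_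
    exact ((mem_openCone_iff h.subset_sphere).1 hx).1
  rw [e2] at h3
  rw [e1] at h2
  have h4 := h3.comp h2
  have h5 : MeasurePreserving (fun p : Metric.sphere (0 : EuclideanSpace ℝ (Fin N)) 1 × Ioi (0 : ℝ) =>
      ((p.2 : ℝ), (p.1 : EuclideanSpace ℝ (Fin N))))
      (((volume : Measure (EuclideanSpace ℝ (Fin N))).toSphere.restrict (Subtype.val ⁻¹' ω)).prod
        (Measure.volumeIoiPow (N - 1))) ((radMeas N).prod (angMeas ω)) := by
    have a1 : MeasurePreserving (Subtype.val : Ioi (0 : ℝ) → ℝ) (Measure.volumeIoiPow (N - 1))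
        (radMeas N) := ⟨measurable_subtype_coe, map_val_volumeIoiPow _⟩
    have a2 : MeasurePreserving (Subtype.val : Metric.sphere (0 : EuclideanSpace ℝ (Fin N)) 1 → _)
        ((volume : Measure (EuclideanSpace ℝ (Fin N))).toSphere.restrict (Subtype.val ⁻¹' ω))
        (angMeas ω) := ⟨measurable_subtype_coe, rfl⟩
    exact (a1.prod a2).comp Measure.measurePreserving_swap
  refine ⟨by fun_prop, ?_⟩
  rw [← h5.map_eq, Measure.map_map (by fun_prop) h5.measurable, ← h4.map_eq]
  rfl

theorem angMass_nonneg (ω : Set (EuclideanSpace ℝ (Fin N))) : 0 ≤ angMass ω := measureReal_nonneg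

theorem angMeas_univ (ω : Set (EuclideanSpace ℝ (Fin N))) :
    angMeas ω univ = ENNReal.ofReal (angMass ω) := by
  simp [angMass]

theorem map_norm_openCone (h : IsOpenInSphere ω) :
    (volume.restrict (openCone ω)).map (fun x => ‖x‖) =
      ENNReal.ofReal (angMass ω) • radMeas N := by
  rw [← (measurePreserving_polar h).map_eq, Measure.map_map (by fun_prop) (by fun_prop)]
  have e : (fun x : EuclideanSpace ℝ (Fin N) => ‖x‖) ∘
      (fun p : ℝ × EuclideanSpace ℝ (Fin N) => p.1 • p.2) =ᵐ[(radMeas N).prod (angMeas ω)]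
      Prod.fst := by
    filter_upwards [Measure.quasiMeasurePreserving_fst.ae (ae_radMeas N),
      Measure.quasiMeasurePreserving_snd.ae (ae_angMeas h)] with p hp1 hp2
    have : ‖p.2‖ = 1 := by simpa using h.subset_sphere hp2
    simp only [Function.comp, norm_smul, this, mul_one]
    exact Real.norm_of_nonneg (le_of_lt hp1)
  rw [Measure.map_congr e, Measure.map_fst_prod, angMeas_univ]

theorem lintegral_openCone_norm (h : IsOpenInSphere ω) {g : ℝ → ENNReal} (hg : Measurable g) :
    ∫⁻ x in openCone ω, g ‖x‖ = ENNReal.ofReal (angMass ω) * ∫⁻ r, g r ∂(radMeas N) := by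
  have := lintegral_map (μ := volume.restrict (openCone ω)) hg measurable_norm
  rw [← this, map_norm_openCone h, lintegral_smul_measure]
  rfl

theorem boundedCone_eq (h : IsOpenInSphere ω) : boundedCone ω = openCone ω ∩ Metric.ball 0 1 := by
  ext x
  constructor
  · rintro ⟨y, hy, t, ht, ht1, rfl⟩
    have hy1 : ‖y‖ = 1 := by simpa using h.subset_sphere hy
    exact ⟨⟨y, hy, t, ht, rfl⟩, by simpa [norm_smul, hy1, abs_of_pos ht]⟩
  · rintro ⟨⟨y, hy, t, ht, rfl⟩, h2⟩
    have hy1 : ‖y‖ = 1 := by simpa using h.subset_sphere hy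
    exact ⟨y, hy, t, ht, by simpa [norm_smul, hy1, abs_of_pos ht] using h2, rfl⟩

theorem angMass_eq (hN : 0 < N) (h : IsOpenInSphere ω) :
    angMass ω = N * volume.real (boundedCone ω) := by
  have h1 := lintegral_openCone_norm h (g := (Iio 1).indicator 1)
    (measurable_one.indicator measurableSet_Iio)
  have h2 : ∫⁻ x in openCone ω, (Iio 1).indicator (1 : ℝ → ENNReal) ‖x‖ =
      volume (boundedCone ω) := by
    have : (fun x : EuclideanSpace ℝ (Fin N) => (Iio 1).indicator (1 : ℝ → ENNReal) ‖x‖) =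
        (Metric.ball 0 1).indicator 1 := by
      ext x; simp [indicator]
    rw [this, lintegral_indicator_one Metric.isOpen_ball.measurableSet,
      Measure.restrict_apply Metric.isOpen_ball.measurableSet, inter_comm, boundedCone_eq h]
  have h3 : ∫⁻ r, (Iio 1).indicator (1 : ℝ → ENNReal) r ∂(radMeas N) = ENNReal.ofReal (1 / N) := by
    rw [lintegral_indicator_one measurableSet_Iio, radMeas, ← map_val_volumeIoiPow,
      Measure.map_apply measurable_subtype_coe measurableSet_Iio]
    have := Measure.volumeIoiPow_apply_Iio (N - 1) ⟨1, mem_Ioi.2 one_pos⟩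
    have e : ((N - 1 : ℕ) : ℝ) + 1 = N := by
      rw [Nat.cast_sub (by omega)]; simp
    rw [e] at this
    rw [show (Subtype.val ⁻¹' Iio (1 : ℝ) : Set (Ioi (0 : ℝ))) = Iio ⟨1, mem_Ioi.2 one_pos⟩ from rfl,
      this]
    simp
  rw [h2, h3, ← ENNReal.ofReal_mul (angMass_nonneg ω)] at h1
  rw [Measure.real, h1, ENNReal.toReal_ofReal (mul_nonneg (angMass_nonneg ω) (by positivity))]
  field_simp

theorem angMass_pos (hN : 0 < N) (h : IsOpenInSphere ω) (hne : ω.Nonempty) : 0 < angMass ω := by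
  rw [angMass_eq hN h]
  refine mul_pos (by exact_mod_cast hN) ?_
  obtain ⟨y, hy⟩ := hne
  have ho : IsOpen (boundedCone ω) := by
    rw [boundedCone_eq h]
    exact h.isOpen_openCone.inter Metric.isOpen_ball
  refine ENNReal.toReal_pos (ho.measure_pos _ ⟨(1 / 2 : ℝ) • y, y, hy, 1 / 2, by norm_num,
    by norm_num, rfl⟩).ne' ?_
  refine ((measure_mono ?_).trans_lt
    (measure_ball_lt_top (x := (0 : EuclideanSpace ℝ (Fin N))) (r := 1))).ne
  rw [boundedCone_eq h]
  exact inter_subset_right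

theorem integral_openCone_norm (h : IsOpenInSphere ω) {g : ℝ → ℝ}
    (hg : AEStronglyMeasurable g (radMeas N)) :
    ∫ x in openCone ω, g ‖x‖ = angMass ω * ∫ r, g r ∂(radMeas N) := by
  have := integral_map (μ := volume.restrict (openCone ω)) (φ := fun x => ‖x‖) (f := g)
    measurable_norm.aemeasurable (by rw [map_norm_openCone h]; exact hg.smul_measure _)
  rw [← this, map_norm_openCone h, integral_smul_measure,
    ENNReal.toReal_ofReal (angMass_nonneg ω), smul_eq_mul]

theorem integrable_of_integrable_openCone_norm (h : IsOpenInSphere ω) (hpos : 0 < angMass ω)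
    {g : ℝ → ℝ} (hg : AEStronglyMeasurable g (radMeas N))
    (hi : IntegrableOn (fun x : EuclideanSpace ℝ (Fin N) => g ‖x‖) (openCone ω)) :
    Integrable g (radMeas N) := by
  have := integrable_map_measure (μ := volume.restrict (openCone ω)) (f := fun x => ‖x‖) (g := g)
    (by rw [map_norm_openCone h]; exact hg.smul_measure _) measurable_norm.aemeasurable
  have h2 := this.2 hi
  rw [map_norm_openCone h] at h2
  exact (integrable_smul_measure (by simpa using hpos) ENNReal.ofReal_ne_top).1 h2

theorem integral_radMeas (g : ℝ → ℝ) :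
    ∫ r, g r ∂(radMeas N) = ∫ r in Ioi 0, r ^ (N - 1) * g r := by
  rw [radMeas, integral_withDensity_eq_integral_toReal_smul (by fun_prop) (by simp)]
  refine setIntegral_congr_fun measurableSet_Ioi fun r hr => ?_
  have : 0 ≤ r ^ (N - 1) := pow_nonneg (le_of_lt hr) _
  simp [ENNReal.toReal_ofReal this]

theorem integrable_radMeas_iff {g : ℝ → ℝ} :
    Integrable g (radMeas N) ↔ IntegrableOn (fun r => r ^ (N - 1) * g r) (Ioi 0) := by
  rw [radMeas, integrable_withDensity_iff_integrable_smul' (by fun_prop) (by simp), IntegrableOn]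
  refine integrable_congr ?_
  filter_upwards [ae_restrict_mem measurableSet_Ioi] with r hr
  have : 0 ≤ r ^ (N - 1) := pow_nonneg (le_of_lt hr) _
  simp [ENNReal.toReal_ofReal this]

end

/-! ### Weak gradients -/

section

variable {N : ℕ} {Ω : Set (EuclideanSpace ℝ (Fin N))}

theorem IsWeakGradient.weakGrad {u : EuclideanSpace ℝ (Fin N) → ℝ}
    (h : ∃ G, IsWeakGradient Ω u G) : IsWeakGradient Ω u (weakGrad Ω u) := by
  rw [CriticalCone.weakGrad, dif_pos h]
  exact h.choose_spec

theorem IsWeakGradient.weakGrad_ae_eq (hΩ : IsOpen Ω) {u : EuclideanSpace ℝ (Fin N) → ℝ}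
    {G : EuclideanSpace ℝ (Fin N) → EuclideanSpace ℝ (Fin N)} (h : IsWeakGradient Ω u G) :
    CriticalCone.weakGrad Ω u =ᵐ[volume.restrict Ω] G :=
  (IsWeakGradient.weakGrad ⟨G, h⟩).ae_eq hΩ h

theorem IsWeakGradient.congr {u v : EuclideanSpace ℝ (Fin N) → ℝ}
    {G : EuclideanSpace ℝ (Fin N) → EuclideanSpace ℝ (Fin N)} (h : IsWeakGradient Ω u G)
    (huv : u =ᵐ[volume.restrict Ω] v) : IsWeakGradient Ω v G := by
  refine ⟨h.locallyIntegrable_fun.congr huv, h.locallyIntegrable_grad, fun φ h1 h2 h3 w => ?_⟩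
  rw [← h.integral_by_parts φ h1 h2 h3 w]
  refine integral_congr_ae ?_
  filter_upwards [huv] with x hx
  rw [hx]

theorem mem_D12_of_isWeakGradient (hΩ : IsOpen Ω) {u : EuclideanSpace ℝ (Fin N) → ℝ}
    {G : EuclideanSpace ℝ (Fin N) → EuclideanSpace ℝ (Fin N)}
    (hu : MemLp u (ENNReal.ofReal (critExp N)) (volume.restrict Ω)) (h : IsWeakGradient Ω u G)
    (hG : MemLp G 2 (volume.restrict Ω)) : u ∈ D12 Ω :=
  ⟨hu, ⟨G, h⟩, (memLp_congr_ae (h.weakGrad_ae_eq hΩ)).2 hG⟩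

theorem inner_gradient (u : EuclideanSpace ℝ (Fin N) → ℝ) (x v : EuclideanSpace ℝ (Fin N)) :
    inner ℝ (gradient u x) v = fderiv ℝ u x v :=
  InnerProductSpace.toDual_symm_apply

theorem norm_gradient (u : EuclideanSpace ℝ (Fin N) → ℝ) (x : EuclideanSpace ℝ (Fin N)) :
    ‖gradient u x‖ = ‖fderiv ℝ u x‖ :=
  LinearIsometryEquiv.norm_map _ _

theorem continuous_gradient {u : EuclideanSpace ℝ (Fin N) → ℝ} (hu : ContDiff ℝ 1 u) :
    Continuous (gradient u) :=
  (LinearIsometryEquiv.continuous _).comp (hu.continuous_fderiv one_ne_zero)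

theorem apply_eq_zero_of_notMem {φ : EuclideanSpace ℝ (Fin N) → ℝ} (hs : tsupport φ ⊆ Ω)
    {x : EuclideanSpace ℝ (Fin N)} (hx : x ∉ Ω) : φ x = 0 :=
  image_eq_zero_of_notMem_tsupport fun h => hx (hs h)

theorem fderiv_eq_zero_of_notMem {φ : EuclideanSpace ℝ (Fin N) → ℝ} (hs : tsupport φ ⊆ Ω)
    {x : EuclideanSpace ℝ (Fin N)} (hx : x ∉ Ω) : fderiv ℝ φ x = 0 :=
  image_eq_zero_of_notMem_tsupport fun h => hx (hs (tsupport_fderiv_subset ℝ h))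

theorem isWeakGradient_of_contDiff {u : EuclideanSpace ℝ (Fin N) → ℝ} (hu : ContDiff ℝ 1 u) :
    IsWeakGradient Ω u (gradient u) := by
  refine ⟨hu.continuous.locallyIntegrable.locallyIntegrableOn _,
    (continuous_gradient hu).locallyIntegrable.locallyIntegrableOn _, fun φ h1 h2 h3 v => ?_⟩
  have hφd : Continuous fun x => fderiv ℝ φ x v :=
    (h1.continuous_fderiv (by simp)).clm_apply continuous_const
  have hud : Continuous fun x => fderiv ℝ u x v :=
    (hu.continuous_fderiv one_ne_zero).clm_apply continuous_const
  rw [setIntegral_eq_integral_of_forall_compl_eq_zero,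
    setIntegral_eq_integral_of_forall_compl_eq_zero]
  · simp_rw [inner_gradient]
    refine integral_mul_fderiv_eq_neg_fderiv_mul_of_integrable ?_ ?_ ?_ ?_ ?_
    · exact (hud.mul h1.continuous).integrable_of_hasCompactSupport h2.mul_left
    · refine (hu.continuous.mul hφd).integrable_of_hasCompactSupport ?_
      exact (h2.fderiv_apply (𝕜 := ℝ) v).mul_left
    · exact (hu.continuous.mul h1.continuous).integrable_of_hasCompactSupport h2.mul_left
    · exact fun x _ => hu.differentiable one_ne_zero x
    · exact fun x _ => h1.differentiable (by simp) x
  · intro x hx; simp [apply_eq_zero_of_notMem h3 hx]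
  · intro x hx; simp [fderiv_eq_zero_of_notMem h3 hx]

/-! ### Hölder's inequality for the critical exponent -/

/-- The conjugate exponent `2N/(N+2)` of `2*`. -/
def dualExp (N : ℕ) : ℝ := 2 * (N : ℝ) / ((N : ℝ) + 2)

theorem holderConjugate_critExp (hN : 3 ≤ N) :
    (ENNReal.ofReal (critExp N)).HolderConjugate (ENNReal.ofReal (dualExp N)) := by
  have h3 : (3 : ℝ) ≤ N := by exact_mod_cast hN
  refine Real.HolderConjugate.ennrealOfReal ?_
  refine Real.holderConjugate_iff.2 ⟨(by norm_num : (1 : ℝ) < 2).trans (two_lt_critExp hN), ?_⟩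
  have : (N : ℝ) - 2 ≠ 0 := by linarith
  rw [critExp, dualExp]
  field_simp
  ring

theorem integrable_mul_of_memLp_critExp (hN : 3 ≤ N) {X : Type*} [MeasurableSpace X] {μ : Measure X}
    {u k : X → ℝ} (hu : MemLp u (ENNReal.ofReal (critExp N)) μ)
    (hk : MemLp k (ENNReal.ofReal (dualExp N)) μ) : Integrable (fun x => u x * k x) μ := by
  have := holderConjugate_critExp hN
  exact hu.integrable_mul hk

theorem integrable_inner_of_memLp_two {X : Type*} [MeasurableSpace X] {μ : Measure X}
    {G H : X → EuclideanSpace ℝ (Fin N)} (hG : MemLp G 2 μ) (hH : MemLp H 2 μ) :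
    Integrable (fun x => inner ℝ (G x) (H x)) μ := by
  have h1 := (memLp_two_iff_integrable_sq_norm hG.1).1 hG
  have h2 := (memLp_two_iff_integrable_sq_norm hH.1).1 hH
  refine (h1.add h2).mono' (hG.1.inner hH.1) (ae_of_all _ fun x => ?_)
  refine (norm_inner_le_norm _ _).trans ?_
  simp only [Pi.add_apply]
  nlinarith [sq_nonneg (‖G x‖ - ‖H x‖), sq_nonneg ‖G x‖, sq_nonneg ‖H x‖]

/-! ### Radial vector fields on cones -/

/-- The function `η(x/|x|) g(|x|)`, the product of an angular and a radial factor. -/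
def conicTest (η : EuclideanSpace ℝ (Fin N) → ℝ) (g : ℝ → ℝ) (x : EuclideanSpace ℝ (Fin N)) : ℝ :=
  η (‖x‖⁻¹ • x) * g ‖x‖

variable {η : EuclideanSpace ℝ (Fin N) → ℝ} {g : ℝ → ℝ}

theorem conicTest_eventually_eq_zero (hgs : tsupport g ⊆ Ioi 0) :
    conicTest η g =ᶠ[𝓝 0] fun _ => 0 := by
  have h0 : (0 : ℝ) ∉ tsupport g := fun h => lt_irrefl (0 : ℝ) (hgs h)
  have h1 : ∀ᶠ r in 𝓝 (0 : ℝ), g r = 0 := by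
    have := notMem_tsupport_iff_eventuallyEq.1 h0
    exact this
  have h2 : Tendsto (fun x : EuclideanSpace ℝ (Fin N) => ‖x‖) (𝓝 0) (𝓝 0) := by
    simpa using (continuous_norm (E := EuclideanSpace ℝ (Fin N))).tendsto 0
  filter_upwards [h2.eventually h1] with x hx
  simp [conicTest, hx]

theorem contDiff_conicTest {n : ℕ∞} (hη : ContDiff ℝ n η) (hg : ContDiff ℝ n g)
    (hgs : tsupport g ⊆ Ioi 0) : ContDiff ℝ n (conicTest η g) := by
  refine contDiff_iff_contDiffAt.2 fun x => ?_
  by_cases hx : x = 0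
  · subst hx
    exact contDiffAt_const.congr_of_eventuallyEq (conicTest_eventually_eq_zero hgs)
  · have h1 : ContDiffAt ℝ n (fun x : EuclideanSpace ℝ (Fin N) => ‖x‖) x := contDiffAt_norm ℝ hx
    refine ContDiffAt.mul ?_ (hg.contDiffAt.comp x h1)
    exact hη.contDiffAt.comp x ((h1.inv (norm_ne_zero_iff.2 hx)).smul contDiffAt_id)

theorem conicTest_support {ω : Set (EuclideanSpace ℝ (Fin N))} (hω : ω ⊆ Metric.sphere 0 1)
    (hηs : tsupport η ⊆ openCone ω) (hgc : HasCompactSupport g) (hgs : tsupport g ⊆ Ioi 0) :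
    HasCompactSupport (conicTest η g) ∧ tsupport (conicTest η g) ⊆ openCone ω := by
  set K : Set (EuclideanSpace ℝ (Fin N)) :=
    (fun p : ℝ × EuclideanSpace ℝ (Fin N) => p.1 • p.2) ''
      (tsupport g ×ˢ (tsupport η ∩ Metric.sphere 0 1)) with hK
  have hKc : IsCompact K := by
    refine IsCompact.image (hgc.isCompact.prod ?_) (by fun_prop)
    exact (isCompact_sphere 0 1).inter_left (isClosed_tsupport _)
  have hsub : Function.support (conicTest η g) ⊆ K := by
    intro x hx
    have h1 : η (‖x‖⁻¹ • x) ≠ 0 := fun h => hx (by simp [conicTest, h])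
    have h2 : g ‖x‖ ≠ 0 := fun h => hx (by simp [conicTest, h])
    have h3 : ‖x‖ ∈ tsupport g := subset_closure h2
    have h4 : ‖x‖ ≠ 0 := (hgs h3).ne'
    refine ⟨(‖x‖, ‖x‖⁻¹ • x), ⟨h3, subset_closure h1, ?_⟩, ?_⟩
    · simp [norm_smul, h4]
    · simp [smul_smul, h4]
  have hKΩ : K ⊆ openCone ω := by
    rintro _ ⟨⟨r, θ⟩, ⟨hr, hθ, hθ1⟩, rfl⟩
    obtain ⟨h0, h1⟩ := (mem_openCone_iff hω).1 (hηs hθ)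
    have hn : ‖θ‖ = 1 := by simpa using hθ1
    rw [hn, inv_one, one_smul] at h1
    exact ⟨θ, h1, r, hgs hr, rfl⟩
  exact ⟨HasCompactSupport.of_support_subset_isCompact hKc hsub,
    (closure_minimal hsub hKc.isClosed).trans hKΩ⟩

/-- Euler's relation: the radial derivative only sees the radial factor. -/
theorem fderiv_conicTest_self (hη : ContDiff ℝ 1 η) (hg : ContDiff ℝ 1 g)
    (hgs : tsupport g ⊆ Ioi 0) (x : EuclideanSpace ℝ (Fin N)) :
    fderiv ℝ (conicTest η g) x x = η (‖x‖⁻¹ • x) * (‖x‖ * deriv g ‖x‖) := by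
  by_cases hx : x = 0
  · subst hx; simp
  have h1 : HasDerivAt (fun t : ℝ => t • x) x 1 := by
    simpa using (hasDerivAt_id (1 : ℝ)).smul_const x
  have h2 : HasFDerivAt (conicTest η g) (fderiv ℝ (conicTest η g) ((1 : ℝ) • x)) ((1 : ℝ) • x) :=
    ((contDiff_conicTest (n := 1) hη hg hgs).differentiable one_ne_zero _).hasFDerivAt
  have h3 := h2.comp_hasDerivAt (1 : ℝ) h1
  rw [one_smul] at h3
  have h4 : HasDerivAt (fun t : ℝ => η (‖x‖⁻¹ • x) * g (t * ‖x‖))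
      (η (‖x‖⁻¹ • x) * (deriv g ‖x‖ * ‖x‖)) 1 := by
    have h5 : HasDerivAt (fun t : ℝ => t * ‖x‖) ‖x‖ 1 := by
      simpa using (hasDerivAt_id (1 : ℝ)).mul_const ‖x‖
    have h6 : HasDerivAt g (deriv g (1 * ‖x‖)) (1 * ‖x‖) :=
      (hg.differentiable one_ne_zero _).hasDerivAt
    have h7 := h6.comp (1 : ℝ) h5
    rw [one_mul] at h7
    exact h7.const_mul _
  have h8 : (conicTest η g ∘ fun t : ℝ => t • x) =ᶠ[𝓝 1]
      fun t : ℝ => η (‖x‖⁻¹ • x) * g (t * ‖x‖) := by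
    filter_upwards [lt_mem_nhds one_pos] with t ht
    have hx0 := norm_ne_zero_iff.2 hx
    simp only [Function.comp, conicTest, norm_smul, Real.norm_of_nonneg ht.le, smul_smul]
    congr 3
    field_simp
  rw [h3.unique (h4.congr_of_eventuallyEq h8)]
  ring

variable {ω : Set (EuclideanSpace ℝ (Fin N))} {u : EuclideanSpace ℝ (Fin N) → ℝ}
  {G : EuclideanSpace ℝ (Fin N) → EuclideanSpace ℝ (Fin N)}

/-- The divergence theorem for the field `η(x/|x|) g(|x|) x`, whose divergence contains no
derivative of the angular factor `η`. -/
theorem integral_div_conicTest (hω : ω ⊆ Metric.sphere 0 1)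
    (hG : IsWeakGradient (openCone ω) u G)
    (hη : ContDiff ℝ ((⊤ : ℕ∞) : WithTop ℕ∞) η) (hηs : tsupport η ⊆ openCone ω)
    (hg : ContDiff ℝ ((⊤ : ℕ∞) : WithTop ℕ∞) g)
    (hgc : HasCompactSupport g) (hgs : tsupport g ⊆ Ioi 0) :
    ∫ x in openCone ω, u x * (η (‖x‖⁻¹ • x) * (N * g ‖x‖ + ‖x‖ * deriv g ‖x‖)) =
      - ∫ x in openCone ω, inner ℝ (G x) x * (η (‖x‖⁻¹ • x) * g ‖x‖) := by
  set ψ := conicTest η g with hψ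
  have hψd : ContDiff ℝ ((⊤ : ℕ∞) : WithTop ℕ∞) ψ := contDiff_conicTest hη hg hgs
  obtain ⟨hψc, hψs⟩ := conicTest_support hω hηs hgc hgs
  have hint1 : ∀ k : EuclideanSpace ℝ (Fin N) → ℝ, Continuous k → HasCompactSupport k →
      tsupport k ⊆ openCone ω → IntegrableOn (fun x => u x * k x) (openCone ω) := by
    intro k hk hkc hks
    have h1 : IntegrableOn (fun x => u x * k x) (tsupport k) :=
      (hG.locallyIntegrable_fun.integrableOn_compact_subset hks hkc).mul_continuousOn
        hk.continuousOn hkc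
    refine ((integrableOn_iff_integrable_of_support_subset ?_).1 h1).integrableOn
    intro x hx
    exact subset_closure fun h => hx (by simp [h])
  have hint2 : ∀ v : EuclideanSpace ℝ (Fin N), ∀ k : EuclideanSpace ℝ (Fin N) → ℝ, Continuous k →
      HasCompactSupport k → tsupport k ⊆ openCone ω →
      IntegrableOn (fun x => inner ℝ (G x) v * k x) (openCone ω) := by
    intro v k hk hkc hks
    have h0 : IntegrableOn (fun x => inner ℝ (G x) v) (tsupport k) :=
      (hG.locallyIntegrable_grad.integrableOn_compact_subset hks hkc).inner_const v
    have h1 : IntegrableOn (fun x => inner ℝ (G x) v * k x) (tsupport k) :=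
      h0.mul_continuousOn hk.continuousOn hkc
    refine ((integrableOn_iff_integrable_of_support_subset ?_).1 h1).integrableOn
    intro x hx
    exact subset_closure fun h => hx (by simp [h])
  -- the components of the field
  set c : Fin N → EuclideanSpace ℝ (Fin N) → ℝ := fun i x => x i * ψ x with hc
  have hci : ∀ i, ContDiff ℝ ((⊤ : ℕ∞) : WithTop ℕ∞) (fun x : EuclideanSpace ℝ (Fin N) => x i) :=
    fun i => (EuclideanSpace.proj (𝕜 := ℝ) i).contDiff
  have hcd : ∀ i, ContDiff ℝ ((⊤ : ℕ∞) : WithTop ℕ∞) (c i) := fun i => (hci i).mul hψd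
  have hcc : ∀ i, HasCompactSupport (c i) := fun i => hψc.mul_left
  have hcs : ∀ i, tsupport (c i) ⊆ openCone ω := fun i => (tsupport_mul_subset_right).trans hψs
  set e : Fin N → EuclideanSpace ℝ (Fin N) := fun i => EuclideanSpace.single i 1 with he
  have hsum : ∀ x : EuclideanSpace ℝ (Fin N), x = ∑ i, x i • e i := fun x => by
    ext j; simp [he, Pi.single_apply]
  have hlin : ∀ (L : EuclideanSpace ℝ (Fin N) →L[ℝ] ℝ) x, ∑ i, x i * L (e i) = L x := by
    intro L x
    conv_rhs => rw [hsum x]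
    simp
  have hfd : ∀ i x, fderiv ℝ (c i) x (e i) = ψ x + x i * fderiv ℝ ψ x (e i) := by
    intro i x
    have h1 : HasFDerivAt (fun x : EuclideanSpace ℝ (Fin N) => x i)
        (EuclideanSpace.proj (𝕜 := ℝ) i) x := (EuclideanSpace.proj (𝕜 := ℝ) i).hasFDerivAt
    have h2 := h1.mul (hψd.differentiable (by simp) x).hasFDerivAt
    have h3 : fderiv ℝ (c i) x = _ := h2.fderiv
    rw [h3]
    simp [he]
    ring
  have hparts := fun i => hG.integral_by_parts (c i) (hcd i) (hcc i) (hcs i) (e i)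
  have hA : ∀ x, ∑ i, u x * fderiv ℝ (c i) x (e i) =
      u x * (η (‖x‖⁻¹ • x) * (N * g ‖x‖ + ‖x‖ * deriv g ‖x‖)) := by
    intro x
    have h1 := hlin (fderiv ℝ ψ x) x
    rw [← Finset.mul_sum]
    simp_rw [hfd]
    rw [Finset.sum_add_distrib, h1, fderiv_conicTest_self (hη.of_le (by simp)) (hg.of_le (by simp))
      hgs]
    simp only [hψ, conicTest, Finset.sum_const, Finset.card_univ, Fintype.card_fin, nsmul_eq_mul]
    ring
  have hB : ∀ x, ∑ i, inner ℝ (G x) (e i) * c i x =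
      inner ℝ (G x) x * (η (‖x‖⁻¹ • x) * g ‖x‖) := by
    intro x
    have h1 := hlin (innerSL ℝ (G x)) x
    simp only [innerSL_apply_apply] at h1
    rw [← h1, Finset.sum_mul]
    refine Finset.sum_congr rfl fun i _ => ?_
    simp only [hc, hψ, conicTest]
    ring
  simp_rw [← hA, ← hB]
  rw [integral_finsetSum, integral_finsetSum, ← Finset.sum_neg_distrib]
  · exact Finset.sum_congr rfl fun i _ => hparts i
  · exact fun i _ => hint2 (e i) (c i) (hcd i).continuous (hcc i) (hcs i)
  · intro i _
    refine hint1 _ (((hcd i).continuous_fderiv (by simp)).clm_apply continuous_const)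
      ((hcc i).fderiv_apply (𝕜 := ℝ) (e i)) ?_
    refine Subset.trans ?_ (hcs i)
    exact tsupport_fderiv_apply_subset ℝ (e i)

theorem exists_angular_cutoff {U : Set (EuclideanSpace ℝ (Fin N))} (ho : IsOpen U) :
    ∃ η : ℕ → EuclideanSpace ℝ (Fin N) → ℝ,
      (∀ k, ContDiff ℝ ((⊤ : ℕ∞) : WithTop ℕ∞) (η k)) ∧ (∀ k, tsupport (η k) ⊆ U) ∧
      (∀ k x, |η k x| ≤ 1) ∧ ∀ x ∈ U, Tendsto (fun k => η k x) atTop (𝓝 1) := by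
  obtain ⟨f, hfs, hfd, hfr⟩ := ho.exists_contDiff_support_eq (n := ⊤)
  have hf0 : ∀ x, 0 ≤ f x := fun x => (hfr ⟨x, rfl⟩).1
  refine ⟨fun k x => Real.smoothTransition (k * f x - 1), fun k => ?_, fun k => ?_, fun k x => ?_,
    fun x hx => ?_⟩
  · exact Real.smoothTransition.contDiff.comp ((contDiff_const.mul hfd).sub contDiff_const)
  · have h1 : Function.support (fun x => Real.smoothTransition (k * f x - 1)) ⊆ {x | 1 ≤ k * f x} := by
      intro x hx
      by_contra h
      simp only [mem_ofPred_eq, not_le] at h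
      exact hx (Real.smoothTransition.zero_of_nonpos (by linarith))
    have h2 : IsClosed {x | 1 ≤ k * f x} :=
      isClosed_le continuous_const (continuous_const.mul hfd.continuous)
    refine (closure_minimal h1 h2).trans fun x hx => ?_
    rw [← hfs]
    intro h
    simp only [mem_ofPred_eq, h, mul_zero] at hx
    linarith
  · rw [abs_of_nonneg (Real.smoothTransition.nonneg _)]
    exact Real.smoothTransition.le_one _
  · have hpos : 0 < f x := lt_of_le_of_ne (hf0 x) (by rw [← hfs] at hx; exact Ne.symm hx)
    have h1 : Tendsto (fun k : ℕ => (k : ℝ) * f x) atTop atTop :=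
      tendsto_natCast_atTop_atTop.atTop_mul_const hpos
    refine tendsto_const_nhds.congr' ?_
    filter_upwards [h1.eventually_ge_atTop 2] with k hk
    exact (Real.smoothTransition.one_of_one_le (by linarith)).symm

/-- The divergence theorem for a compactly supported radial field `g(|x|) x` on a cone: such a field
is tangent to the boundary, so that no boundary terms appear, whatever the regularity of the
cone. -/
theorem integral_div_radial (hN : 3 ≤ N) (hω : IsOpenInSphere ω)
    (hG : IsWeakGradient (openCone ω) u G)
    (hu : MemLp u (ENNReal.ofReal (critExp N)) (volume.restrict (openCone ω)))
    (hG2 : MemLp G 2 (volume.restrict (openCone ω)))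
    (hg : ContDiff ℝ ((⊤ : ℕ∞) : WithTop ℕ∞) g)
    (hgc : HasCompactSupport g) (hgs : tsupport g ⊆ Ioi 0) :
    ∫ x in openCone ω, u x * (N * g ‖x‖ + ‖x‖ * deriv g ‖x‖) =
      - ∫ x in openCone ω, inner ℝ (G x) x * g ‖x‖ := by
  have ho := hω.isOpen_openCone
  obtain ⟨η, hηd, hηs, hη1, hηlim⟩ := exists_angular_cutoff ho
  have hmem : ∀ x ∈ openCone ω, ‖x‖⁻¹ • x ∈ openCone ω := fun x hx => by
    have h := ((mem_openCone_iff hω.subset_sphere).1 hx).2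
    exact ⟨_, h, 1, one_pos, by rw [one_smul]⟩
  have hmeas : ∀ k, Measurable fun x : EuclideanSpace ℝ (Fin N) => η k (‖x‖⁻¹ • x) := fun k =>
    (hηd k).continuous.measurable.comp (by fun_prop)
  have hgd : Continuous (deriv g) := hg.continuous_deriv (by simp)
  have hk1 : Continuous fun x : EuclideanSpace ℝ (Fin N) => N * g ‖x‖ + ‖x‖ * deriv g ‖x‖ := by
    have := hg.continuous
    fun_prop
  have hsupp : ∀ k : ℝ → ℝ, HasCompactSupport k →
      HasCompactSupport fun x : EuclideanSpace ℝ (Fin N) => k ‖x‖ := by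
    intro k hk
    obtain ⟨R, hR⟩ := hk.isCompact.isBounded.exists_norm_le
    refine HasCompactSupport.of_support_subset_isCompact (isCompact_closedBall 0 R) fun x hx => ?_
    simpa using hR ‖x‖ (subset_closure hx)
  have hi1 : Integrable (fun x => u x * (N * g ‖x‖ + ‖x‖ * deriv g ‖x‖))
      (volume.restrict (openCone ω)) := by
    refine integrable_mul_of_memLp_critExp hN hu (MemLp.restrict _ ?_)
    exact hk1.memLp_of_hasCompactSupport
      (((hsupp g hgc).mul_left).add ((hsupp _ hgc.deriv).mul_left))
  have hi2 : Integrable (fun x => inner ℝ (G x) x * g ‖x‖) (volume.restrict (openCone ω)) := by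
    have h1 : MemLp (fun x : EuclideanSpace ℝ (Fin N) => g ‖x‖ • x) 2
        (volume.restrict (openCone ω)) := by
      refine MemLp.restrict _ (Continuous.memLp_of_hasCompactSupport ?_ (hsupp g hgc).smul_right)
      have := hg.continuous
      fun_prop
    refine (integrable_inner_of_memLp_two hG2 h1).congr (ae_of_all _ fun x => ?_)
    simp only [inner_smul_right]
    ring
  have hlim1 : Tendsto (fun k => ∫ x in openCone ω,
      u x * (η k (‖x‖⁻¹ • x) * (N * g ‖x‖ + ‖x‖ * deriv g ‖x‖))) atTop
      (𝓝 (∫ x in openCone ω, u x * (N * g ‖x‖ + ‖x‖ * deriv g ‖x‖))) := by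
    refine tendsto_integral_of_dominated_convergence _ (fun k => ?_) hi1.norm (fun k => ?_) ?_
    · exact hu.1.mul ((hmeas k).mul hk1.measurable).aestronglyMeasurable
    · refine ae_of_all _ fun x => ?_
      rw [norm_mul, norm_mul, norm_mul]
      refine mul_le_mul_of_nonneg_left ?_ (norm_nonneg _)
      exact mul_le_of_le_one_left (norm_nonneg _) (hη1 k _)
    · filter_upwards [ae_restrict_mem ho.measurableSet] with x hx
      simpa using ((hηlim _ (hmem x hx)).mul_const (N * g ‖x‖ + ‖x‖ * deriv g ‖x‖)).const_mul (u x)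
  have hlim2 : Tendsto (fun k => ∫ x in openCone ω,
      inner ℝ (G x) x * (η k (‖x‖⁻¹ • x) * g ‖x‖)) atTop
      (𝓝 (∫ x in openCone ω, inner ℝ (G x) x * g ‖x‖)) := by
    refine tendsto_integral_of_dominated_convergence _ (fun k => ?_) hi2.norm (fun k => ?_) ?_
    · exact (hG2.1.inner aestronglyMeasurable_id).mul
        ((hmeas k).mul (hg.continuous.measurable.comp measurable_norm)).aestronglyMeasurable
    · refine ae_of_all _ fun x => ?_
      rw [norm_mul, norm_mul, norm_mul]
      refine mul_le_mul_of_nonneg_left ?_ (norm_nonneg _)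
      exact mul_le_of_le_one_left (norm_nonneg _) (hη1 k _)
    · filter_upwards [ae_restrict_mem ho.measurableSet] with x hx
      simpa using ((hηlim _ (hmem x hx)).mul_const (g ‖x‖)).const_mul (inner ℝ (G x) x)
  -- angular cutoffs converge to `1` on the cone with no control of their derivatives, which do not
  -- enter the identity
  refine tendsto_nhds_unique hlim1 (hlim2.neg.congr fun k => ?_)
  exact (integral_div_conicTest hω.subset_sphere hG (hηd k) (hηs k) hg hgc hgs).symm

/-- Cutoff functions on the half-line, with scale-invariant bounds on the derivatives. -/
theorem exists_radial_cutoff : ∃ χ : ℕ → ℝ → ℝ,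
    (∀ k, ContDiff ℝ ((⊤ : ℕ∞) : WithTop ℕ∞) (χ k)) ∧ (∀ k, HasCompactSupport (χ k)) ∧
    (∀ k, tsupport (χ k) ⊆ Ioi 0) ∧ (∀ k r, |χ k r| ≤ 1) ∧
    (∀ r, 0 < r → ∀ᶠ k in atTop, χ k =ᶠ[𝓝 r] fun _ => 1) ∧
    ∃ C, ∀ k r, |r * deriv (χ k) r| ≤ C := by
  set s := Real.smoothTransition with hs
  have hsd : ContDiff ℝ ((⊤ : ℕ∞) : WithTop ℕ∞) s := Real.smoothTransition.contDiff
  have hs0 : ∀ t, t ≤ 0 → s t = 0 := fun t ht => Real.smoothTransition.zero_of_nonpos ht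
  have hs1 : ∀ t, 1 ≤ t → s t = 1 := fun t ht => Real.smoothTransition.one_of_one_le ht
  have hsn : ∀ t, 0 ≤ s t := Real.smoothTransition.nonneg
  have hsl : ∀ t, s t ≤ 1 := Real.smoothTransition.le_one
  have hds : ∀ t, HasDerivAt s (deriv s t) t := fun t =>
    (hsd.differentiable (by simp) t).hasDerivAt
  obtain ⟨C, hC⟩ : ∃ C, ∀ t, ‖(t + 1) * deriv s t‖ ≤ C := by
    refine Continuous.bounded_above_of_compact_support
      ((continuous_id.add continuous_const).mul (hsd.continuous_deriv (by simp))) ?_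
    refine HasCompactSupport.mul_left ?_
    refine HasCompactSupport.of_support_subset_isCompact (isCompact_Icc (a := (0 : ℝ)) (b := 1)) ?_
    intro t ht
    by_contra h
    rw [mem_Icc, not_and_or, not_le, not_le] at h
    refine ht ?_
    rcases h with h | h
    · have : s =ᶠ[𝓝 t] fun _ => 0 := by
        filter_upwards [gt_mem_nhds h] with r hr using hs0 r hr.le
      rw [this.deriv_eq]; simp
    · have : s =ᶠ[𝓝 t] fun _ => 1 := by
        filter_upwards [lt_mem_nhds h] with r hr using hs1 r hr.le
      rw [this.deriv_eq]; simp
  set a : ℕ → ℝ := fun k => (k : ℝ) + 1 with ha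
  have ha0 : ∀ k, 0 < a k := fun k => by positivity
  have halim : Tendsto a atTop atTop :=
    tendsto_atTop_add_const_right _ _ tendsto_natCast_atTop_atTop
  have hsub : ∀ k, Function.support (fun r => s (a k * r - 1) * (1 - s (r / a k - 1))) ⊆
      Icc (1 / a k) (2 * a k) := by
    intro k r hr
    by_contra h
    rw [mem_Icc, not_and_or, not_le, not_le] at h
    refine hr ?_
    rcases h with h | h
    · rw [lt_div_iff₀ (ha0 k)] at h
      simp only [hs0 (a k * r - 1) (by linarith), zero_mul]
    · have : 2 ≤ r / a k := by rw [le_div_iff₀ (ha0 k)]; exact h.le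
      simp only [hs1 (r / a k - 1) (by linarith), sub_self, mul_zero]
  refine ⟨fun k r => s (a k * r - 1) * (1 - s (r / a k - 1)), fun k => ?_, fun k => ?_, fun k => ?_,
    fun k r => ?_, fun r hr => ?_, C + C, fun k r => ?_⟩
  · exact (hsd.comp ((contDiff_const.mul contDiff_id).sub contDiff_const)).mul
      (contDiff_const.sub (hsd.comp ((contDiff_id.div_const _).sub contDiff_const)))
  · exact HasCompactSupport.of_support_subset_isCompact isCompact_Icc (hsub k)
  · refine (closure_minimal (hsub k) isClosed_Icc).trans fun r hr => ?_
    exact (div_pos one_pos (ha0 k)).trans_le hr.1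
  · rw [abs_le]
    constructor <;> nlinarith [hsn (a k * r - 1), hsl (a k * r - 1), hsn (r / a k - 1),
      hsl (r / a k - 1)]
  · have h1 : ∀ᶠ k in atTop, 2 / r < a k := halim.eventually_gt_atTop _
    have h2 : ∀ᶠ k in atTop, r < a k := halim.eventually_gt_atTop _
    filter_upwards [h1, h2] with k hk1 hk2
    have hk1' : 2 / a k < r := by
      rw [div_lt_iff₀ hr] at hk1
      rw [div_lt_iff₀ (ha0 k)]
      linarith
    filter_upwards [lt_mem_nhds hk1', gt_mem_nhds hk2] with t ht1 ht2
    rw [div_lt_iff₀ (ha0 k)] at ht1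
    have h3 : t / a k ≤ 1 := by rw [div_le_one (ha0 k)]; exact ht2.le
    rw [hs1 (a k * t - 1) (by linarith), hs0 (t / a k - 1) (by linarith)]
    norm_num
  · have e1 : HasDerivAt (fun r => s (a k * r - 1)) (deriv s (a k * r - 1) * a k) r := by
      have h := (((hasDerivAt_id r).const_mul (a k)).sub_const 1)
      rw [mul_one] at h
      exact (hds (a k * r - 1)).comp r h
    have e2 : HasDerivAt (fun r => s (r / a k - 1)) (deriv s (r / a k - 1) * (1 / a k)) r := by
      have h := (((hasDerivAt_id r).div_const (a k)).sub_const 1)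
      exact (hds (r / a k - 1)).comp r h
    have e3 := e1.mul (e2.const_sub 1)
    have e4 : deriv (fun r => s (a k * r - 1) * (1 - s (r / a k - 1))) r = _ := e3.deriv
    rw [e4]
    have e5 : r * (deriv s (a k * r - 1) * a k * (1 - s (r / a k - 1)) +
        s (a k * r - 1) * -(deriv s (r / a k - 1) * (1 / a k))) =
        ((a k * r - 1) + 1) * deriv s (a k * r - 1) * (1 - s (r / a k - 1)) -
        ((r / a k - 1) + 1) * deriv s (r / a k - 1) * s (a k * r - 1) := by
      have hak : r * (deriv s (a k * r - 1) * a k) = (a k * r) * deriv s (a k * r - 1) := by ring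
      rw [sub_add_cancel, sub_add_cancel, mul_add, ← mul_assoc r, hak, div_eq_mul_one_div r]
      ring
    rw [e5]
    refine (abs_sub _ _).trans (add_le_add ?_ ?_)
    · rw [abs_mul]
      refine (mul_le_of_le_one_right (abs_nonneg _) ?_).trans (hC _)
      rw [abs_le]
      constructor <;> linarith [hsn (r / a k - 1), hsl (r / a k - 1)]
    · rw [abs_mul]
      refine (mul_le_of_le_one_right (abs_nonneg _) ?_).trans (hC _)
      rw [abs_of_nonneg (hsn _)]
      exact hsl _

theorem memLp_decay (hN : 3 ≤ N) :
    MemLp (fun x : EuclideanSpace ℝ (Fin N) => (1 + ‖x‖ ^ 2) ^ (-(N : ℝ) / 2))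
      (ENNReal.ofReal (dualExp N)) := by
  have h3 : (3 : ℝ) ≤ N := by exact_mod_cast hN
  have hd : 1 < dualExp N := by
    rw [dualExp, lt_div_iff₀ (by linarith)]; linarith
  have hm : AEStronglyMeasurable
      (fun x : EuclideanSpace ℝ (Fin N) => (1 + ‖x‖ ^ 2) ^ (-(N : ℝ) / 2)) volume :=
    Measurable.aestronglyMeasurable (by fun_prop)
  rw [← integrable_norm_rpow_iff hm (by simpa using one_pos.trans hd) ENNReal.ofReal_ne_top,
    ENNReal.toReal_ofReal (by linarith)]
  have := integrable_rpow_neg_one_add_norm_sq (E := EuclideanSpace ℝ (Fin N))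
    (μ := volume) (r := N * dualExp N) (by
      rw [finrank_euclideanSpace_fin]
      nlinarith)
  refine this.congr (ae_of_all _ fun x => ?_)
  have hb : 0 < 1 + ‖x‖ ^ 2 := by positivity
  simp only
  rw [Real.norm_of_nonneg (Real.rpow_nonneg hb.le _), ← Real.rpow_mul hb.le]
  congr 1
  ring

theorem memLp_two_decay (hN : 3 ≤ N) :
    MemLp (fun x : EuclideanSpace ℝ (Fin N) => (1 + ‖x‖ ^ 2) ^ (-(N : ℝ) / 2) • x) 2 := by
  rw [memLp_two_iff_integrable_sq_norm (Measurable.aestronglyMeasurable (by fun_prop))]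
  refine (integrable_bubbleMoment hN).congr (ae_of_all _ fun x => ?_)
  have hb : 0 < 1 + ‖x‖ ^ 2 := by positivity
  simp only
  rw [norm_smul, mul_pow, Real.norm_of_nonneg (Real.rpow_nonneg hb.le _), mul_comm]
  congr 1
  generalize 1 + ‖x‖ ^ 2 = b at hb
  rw [← Real.rpow_natCast (_ ^ _), ← Real.rpow_mul hb.le, ← Real.rpow_natCast, ← Real.rpow_neg hb.le]
  congr 1
  push_cast
  ring

/-- The divergence theorem on a cone for radial fields `h(|x|) x` decaying like `|x|^{1-N}`. -/
theorem integral_div_radial_of_decay (hN : 3 ≤ N) (hω : IsOpenInSphere ω)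
    (hG : IsWeakGradient (openCone ω) u G)
    (hu : MemLp u (ENNReal.ofReal (critExp N)) (volume.restrict (openCone ω)))
    (hG2 : MemLp G 2 (volume.restrict (openCone ω))) {h : ℝ → ℝ} {C : ℝ}
    (hh : ContDiff ℝ ((⊤ : ℕ∞) : WithTop ℕ∞) h)
    (hb : ∀ r, |h r| ≤ C * (1 + r ^ 2) ^ (-(N : ℝ) / 2))
    (hb' : ∀ r, |r * deriv h r| ≤ C * (1 + r ^ 2) ^ (-(N : ℝ) / 2)) :
    ∫ x in openCone ω, u x * (N * h ‖x‖ + ‖x‖ * deriv h ‖x‖) =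
      - ∫ x in openCone ω, inner ℝ (G x) x * h ‖x‖ := by
  have ho := hω.isOpen_openCone
  have hC0 : 0 ≤ C := by
    have := (abs_nonneg _).trans (hb 0)
    simpa using this
  obtain ⟨χ, hχd, hχc, hχs, hχ1, hχlim, K, hK⟩ := exists_radial_cutoff
  have hK0 : 0 ≤ K := (abs_nonneg _).trans (hK 0 0)
  have hhd : Continuous (deriv h) := hh.continuous_deriv (by simp)
  have hdd : ∀ k r, HasDerivAt (fun r => χ k r * h r) (deriv (χ k) r * h r + χ k r * deriv h r) r :=
    fun k r => ((hχd k).differentiable (by simp) r).hasDerivAt.mul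
      (hh.differentiable (by simp) r).hasDerivAt
  have hid := fun k => integral_div_radial hN hω hG hu hG2 (g := fun r => χ k r * h r)
    ((hχd k).mul hh) (hχc k).mul_right (tsupport_mul_subset_left.trans (hχs k))
  set d : EuclideanSpace ℝ (Fin N) → ℝ := fun x => (1 + ‖x‖ ^ 2) ^ (-(N : ℝ) / 2) with hd
  have hd0 : ∀ x, 0 ≤ d x := fun x => by positivity
  have hi1 : Integrable (fun x => ‖u x * d x‖ * ((N + K + 1) * C)) (volume.restrict (openCone ω)) :=
    (integrable_mul_of_memLp_critExp hN hu ((memLp_decay hN).restrict _)).norm.mul_const _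
  have hi2 : Integrable (fun x => ‖inner ℝ (G x) (d x • x)‖ * C) (volume.restrict (openCone ω)) :=
    (integrable_inner_of_memLp_two hG2 ((memLp_two_decay hN).restrict _)).norm.mul_const _
  have hpos : ∀ x ∈ openCone ω, 0 < ‖x‖ := fun x hx =>
    norm_pos_iff.2 ((mem_openCone_iff hω.subset_sphere).1 hx).1
  have hlim1 : Tendsto (fun k => ∫ x in openCone ω, u x * (N * (χ k ‖x‖ * h ‖x‖) +
      ‖x‖ * deriv (fun r => χ k r * h r) ‖x‖)) atTop
      (𝓝 (∫ x in openCone ω, u x * (N * h ‖x‖ + ‖x‖ * deriv h ‖x‖))) := by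
    simp_rw [fun k r => (hdd k r).deriv]
    refine tendsto_integral_of_dominated_convergence _ (fun k => ?_) hi1 (fun k => ?_) ?_
    · have c1 := (hχd k).continuous
      have c2 := hh.continuous
      have c3 : Continuous (deriv (χ k)) := (hχd k).continuous_deriv (by simp)
      exact hu.1.mul (Continuous.aestronglyMeasurable (by fun_prop))
    · refine ae_of_all _ fun x => ?_
      rw [norm_mul, norm_mul, mul_assoc]
      refine mul_le_mul_of_nonneg_left ?_ (norm_nonneg _)
      have b1 := hb ‖x‖
      have b2 := hb' ‖x‖
      change _ ≤ C * d x at b1 b2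
      rw [Real.norm_of_nonneg (hd0 x), Real.norm_eq_abs]
      have e : N * (χ k ‖x‖ * h ‖x‖) + ‖x‖ * (deriv (χ k) ‖x‖ * h ‖x‖ + χ k ‖x‖ * deriv h ‖x‖) =
          N * (χ k ‖x‖ * h ‖x‖) + ((‖x‖ * deriv (χ k) ‖x‖) * h ‖x‖ +
            χ k ‖x‖ * (‖x‖ * deriv h ‖x‖)) := by ring
      rw [e]
      have hCd : 0 ≤ C * d x := mul_nonneg hC0 (hd0 x)
      calc _ ≤ |N * (χ k ‖x‖ * h ‖x‖)| + (|(‖x‖ * deriv (χ k) ‖x‖) * h ‖x‖| +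
            |χ k ‖x‖ * (‖x‖ * deriv h ‖x‖)|) :=
            (abs_add_le _ _).trans (add_le_add le_rfl (abs_add_le _ _))
        _ ≤ N * (1 * (C * d x)) + (K * (C * d x) + 1 * (C * d x)) := by
            rw [abs_mul, abs_mul, abs_mul (‖x‖ * _), abs_mul (χ k ‖x‖), Nat.abs_cast]
            gcongr
            · exact hχ1 k _
            · exact hK k _
            · exact hχ1 k _
        _ = d x * ((N + K + 1) * C) := by ring
    · filter_upwards [ae_restrict_mem ho.measurableSet] with x hx
      refine tendsto_const_nhds.congr' ?_
      filter_upwards [hχlim ‖x‖ (hpos x hx)] with k hk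
      rw [hk.deriv_eq, hk.eq_of_nhds]
      simp
  have hlim2 : Tendsto (fun k => ∫ x in openCone ω, inner ℝ (G x) x * (χ k ‖x‖ * h ‖x‖)) atTop
      (𝓝 (∫ x in openCone ω, inner ℝ (G x) x * h ‖x‖)) := by
    refine tendsto_integral_of_dominated_convergence _ (fun k => ?_) hi2 (fun k => ?_) ?_
    · have c1 := (hχd k).continuous
      have c2 := hh.continuous
      exact (hG2.1.inner aestronglyMeasurable_id).mul
        (Continuous.aestronglyMeasurable (by fun_prop))
    · refine ae_of_all _ fun x => ?_
      rw [inner_smul_right, norm_mul, norm_mul, norm_mul, mul_comm ‖d x‖, mul_assoc]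
      refine mul_le_mul_of_nonneg_left ?_ (norm_nonneg _)
      rw [Real.norm_of_nonneg (hd0 x), mul_comm (d x)]
      refine le_trans ?_ (hb ‖x‖)
      exact mul_le_of_le_one_left (norm_nonneg _) (hχ1 k _)
    · filter_upwards [ae_restrict_mem ho.measurableSet] with x hx
      refine tendsto_const_nhds.congr' ?_
      filter_upwards [hχlim ‖x‖ (hpos x hx)] with k hk
      rw [hk.eq_of_nhds]
      simp
  exact tendsto_nhds_unique hlim1 (hlim2.neg.congr fun k => (hid k).symm)

end

/-! ### The bubbles -/

section

variable {N : ℕ}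

/-- The normalising constant `a_N` of the bubbles. -/
def bubbleConst (N : ℕ) : ℝ := ((N : ℝ) * ((N : ℝ) - 2)) ^ (((N : ℝ) - 2) / 4)

/-- The radial factor of the gradient of the bubble: `∇U_ε(x) = bubbleSlope N ε |x| • x`. -/
def bubbleSlope (N : ℕ) (ε r : ℝ) : ℝ :=
  -(((N : ℝ) - 2) * bubbleConst N * ε ^ (((N : ℝ) - 2) / 2)) * (ε ^ 2 + r ^ 2) ^ (-(N : ℝ) / 2)

/-- The integral of `U_ε^{2*}` over `ℝ^N`. -/
def bubbleEnergy (N : ℕ) : ℝ := bubbleConst N ^ critExp N * bubbleMass N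

theorem bubbleConst_pos (hN : 3 ≤ N) : 0 < bubbleConst N := by
  have h3 : (3 : ℝ) ≤ N := by exact_mod_cast hN
  exact Real.rpow_pos_of_pos (mul_pos (by linarith) (by linarith)) _

theorem bubbleConst_rpow (hN : 3 ≤ N) : bubbleConst N ^ (critExp N - 2) = N * ((N : ℝ) - 2) := by
  have h3 : (3 : ℝ) ≤ N := by exact_mod_cast hN
  have hpos : 0 < (N : ℝ) * ((N : ℝ) - 2) := mul_pos (by linarith) (by linarith)
  have h2 : (N : ℝ) - 2 ≠ 0 := by linarith
  rw [bubbleConst, ← Real.rpow_mul hpos.le]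
  have : ((N : ℝ) - 2) / 4 * (critExp N - 2) = 1 := by
    rw [critExp]; field_simp; ring
  rw [this, Real.rpow_one]

theorem bubbleEnergy_pos (hN : 3 ≤ N) : 0 < bubbleEnergy N :=
  mul_pos (Real.rpow_pos_of_pos (bubbleConst_pos hN) _) (bubbleMass_pos hN)

theorem sobolevConst_eq (hN : 3 ≤ N) :
    sobolevConst N = bubbleEnergy N ^ (1 - 2 / critExp N) := by
  have h3 : (3 : ℝ) ≤ N := by exact_mod_cast hN
  have h2 : (0 : ℝ) < N - 2 := by linarith
  have hp := critExp_pos hN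
  have hI := bubbleMass_pos hN
  have ha := bubbleConst_pos hN
  rw [bubbleEnergy, Real.mul_rpow (Real.rpow_nonneg ha.le _) hI.le, ← Real.rpow_mul ha.le]
  have e1 : critExp N * (1 - 2 / critExp N) = critExp N - 2 := by field_simp
  rw [e1, bubbleConst_rpow hN, Real.rpow_sub hI, Real.rpow_one, sobolevConst, one_div,
    Real.inv_rpow hI.le]
  have := bubbleMass_eq hN
  have h5 := (Real.rpow_pos_of_pos hI (2 / critExp N)).ne'
  field_simp
  linear_combination -this

theorem bubble_eq {ε : ℝ} (hε : 0 < ε) (x : EuclideanSpace ℝ (Fin N)) :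
    bubble ε x = bubbleConst N * ε ^ (((N : ℝ) - 2) / 2) *
      (ε ^ 2 + ‖x‖ ^ 2) ^ (-((N : ℝ) - 2) / 2) := by
  have hb : 0 < ε ^ 2 + ‖x‖ ^ 2 := by positivity
  rw [bubble, Real.div_rpow hε.le hb.le, bubbleConst, neg_div, Real.rpow_neg hb.le, mul_assoc,
    ← div_eq_mul_inv (ε ^ _)]

theorem bubble_pos (hN : 3 ≤ N) {ε : ℝ} (hε : 0 < ε) (x : EuclideanSpace ℝ (Fin N)) :
    0 < bubble ε x := by
  have := bubbleConst_pos hN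
  rw [bubble_eq hε]
  positivity

theorem hasFDerivAt_bubble {ε : ℝ} (hε : 0 < ε) (x : EuclideanSpace ℝ (Fin N)) :
    HasFDerivAt (bubble ε) (bubbleSlope N ε ‖x‖ • innerSL ℝ x) x := by
  have hb : ε ^ 2 + ‖x‖ ^ 2 ≠ 0 := by positivity
  have h1 : HasDerivAt (fun s : ℝ => bubbleConst N * ε ^ (((N : ℝ) - 2) / 2) *
      (ε ^ 2 + s) ^ (-((N : ℝ) - 2) / 2))
      (bubbleConst N * ε ^ (((N : ℝ) - 2) / 2) *
        (1 * (-((N : ℝ) - 2) / 2) * (ε ^ 2 + ‖x‖ ^ 2) ^ (-((N : ℝ) - 2) / 2 - 1))) (‖x‖ ^ 2) :=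
    (((hasDerivAt_id (‖x‖ ^ 2)).const_add (ε ^ 2)).rpow_const (Or.inl hb)).const_mul _
  have h2 := hasFDerivAt_comp_norm_sq h1
  rw [show (bubble ε : EuclideanSpace ℝ (Fin N) → ℝ) = _ from funext fun x => bubble_eq hε x]
  refine h2.congr_fderiv ?_
  congr 1
  have : -((N : ℝ) - 2) / 2 - 1 = -(N : ℝ) / 2 := by ring
  rw [this, bubbleSlope]
  ring

theorem contDiff_bubble {ε : ℝ} (hε : 0 < ε) :
    ContDiff ℝ 1 (bubble ε : EuclideanSpace ℝ (Fin N) → ℝ) := by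
  rw [show (bubble ε : EuclideanSpace ℝ (Fin N) → ℝ) = _ from funext fun x => bubble_eq hε x]
  refine contDiff_const.mul (ContDiff.rpow_const_of_ne (contDiff_const.add (contDiff_norm_sq ℝ))
    fun x => ?_)
  positivity

theorem gradient_bubble {ε : ℝ} (hε : 0 < ε) (x : EuclideanSpace ℝ (Fin N)) :
    gradient (bubble ε) x = bubbleSlope N ε ‖x‖ • x := by
  refine ext_inner_right ℝ fun v => ?_
  rw [inner_gradient, (hasFDerivAt_bubble hε x).fderiv]
  simp [inner_smul_left]

/-- Comparison of `ε² + s` with `1 + s`. -/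
theorem min_mul_le {ε s : ℝ} (hs : 0 ≤ s) : min 1 (ε ^ 2) * (1 + s) ≤ ε ^ 2 + s := by
  have h1 := min_le_left 1 (ε ^ 2)
  have h2 := min_le_right 1 (ε ^ 2)
  nlinarith

theorem rpow_neg_le {ε s t : ℝ} (hε : 0 < ε) (hs : 0 ≤ s) (ht : t ≤ 0) :
    (ε ^ 2 + s) ^ t ≤ min 1 (ε ^ 2) ^ t * (1 + s) ^ t := by
  have h0 : 0 < min 1 (ε ^ 2) := lt_min one_pos (by positivity)
  rw [← Real.mul_rpow h0.le (by positivity)]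
  exact Real.rpow_le_rpow_of_nonpos (by positivity) (min_mul_le hs) ht

theorem contDiff_bubbleSlope {ε : ℝ} (hε : 0 < ε) :
    ContDiff ℝ ((⊤ : ℕ∞) : WithTop ℕ∞) (bubbleSlope N ε) := by
  refine contDiff_const.mul (ContDiff.rpow_const_of_ne (contDiff_const.add (contDiff_id.pow 2))
    fun x => ?_)
  positivity

theorem deriv_bubbleSlope {ε : ℝ} (hε : 0 < ε) (r : ℝ) :
    deriv (bubbleSlope N ε) r = ((N : ℝ) - 2) * bubbleConst N * ε ^ (((N : ℝ) - 2) / 2) *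
      (N * r * (ε ^ 2 + r ^ 2) ^ (-(N : ℝ) / 2 - 1)) := by
  have hb : ε ^ 2 + r ^ 2 ≠ 0 := by positivity
  have h1 := ((((hasDerivAt_pow 2 r).const_add (ε ^ 2)).rpow_const
    (p := -(N : ℝ) / 2) (Or.inl hb)).const_mul
    (-(((N : ℝ) - 2) * bubbleConst N * ε ^ (((N : ℝ) - 2) / 2))))
  have h2 : deriv (bubbleSlope N ε) r = _ := h1.deriv
  rw [h2]
  push_cast
  ring

/-- The equation `-ΔU = U^{2*-1}`, written for the radial field `∇U`. -/
theorem bubbleSlope_equation (hN : 3 ≤ N) {ε : ℝ} (hε : 0 < ε) (x : EuclideanSpace ℝ (Fin N)) :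
    N * bubbleSlope N ε ‖x‖ + ‖x‖ * deriv (bubbleSlope N ε) ‖x‖ =
      -(bubble ε x ^ (critExp N - 1)) := by
  have h3 : (3 : ℝ) ≤ N := by exact_mod_cast hN
  have h2 : (N : ℝ) - 2 ≠ 0 := by linarith
  have ha := bubbleConst_pos hN
  set b := ε ^ 2 + ‖x‖ ^ 2 with hb
  have hb0 : 0 < b := by positivity
  have hE : 0 < ε ^ (((N : ℝ) - 2) / 2) := by positivity
  have e1 : critExp N - 1 = (critExp N - 2) + 1 := by ring
  have e2 : ((N : ℝ) - 2) / 2 * (critExp N - 2) = 2 := by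
    rw [critExp]; field_simp; ring
  have e3 : -((N : ℝ) - 2) / 2 * (critExp N - 1) = -(N : ℝ) / 2 - 1 := by
    rw [critExp]; field_simp; ring
  have e4 : ε ^ (((N : ℝ) - 2) / 2 * (critExp N - 1)) = ε ^ 2 * ε ^ (((N : ℝ) - 2) / 2) := by
    rw [e1, mul_add, mul_one, e2, Real.rpow_add hε]
    norm_num
  rw [deriv_bubbleSlope hε, bubbleSlope, bubble_eq hε, ← hb,
    Real.mul_rpow (by positivity) (by positivity), Real.mul_rpow ha.le hE.le,
    ← Real.rpow_mul hb0.le, e3, ← Real.rpow_mul hε.le, e4]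
  have e5 : bubbleConst N ^ (critExp N - 1) = N * ((N : ℝ) - 2) * bubbleConst N := by
    rw [e1, Real.rpow_add ha, bubbleConst_rpow hN, Real.rpow_one]
  have e6 : b ^ (-(N : ℝ) / 2) = b * b ^ (-(N : ℝ) / 2 - 1) := by
    nth_rw 2 [← Real.rpow_one b]
    rw [← Real.rpow_add hb0]
    congr 1; ring
  rw [e5, e6]
  have e7 : ‖x‖ ^ 2 = b - ε ^ 2 := by rw [hb]; ring
  linear_combination (((N : ℝ) - 2) * bubbleConst N * ε ^ (((N : ℝ) - 2) / 2) * N *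
    b ^ (-(N : ℝ) / 2 - 1)) * e7

theorem exists_bubbleSlope_bound (hN : 3 ≤ N) {ε : ℝ} (hε : 0 < ε) : ∃ C : ℝ,
    (∀ r, |bubbleSlope N ε r| ≤ C * (1 + r ^ 2) ^ (-(N : ℝ) / 2)) ∧
    (∀ r, |r * deriv (bubbleSlope N ε) r| ≤ C * (1 + r ^ 2) ^ (-(N : ℝ) / 2)) := by
  have h3 : (3 : ℝ) ≤ N := by exact_mod_cast hN
  have h2 : (0 : ℝ) < N - 2 := by linarith
  have ha := bubbleConst_pos hN
  have hm0 : 0 < min 1 (ε ^ 2) := lt_min one_pos (by positivity)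
  set A := ((N : ℝ) - 2) * bubbleConst N * ε ^ (((N : ℝ) - 2) / 2) with hA
  have hA0 : 0 < A := by positivity
  set m := min 1 (ε ^ 2) ^ (-(N : ℝ) / 2) with hm
  have hmp : 0 < m := by positivity
  have hkey : ∀ r : ℝ, (ε ^ 2 + r ^ 2) ^ (-(N : ℝ) / 2) ≤ m * (1 + r ^ 2) ^ (-(N : ℝ) / 2) :=
    fun r => rpow_neg_le hε (sq_nonneg r) (by linarith)
  refine ⟨N * A * m, fun r => ?_, fun r => ?_⟩
  · have hb : 0 < ε ^ 2 + r ^ 2 := by positivity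
    rw [bubbleSlope, ← hA, abs_mul, abs_neg, abs_of_pos hA0, abs_of_pos (by positivity)]
    calc A * (ε ^ 2 + r ^ 2) ^ (-(N : ℝ) / 2) ≤ A * (m * (1 + r ^ 2) ^ (-(N : ℝ) / 2)) :=
          mul_le_mul_of_nonneg_left (hkey r) hA0.le
      _ = 1 * (A * m * (1 + r ^ 2) ^ (-(N : ℝ) / 2)) := by ring
      _ ≤ N * (A * m * (1 + r ^ 2) ^ (-(N : ℝ) / 2)) :=
          mul_le_mul_of_nonneg_right (by linarith) (by positivity)
      _ = _ := by ring
  · have hb : 0 < ε ^ 2 + r ^ 2 := by positivity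
    have e1 : r * deriv (bubbleSlope N ε) r =
        N * A * (r ^ 2 * (ε ^ 2 + r ^ 2) ^ (-(N : ℝ) / 2 - 1)) := by
      rw [deriv_bubbleSlope hε, ← hA]; ring
    have e2 : r ^ 2 * (ε ^ 2 + r ^ 2) ^ (-(N : ℝ) / 2 - 1) ≤ (ε ^ 2 + r ^ 2) ^ (-(N : ℝ) / 2) := by
      rw [Real.rpow_sub_one hb.ne', mul_div_assoc', div_le_iff₀ hb, mul_comm]
      refine mul_le_mul_of_nonneg_left ?_ (by positivity)
      nlinarith [sq_nonneg ε]
    rw [e1, abs_of_nonneg (by positivity), mul_assoc (N * A)]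
    exact mul_le_mul_of_nonneg_left (e2.trans (hkey r)) (by positivity)

theorem memLp_bubble (hN : 3 ≤ N) {ε : ℝ} (hε : 0 < ε) :
    MemLp (bubble ε : EuclideanSpace ℝ (Fin N) → ℝ) (ENNReal.ofReal (critExp N)) := by
  have h3 : (3 : ℝ) ≤ N := by exact_mod_cast hN
  have hp := critExp_pos hN
  have ha := bubbleConst_pos hN
  have hm0 : 0 < min 1 (ε ^ 2) := lt_min one_pos (by positivity)
  have hc := (contDiff_bubble (N := N) hε).continuous
  rw [← integrable_norm_rpow_iff hc.aestronglyMeasurable (by simpa using hp) ENNReal.ofReal_ne_top,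
    ENNReal.toReal_ofReal hp.le]
  set A := bubbleConst N * ε ^ (((N : ℝ) - 2) / 2) * min 1 (ε ^ 2) ^ (-((N : ℝ) - 2) / 2) with hA
  have hA0 : 0 < A := by positivity
  refine Integrable.mono' ((integrable_bubbleMass hN).const_mul (A ^ critExp N))
    (hc.norm.rpow_const fun x => Or.inr hp.le).aestronglyMeasurable (ae_of_all _ fun x => ?_)
  have hb : 0 < 1 + ‖x‖ ^ 2 := by positivity
  rw [Real.norm_of_nonneg (by positivity), Real.norm_of_nonneg (bubble_pos hN hε x).le]
  calc bubble ε x ^ critExp N ≤ (A * (1 + ‖x‖ ^ 2) ^ (-((N : ℝ) - 2) / 2)) ^ critExp N := by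
        refine Real.rpow_le_rpow (bubble_pos hN hε x).le ?_ hp.le
        rw [bubble_eq hε, hA, mul_assoc (bubbleConst N * _)]
        exact mul_le_mul_of_nonneg_left (rpow_neg_le hε (sq_nonneg _) (by linarith)) (by positivity)
    _ = A ^ critExp N * ((1 + ‖x‖ ^ 2) ^ N)⁻¹ := by
        rw [Real.mul_rpow hA0.le (Real.rpow_nonneg hb.le _), profile_rpow_critExp hN hb]

theorem memLp_gradient_bubble (hN : 3 ≤ N) {ε : ℝ} (hε : 0 < ε) :
    MemLp (gradient (bubble ε : EuclideanSpace ℝ (Fin N) → ℝ)) 2 := by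
  obtain ⟨C, hC, -⟩ := exists_bubbleSlope_bound hN hε
  refine MemLp.of_le_mul (c := C) (memLp_two_decay hN)
    (continuous_gradient (contDiff_bubble hε)).aestronglyMeasurable (ae_of_all _ fun x => ?_)
  have hb : 0 < 1 + ‖x‖ ^ 2 := by positivity
  rw [gradient_bubble hε, norm_smul, norm_smul, ← mul_assoc, Real.norm_eq_abs,
    Real.norm_of_nonneg (Real.rpow_nonneg hb.le _)]
  exact mul_le_mul_of_nonneg_right (hC _) (norm_nonneg _)

end

/-! ### The bubbles on cones -/

section

variable {N : ℕ} {ω : Set (EuclideanSpace ℝ (Fin N))}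

theorem IsSphereDomain.isOpenInSphere (h : IsSphereDomain ω) : IsOpenInSphere ω :=
  ⟨h.isOpen_in_sphere⟩

theorem one_half_sub_one_div_critExp (hN : 3 ≤ N) : 1 / 2 - 1 / critExp N = 1 / (N : ℝ) := by
  have h3 : (3 : ℝ) ≤ N := by exact_mod_cast hN
  have h2 : (N : ℝ) - 2 ≠ 0 := by linarith
  rw [critExp]
  field_simp
  ring

theorem energy_eq_of_mem_nehari (hN : 3 ≤ N) {Ω : Set (EuclideanSpace ℝ (Fin N))}
    {u : EuclideanSpace ℝ (Fin N) → ℝ} (hu : u ∈ nehari Ω) :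
    energy Ω u = 1 / N * ∫ x in Ω, |u x| ^ critExp N := by
  rw [energy, hu.2.2, ← one_half_sub_one_div_critExp hN]
  ring

theorem abs_rpow_mul_self (hN : 3 ≤ N) (t : ℝ) : |t| ^ (critExp N - 2) * t * t = |t| ^ critExp N := by
  have h := two_lt_critExp hN
  rcases eq_or_ne t 0 with rfl | ht
  · rw [mul_zero, abs_zero, Real.zero_rpow (by linarith)]
  · have h0 : 0 < |t| := abs_pos.2 ht
    rw [mul_assoc, ← abs_mul_abs_self t, ← sq, ← Real.rpow_natCast, ← Real.rpow_add h0]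
    norm_num

/-- Nontrivial solutions of the Neumann problem lie on the Nehari manifold. -/
theorem IsNeumannSolution.mem_nehari (hN : 3 ≤ N) {Ω : Set (EuclideanSpace ℝ (Fin N))}
    {u : EuclideanSpace ℝ (Fin N) → ℝ} (hu : IsNeumannSolution Ω u) (h0 : Nontrivial Ω u) :
    u ∈ nehari Ω := by
  refine ⟨hu.1, h0, ?_⟩
  have h := hu.2 u hu.1
  simpa only [abs_rpow_mul_self hN, real_inner_self_eq_norm_sq] using h

theorem isWeakGradient_bubble (Ω : Set (EuclideanSpace ℝ (Fin N))) {ε : ℝ} (hε : 0 < ε) :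
    IsWeakGradient Ω (bubble ε) (gradient (bubble ε)) :=
  isWeakGradient_of_contDiff (contDiff_bubble hε)

theorem bubble_mem_D12 (hN : 3 ≤ N) {Ω : Set (EuclideanSpace ℝ (Fin N))} (hΩ : IsOpen Ω) {ε : ℝ}
    (hε : 0 < ε) : bubble ε ∈ D12 Ω :=
  mem_D12_of_isWeakGradient hΩ ((memLp_bubble hN hε).restrict _) (isWeakGradient_bubble Ω hε)
    ((memLp_gradient_bubble hN hε).restrict _)

theorem isNeumannSolution_bubble (hN : 3 ≤ N) (hω : IsOpenInSphere ω) {ε : ℝ} (hε : 0 < ε) :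
    IsNeumannSolution (openCone ω) (bubble ε) := by
  refine ⟨bubble_mem_D12 hN hω.isOpen_openCone hε, fun φ hφ => ?_⟩
  obtain ⟨C, hC, hC'⟩ := exists_bubbleSlope_bound (N := N) hN hε
  have h := integral_div_radial_of_decay hN hω (IsWeakGradient.weakGrad hφ.2.1) hφ.1 hφ.2.2
    (contDiff_bubbleSlope hε) hC hC'
  have e1 : ∫ x in openCone ω, inner ℝ (weakGrad (openCone ω) (bubble ε) x)
      (weakGrad (openCone ω) φ x) =
      ∫ x in openCone ω, inner ℝ (weakGrad (openCone ω) φ x) x * bubbleSlope N ε ‖x‖ := by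
    refine integral_congr_ae ?_
    filter_upwards [(isWeakGradient_bubble _ hε).weakGrad_ae_eq hω.isOpen_openCone] with x hx
    rw [hx, gradient_bubble hε, inner_smul_left, real_inner_comm]
    simp only [RCLike.conj_to_real]
    ring
  have e2 : ∫ x in openCone ω, |bubble ε x| ^ (critExp N - 2) * bubble ε x * φ x =
      -∫ x in openCone ω, φ x * (N * bubbleSlope N ε ‖x‖ + ‖x‖ * deriv (bubbleSlope N ε) ‖x‖) := by
    rw [← integral_neg]
    refine integral_congr_ae (ae_of_all _ fun x => ?_)
    have hb := bubble_pos hN hε x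
    simp only
    rw [bubbleSlope_equation hN hε, abs_of_pos hb,
      show critExp N - 1 = (critExp N - 2) + 1 by ring, Real.rpow_add hb, Real.rpow_one]
    ring
  rw [e1, e2, h, neg_neg]

theorem volume_openCone_ne_zero (hω : IsOpenInSphere ω) (hne : ω.Nonempty) :
    volume (openCone ω) ≠ 0 := by
  obtain ⟨y, hy⟩ := hne
  exact (hω.isOpen_openCone.measure_pos _ ⟨(1 : ℝ) • y, y, hy, 1, one_pos, rfl⟩).ne'

theorem nontrivial_bubble (hN : 3 ≤ N) {Ω : Set (EuclideanSpace ℝ (Fin N))} (hΩ : volume Ω ≠ 0)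
    {ε : ℝ} (hε : 0 < ε) : Nontrivial Ω (bubble ε) := by
  intro h
  have : ∀ᵐ x ∂(volume.restrict Ω), False := by
    filter_upwards [h] with x hx using (bubble_pos hN hε x).ne' hx
  rw [eventually_false_iff_eq_bot, ae_eq_bot, Measure.restrict_eq_zero] at this
  exact hΩ this

theorem bubble_mem_nehari_openCone (hN : 3 ≤ N) (hω : IsOpenInSphere ω) (hne : ω.Nonempty) {ε : ℝ}
    (hε : 0 < ε) : bubble ε ∈ nehari (openCone ω) :=
  (isNeumannSolution_bubble hN hω hε).mem_nehari hN
    (nontrivial_bubble hN (volume_openCone_ne_zero hω hne) hε)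

/-- The profile of the bubble as a function of the radius. -/
def bubbleProfile (N : ℕ) (ε r : ℝ) : ℝ :=
  bubbleConst N * ε ^ (((N : ℝ) - 2) / 2) * (ε ^ 2 + r ^ 2) ^ (-((N : ℝ) - 2) / 2)

theorem bubble_eq_profile {ε : ℝ} (hε : 0 < ε) (x : EuclideanSpace ℝ (Fin N)) :
    bubble ε x = bubbleProfile N ε ‖x‖ := bubble_eq hε x

theorem bubble_mem_radialNehari (hN : 3 ≤ N) (hω : IsOpenInSphere ω) (hne : ω.Nonempty) {ε : ℝ}
    (hε : 0 < ε) : bubble ε ∈ radialNehari (openCone ω) :=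
  ⟨bubble_mem_nehari_openCone hN hω hne hε, bubbleProfile N ε, ae_of_all _ (bubble_eq_profile hε)⟩

theorem abs_bubble_rpow (hN : 3 ≤ N) {ε : ℝ} (hε : 0 < ε) (x : EuclideanSpace ℝ (Fin N)) :
    |bubble ε x| ^ critExp N =
      bubbleConst N ^ critExp N * ε ^ N * ((ε ^ 2 + ‖x‖ ^ 2) ^ N)⁻¹ := by
  have h3 : (3 : ℝ) ≤ N := by exact_mod_cast hN
  have h2 : (N : ℝ) - 2 ≠ 0 := by linarith
  have hb : 0 < ε ^ 2 + ‖x‖ ^ 2 := by positivity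
  have ha := bubbleConst_pos hN
  rw [abs_of_pos (bubble_pos hN hε x), bubble_eq hε, Real.mul_rpow (by positivity) (by positivity),
    Real.mul_rpow ha.le (by positivity), profile_rpow_critExp hN hb, ← Real.rpow_mul hε.le]
  have : ((N : ℝ) - 2) / 2 * critExp N = (N : ℕ) := by
    rw [critExp]; field_simp
  rw [this, Real.rpow_natCast]

theorem integral_abs_bubble_rpow (hN : 3 ≤ N) {ε : ℝ} (hε : 0 < ε) :
    ∫ x : EuclideanSpace ℝ (Fin N), |bubble ε x| ^ critExp N = bubbleEnergy N := by
  have h := Measure.integral_comp_smul (volume : Measure (EuclideanSpace ℝ (Fin N)))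
    (fun x => ((ε ^ 2 + ‖x‖ ^ 2) ^ N)⁻¹) ε
  have e : ∀ x : EuclideanSpace ℝ (Fin N), ((ε ^ 2 + ‖ε • x‖ ^ 2) ^ N)⁻¹ =
      (ε ^ (2 * N))⁻¹ * ((1 + ‖x‖ ^ 2) ^ N)⁻¹ := fun x => by
    rw [norm_smul, Real.norm_of_nonneg hε.le, ← mul_inv, pow_mul, ← mul_pow]
    congr 2; ring
  simp_rw [e] at h
  rw [integral_const_mul, finrank_euclideanSpace_fin, abs_of_pos (by positivity), smul_eq_mul,
    ← bubbleMass] at h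
  simp_rw [abs_bubble_rpow hN hε]
  rw [integral_const_mul, bubbleEnergy]
  have hε' := (pow_pos hε N).ne'
  rw [pow_mul', sq] at h
  field_simp at h
  rw [h]
  field_simp

theorem restrict_openCone_sphere (hN : 3 ≤ N) :
    (volume : Measure (EuclideanSpace ℝ (Fin N))).restrict (openCone (Metric.sphere 0 1)) =
      volume := by
  have : NeZero N := ⟨by omega⟩
  refine Measure.restrict_eq_self_of_ae_mem ?_
  have h0 : ∀ᵐ x : EuclideanSpace ℝ (Fin N), x ≠ 0 := by
    rw [ae_iff]
    simp
  filter_upwards [h0] with x hx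
  refine (mem_openCone_iff subset_rfl).2 ⟨hx, ?_⟩
  simp [norm_smul, norm_ne_zero_iff.2 hx]

theorem sphere_nonempty (hN : 3 ≤ N) :
    (Metric.sphere (0 : EuclideanSpace ℝ (Fin N)) 1).Nonempty :=
  ⟨EuclideanSpace.single (⟨0, by omega⟩ : Fin N) (1 : ℝ), by simp⟩

theorem angMass_sphere_pos (hN : 3 ≤ N) :
    0 < angMass (Metric.sphere (0 : EuclideanSpace ℝ (Fin N)) 1) :=
  angMass_pos (by omega) isOpenInSphere_sphere (sphere_nonempty hN)

/-- The integral of `U_ε^{2*}` in the radial variable with weight `r^{N-1}`. -/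
def radialBubbleMass (N : ℕ) : ℝ :=
  bubbleEnergy N / angMass (Metric.sphere (0 : EuclideanSpace ℝ (Fin N)) 1)

theorem integral_openCone_abs_bubble_rpow (hN : 3 ≤ N) (hω : IsOpenInSphere ω) {ε : ℝ}
    (hε : 0 < ε) :
    ∫ x in openCone ω, |bubble ε x| ^ critExp N = angMass ω * radialBubbleMass N := by
  have hp := critExp_pos hN
  have hm : AEStronglyMeasurable (fun r => |bubbleProfile N ε r| ^ critExp N) (radMeas N) := by
    refine Measurable.aestronglyMeasurable ?_
    unfold bubbleProfile
    fun_prop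
  have h1 := integral_openCone_norm hω hm
  have h2 := integral_openCone_norm isOpenInSphere_sphere hm
  simp_rw [← bubble_eq_profile hε] at h1 h2
  rw [restrict_openCone_sphere hN, integral_abs_bubble_rpow hN hε] at h2
  rw [h1, radialBubbleMass, h2, mul_div_cancel_left₀ _ (angMass_sphere_pos hN).ne']

theorem energy_bubble_openCone (hN : 3 ≤ N) (hω : IsOpenInSphere ω) (hne : ω.Nonempty) {ε : ℝ}
    (hε : 0 < ε) :
    energy (openCone ω) (bubble ε) = 1 / N * (angMass ω * radialBubbleMass N) := by
  rw [energy_eq_of_mem_nehari hN (bubble_mem_nehari_openCone hN hω hne hε),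
    integral_openCone_abs_bubble_rpow hN hω hε]

theorem bubble_mem_nehari_univ (hN : 3 ≤ N) {ε : ℝ} (hε : 0 < ε) :
    bubble ε ∈ nehari (univ : Set (EuclideanSpace ℝ (Fin N))) := by
  refine ⟨bubble_mem_D12 hN isOpen_univ hε, nontrivial_bubble hN ?_ hε, ?_⟩
  · exact (isOpen_univ.measure_pos _ ⟨0, trivial⟩).ne'
  · have h := (bubble_mem_nehari_openCone (N := N) hN isOpenInSphere_sphere (sphere_nonempty hN)
      hε).2.2
    have e1 := (isWeakGradient_bubble (openCone (Metric.sphere 0 1)) hε).weakGrad_ae_eq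
      (N := N) isOpenInSphere_sphere.isOpen_openCone
    have e2 := (isWeakGradient_bubble univ hε).weakGrad_ae_eq (N := N) isOpen_univ
    rw [restrict_openCone_sphere hN] at h e1
    rw [Measure.restrict_univ] at e2 ⊢
    rw [← h]
    refine integral_congr_ae ?_
    filter_upwards [e1, e2] with x h1 h2
    rw [h1, h2]

end

/-! ### Weakly differentiable functions on the half-line -/

section

theorem exists_Ioo_of_tsupport {ψ : ℝ → ℝ} (hc : HasCompactSupport ψ) (hs : tsupport ψ ⊆ Ioi 0) :
    ∃ a b : ℝ, 0 < a ∧ a < 1 ∧ 1 < b ∧ tsupport ψ ⊆ Ioo a b := by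
  have hK : IsCompact (tsupport ψ ∪ {1}) := hc.isCompact.union isCompact_singleton
  have hne : (tsupport ψ ∪ {1}).Nonempty := ⟨1, Or.inr rfl⟩
  obtain ⟨m, hm, hm'⟩ := hK.exists_isLeast hne
  obtain ⟨M, -, hM'⟩ := hK.exists_isGreatest hne
  have hm0 : 0 < m := by
    rcases hm with h | h
    · exact hs h
    · rw [mem_singleton_iff.1 h]; exact one_pos
  have h1 : m ≤ 1 := hm' (Or.inr rfl)
  have h2 : 1 ≤ M := hM' (Or.inr rfl)
  refine ⟨m / 2, M + 1, by linarith, by linarith, by linarith, fun r hr => ?_⟩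
  have h3 : m ≤ r := hm' (Or.inl hr)
  have h4 : r ≤ M := hM' (Or.inl hr)
  exact ⟨by linarith, by linarith⟩

theorem setIntegral_Ioi_eq_intervalIntegral {F : ℝ → ℝ} {a b : ℝ} (ha : 0 < a) (hab : a ≤ b)
    (h0 : ∀ r, r ∉ Ioo a b → F r = 0) : ∫ r in Ioi 0, F r = ∫ r in a..b, F r := by
  rw [intervalIntegral.integral_of_le hab]
  refine setIntegral_eq_of_subset_of_forall_sdiff_eq_zero measurableSet_Ioi
    (fun r hr => ha.trans hr.1) fun r hr => h0 r fun h => hr.2 ⟨h.1, h.2.le⟩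

theorem intervalIntegrable_of_locallyIntegrableOn_Ioi {f : ℝ → ℝ}
    (hf : LocallyIntegrableOn f (Ioi 0)) {a b : ℝ} (ha : 0 < a) (hb : 0 < b) :
    IntervalIntegrable f volume a b := by
  rw [intervalIntegrable_iff']
  refine hf.integrableOn_compact_subset (fun r hr => ?_) isCompact_uIcc
  exact (lt_min ha hb).trans_le hr.1

/-- A primitive of a locally integrable function is a weak primitive. -/
theorem integral_primitive_mul_deriv {h : ℝ → ℝ} (hh : LocallyIntegrableOn h (Ioi 0)) {ψ : ℝ → ℝ}
    (hψ : ContDiff ℝ 1 ψ) (hc : HasCompactSupport ψ) (hs : tsupport ψ ⊆ Ioi 0) :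
    ∫ r in Ioi 0, (∫ t in (1 : ℝ)..r, h t) * deriv ψ r = -∫ r in Ioi 0, h r * ψ r := by
  obtain ⟨a, b, ha, ha1, hb1, hab⟩ := exists_Ioo_of_tsupport hc hs
  have hle : a ≤ b := (ha1.trans hb1).le
  have h1 : (1 : ℝ) ∈ uIcc a b := by rw [uIcc_of_le hle]; exact ⟨ha1.le, hb1.le⟩
  have hi := intervalIntegrable_of_locallyIntegrableOn_Ioi hh ha (ha.trans (ha1.trans hb1))
  have hz : ∀ r, r ∉ Ioo a b → ψ r = 0 := fun r hr =>
    image_eq_zero_of_notMem_tsupport fun h => hr (hab h)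
  have hz' : ∀ r, r ∉ Ioo a b → deriv ψ r = 0 := fun r hr =>
    image_eq_zero_of_notMem_tsupport fun h => hr (hab (tsupport_deriv_subset h))
  rw [setIntegral_Ioi_eq_intervalIntegral ha hle fun r hr => by rw [hz' r hr, mul_zero],
    setIntegral_Ioi_eq_intervalIntegral ha hle fun r hr => by rw [hz r hr, mul_zero]]
  obtain ⟨C, hC⟩ := hψ.lipschitzWith_of_hasCompactSupport hc one_ne_zero
  have hψac : AbsolutelyContinuousOnInterval ψ a b :=
    (hC.lipschitzOnWith (s := uIcc a b)).absolutelyContinuousOnInterval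
  have hPac := hi.absolutelyContinuousOnInterval_intervalIntegral h1
  rw [hPac.integral_mul_deriv_eq_deriv_mul hψac, hz a (by simp), hz b (by simp)]
  simp only [mul_zero, sub_self, zero_sub, neg_inj]
  refine intervalIntegral.integral_congr_ae ?_
  filter_upwards [hi.ae_hasDerivAt_integral] with r hr hr'
  rw [(hr (uIoc_subset_uIcc hr') 1 h1).deriv]

theorem exists_bump_integral_eq_one : ∃ ψ : ℝ → ℝ, ContDiff ℝ ((⊤ : ℕ∞) : WithTop ℕ∞) ψ ∧
    HasCompactSupport ψ ∧ tsupport ψ ⊆ Ioi 0 ∧ ∫ r in Ioi 0, ψ r = 1 := by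
  let φ : ContDiffBump (1 : ℝ) := ⟨1 / 4, 1 / 2, by norm_num, by norm_num⟩
  have hs : tsupport (φ.normed volume) ⊆ Ioi 0 := by
    rw [φ.tsupport_normed_eq]
    intro r hr
    have h1 : dist r 1 ≤ 1 / 2 := hr
    rw [Real.dist_eq, abs_le] at h1
    have : 0 < r := by linarith [h1.1]
    exact this
  refine ⟨φ.normed volume, φ.contDiff_normed, φ.hasCompactSupport_normed, hs, ?_⟩
  rw [setIntegral_eq_integral_of_forall_compl_eq_zero, φ.integral_normed]
  exact fun r hr => image_eq_zero_of_notMem_tsupport fun h => hr (hs h)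

/-- A smooth function with compact support in the half-line and vanishing integral is the
derivative of such a function. -/
theorem exists_test_primitive {g : ℝ → ℝ} (hg : ContDiff ℝ ((⊤ : ℕ∞) : WithTop ℕ∞) g)
    (hc : HasCompactSupport g) (hs : tsupport g ⊆ Ioi 0) (h0 : ∫ r in Ioi 0, g r = 0) :
    ∃ χ : ℝ → ℝ, ContDiff ℝ ((⊤ : ℕ∞) : WithTop ℕ∞) χ ∧ HasCompactSupport χ ∧
      tsupport χ ⊆ Ioi 0 ∧ deriv χ = g := by
  obtain ⟨a, b, ha, ha1, hb1, hab⟩ := exists_Ioo_of_tsupport hc hs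
  have hle : a ≤ b := (ha1.trans hb1).le
  have hz : ∀ r, r ∉ Ioo a b → g r = 0 := fun r hr =>
    image_eq_zero_of_notMem_tsupport fun h => hr (hab h)
  rw [setIntegral_Ioi_eq_intervalIntegral ha hle hz] at h0
  have hd : ∀ r, HasDerivAt (fun r => ∫ t in a..r, g t) (g r) r := fun r =>
    intervalIntegral.integral_hasDerivAt_right (hg.continuous.intervalIntegrable _ _)
      (hg.continuous.stronglyMeasurableAtFilter _ _) hg.continuous.continuousAt
  have hde : deriv (fun r => ∫ t in a..r, g t) = g := funext fun r => (hd r).deriv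
  have hsub : Function.support (fun r => ∫ t in a..r, g t) ⊆ Icc a b := by
    intro r hr
    by_contra h
    rw [mem_Icc, not_and_or, not_le, not_le] at h
    refine hr ?_
    rcases h with h | h
    · refine intervalIntegral.integral_zero_ae (ae_of_all _ fun t ht => hz t fun h' => ?_)
      rw [uIoc_of_ge h.le] at ht
      exact absurd h'.1 (not_lt.2 ht.2)
    · have h2 : ∫ t in b..r, g t = 0 := by
        refine intervalIntegral.integral_zero_ae (ae_of_all _ fun t ht => hz t fun h' => ?_)
        rw [uIoc_of_le h.le] at ht
        exact absurd h'.2 (not_lt.2 ht.1.le)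
      have h3 := intervalIntegral.integral_add_adjacent_intervals (μ := volume)
        (hg.continuous.intervalIntegrable a b) (hg.continuous.intervalIntegrable b r)
      simp only
      rw [← h3, h0, h2, add_zero]
  refine ⟨fun r => ∫ t in a..r, g t, contDiff_infty_iff_deriv.2 ⟨fun r => (hd r).differentiableAt,
    by rw [hde]; exact hg⟩, HasCompactSupport.of_support_subset_isCompact isCompact_Icc hsub,
    (closure_minimal hsub isClosed_Icc).trans fun r hr => ha.trans_le hr.1, hde⟩

theorem integrableOn_mul_test {f g : ℝ → ℝ} (hf : LocallyIntegrableOn f (Ioi 0)) (hg : Continuous g)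
    (hc : HasCompactSupport g) (hs : tsupport g ⊆ Ioi 0) :
    IntegrableOn (fun r => f r * g r) (Ioi 0) := by
  have h1 : IntegrableOn (fun r => f r * g r) (tsupport g) :=
    (hf.integrableOn_compact_subset hs hc).mul_continuousOn hg.continuousOn hc
  refine h1.of_forall_sdiff_eq_zero measurableSet_Ioi fun r hr => ?_
  rw [image_eq_zero_of_notMem_tsupport hr.2, mul_zero]

theorem continuousOn_primitive_Ioi {h : ℝ → ℝ} (hh : LocallyIntegrableOn h (Ioi 0)) :
    ContinuousOn (fun r => ∫ t in (1 : ℝ)..r, h t) (Ioi 0) := by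
  intro r hr
  have hr' : (0 : ℝ) < r := hr
  have h1 := intervalIntegral.continuousOn_primitive_interval'
    (intervalIntegrable_of_locallyIntegrableOn_Ioi hh (a := min 1 (r / 2)) (b := max 1 (r + 1))
      (by positivity) (by positivity)) (a := 1)
      (by rw [uIcc_of_le (by simp)]; simp)
  refine (h1.continuousAt ?_).continuousWithinAt
  rw [uIcc_of_le (by simp)]
  exact Icc_mem_nhds (by simp [hr']) (by simp)

theorem hasDerivAt_primitive_Ioi {h : ℝ → ℝ} (hh : ContinuousOn h (Ioi 0)) {r : ℝ} (hr : 0 < r) :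
    HasDerivAt (fun r => ∫ t in (1 : ℝ)..r, h t) (h r) r :=
  intervalIntegral.integral_hasDerivAt_right
    (intervalIntegrable_of_locallyIntegrableOn_Ioi (hh.locallyIntegrableOn measurableSet_Ioi)
      one_pos hr)
    (hh.stronglyMeasurableAtFilter isOpen_Ioi r hr) (hh.continuousAt (Ioi_mem_nhds hr))

/-- The lemma of du Bois-Reymond on the half-line: a function with locally integrable weak
derivative agrees almost everywhere with a primitive of it. -/
theorem exists_ae_eq_primitive {f h : ℝ → ℝ} (hf : LocallyIntegrableOn f (Ioi 0))
    (hh : LocallyIntegrableOn h (Ioi 0))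
    (hw : ∀ ψ : ℝ → ℝ, ContDiff ℝ ((⊤ : ℕ∞) : WithTop ℕ∞) ψ → HasCompactSupport ψ →
      tsupport ψ ⊆ Ioi 0 → ∫ r in Ioi 0, f r * deriv ψ r = -∫ r in Ioi 0, h r * ψ r) :
    ∃ c, ∀ᵐ r, r ∈ Ioi (0 : ℝ) → f r = c + ∫ t in (1 : ℝ)..r, h t := by
  obtain ⟨ψ₀, hψ₀, hψ₀c, hψ₀s, hψ₀i⟩ := exists_bump_integral_eq_one
  set P : ℝ → ℝ := fun r => ∫ t in (1 : ℝ)..r, h t with hP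
  have hPc : ContinuousOn P (Ioi 0) := continuousOn_primitive_Ioi hh
  have hPl : LocallyIntegrableOn P (Ioi 0) := hPc.locallyIntegrableOn measurableSet_Ioi
  have hD : LocallyIntegrableOn (fun r => f r - P r) (Ioi 0) := hf.sub hPl
  set c := ∫ r in Ioi 0, (f r - P r) * ψ₀ r with hc
  refine ⟨c, ?_⟩
  have hDc : LocallyIntegrableOn (fun r => f r - P r - c) (Ioi 0) :=
    hD.sub (continuousOn_const.locallyIntegrableOn measurableSet_Ioi)
  have key := isOpen_Ioi.ae_eq_zero_of_integral_contDiff_smul_eq_zero hDc ?_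
  · filter_upwards [key] with r hr hr'
    have := hr hr'
    linarith
  intro φ hφ hφc hφs
  set m := ∫ r in Ioi 0, φ r with hm
  have hli1 : LocallyIntegrableOn (fun _ => (1 : ℝ)) (Ioi (0 : ℝ)) volume :=
    continuousOn_const.locallyIntegrableOn measurableSet_Ioi
  have hφi : IntegrableOn φ (Ioi 0) := by
    simpa using integrableOn_mul_test hli1 hφ.continuous hφc hφs
  have hψi : IntegrableOn ψ₀ (Ioi 0) := by
    simpa using integrableOn_mul_test hli1 hψ₀.continuous hψ₀c hψ₀s
  obtain ⟨χ, hχ, hχc, hχs, hχd⟩ := exists_test_primitive (g := fun r => φ r - m * ψ₀ r)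
    (hφ.sub (contDiff_const.mul hψ₀)) (hφc.sub hψ₀c.mul_left)
    ((tsupport_sub _ _).trans (union_subset hφs (tsupport_mul_subset_right.trans hψ₀s)))
    (by rw [integral_sub hφi (hψi.const_mul m), integral_const_mul, hψ₀i, hm]; ring)
  have h1 := hw χ hχ hχc hχs
  have h2 := integral_primitive_mul_deriv hh (hχ.of_le (by simp)) hχc hχs
  rw [← h2, hχd] at h1
  have i1 := integrableOn_mul_test hf hφ.continuous hφc hφs
  have i2 := integrableOn_mul_test hf hψ₀.continuous hψ₀c hψ₀s
  have i3 := integrableOn_mul_test hPl hφ.continuous hφc hφs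
  have i4 := integrableOn_mul_test hPl hψ₀.continuous hψ₀c hψ₀s
  have e1 : ∫ r in Ioi 0, f r * (φ r - m * ψ₀ r) =
      (∫ r in Ioi 0, f r * φ r) - m * ∫ r in Ioi 0, f r * ψ₀ r := by
    rw [← integral_const_mul, ← integral_sub i1 (i2.const_mul m)]
    exact integral_congr_ae (ae_of_all _ fun r => by ring)
  have e2 : ∫ r in Ioi 0, P r * (φ r - m * ψ₀ r) =
      (∫ r in Ioi 0, P r * φ r) - m * ∫ r in Ioi 0, P r * ψ₀ r := by
    rw [← integral_const_mul, ← integral_sub i3 (i4.const_mul m)]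
    exact integral_congr_ae (ae_of_all _ fun r => by ring)
  have e3 : c = (∫ r in Ioi 0, f r * ψ₀ r) - ∫ r in Ioi 0, P r * ψ₀ r := by
    rw [hc, ← integral_sub i2 i4]
    exact integral_congr_ae (ae_of_all _ fun r => by ring)
  have e4 : ∫ r, φ r • (f r - P r - c) = ∫ r in Ioi 0, φ r • (f r - P r - c) := by
    rw [setIntegral_eq_integral_of_forall_compl_eq_zero]
    intro r hr
    rw [image_eq_zero_of_notMem_tsupport fun h => hr (hφs h), zero_smul]
  have e5 : ∫ r in Ioi 0, φ r • (f r - P r - c) =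
      ((∫ r in Ioi 0, f r * φ r) - ∫ r in Ioi 0, P r * φ r) - c * m := by
    have i5 : IntegrableOn (fun r => f r * φ r - P r * φ r) (Ioi 0) := i1.sub i3
    rw [hm, ← integral_const_mul, ← integral_sub i1 i3, ← integral_sub i5 (hφi.const_mul c)]
    refine integral_congr_ae (ae_of_all _ fun r => ?_)
    simp only [smul_eq_mul]
    ring
  rw [e1, e2] at h1
  rw [e4, e5, e3]
  linear_combination h1

end

/-! ### Radial functions on cones -/

section

variable {N : ℕ} {ω : Set (EuclideanSpace ℝ (Fin N))}

/-- The mean of `F` over the part of the sphere of radius `r` lying in the cone over `ω`, with the junk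
value `0` where `F` is not integrable. -/
def angMean (ω : Set (EuclideanSpace ℝ (Fin N))) (F : EuclideanSpace ℝ (Fin N) → ℝ) (r : ℝ) : ℝ :=
  (angMass ω)⁻¹ * ∫ θ, F (r • θ) ∂(angMeas ω)

theorem measurable_angMean {F : EuclideanSpace ℝ (Fin N) → ℝ} (hF : Measurable F) :
    Measurable (angMean ω F) := by
  have h : StronglyMeasurable fun p : ℝ × EuclideanSpace ℝ (Fin N) => F (p.1 • p.2) :=
    (hF.comp (by fun_prop)).stronglyMeasurable
  exact (h.integral_prod_right (ν := angMeas ω)).measurable.const_mul _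

theorem ae_norm_polar (hω : IsOpenInSphere ω) :
    ∀ᵐ p ∂((radMeas N).prod (angMeas ω)), ‖p.1 • p.2‖ = p.1 := by
  filter_upwards [Measure.quasiMeasurePreserving_fst.ae (ae_radMeas N),
    Measure.quasiMeasurePreserving_snd.ae (ae_angMeas hω)] with p hp1 hp2
  have h1 : ‖p.2‖ = 1 := by simpa using hω.subset_sphere hp2
  rw [norm_smul, h1, mul_one, Real.norm_of_nonneg (le_of_lt hp1)]

theorem angMass_mul_angMean (hpos : 0 < angMass ω) (F : EuclideanSpace ℝ (Fin N) → ℝ) (r : ℝ) :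
    angMass ω * angMean ω F r = ∫ θ, F (r • θ) ∂(angMeas ω) := by
  rw [angMean, mul_inv_cancel_left₀ hpos.ne']

/-- Testing against a radial function only sees the angular mean. -/
theorem integral_mul_radial (hω : IsOpenInSphere ω) (hpos : 0 < angMass ω)
    {F : EuclideanSpace ℝ (Fin N) → ℝ} {k : ℝ → ℝ}
    (hi : IntegrableOn (fun x => F x * k ‖x‖) (openCone ω)) :
    ∫ x in openCone ω, F x * k ‖x‖ = angMass ω * ∫ r, angMean ω F r * k r ∂(radMeas N) := by
  have hp := measurePreserving_polar hω
  have hi' : Integrable (fun p : ℝ × EuclideanSpace ℝ (Fin N) =>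
      F (p.1 • p.2) * k ‖p.1 • p.2‖) ((radMeas N).prod (angMeas ω)) :=
    (hp.integrable_comp hi.1).2 hi
  have e : (fun p : ℝ × EuclideanSpace ℝ (Fin N) => F (p.1 • p.2) * k ‖p.1 • p.2‖)
      =ᵐ[(radMeas N).prod (angMeas ω)] fun p => F (p.1 • p.2) * k p.1 := by
    filter_upwards [ae_norm_polar hω] with p hp
    rw [hp]
  have h1 : ∫ x in openCone ω, F x * k ‖x‖ =
      ∫ p, F (p.1 • p.2) * k ‖p.1 • p.2‖ ∂((radMeas N).prod (angMeas ω)) := by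
    rw [← hp.map_eq, integral_map hp.aemeasurable (by rw [hp.map_eq]; exact hi.1)]
  rw [h1, integral_congr_ae e, integral_prod _ (hi'.congr e), ← integral_const_mul]
  refine integral_congr_ae (ae_of_all _ fun r => ?_)
  simp only
  rw [integral_mul_const, ← mul_assoc, angMass_mul_angMean hpos]

/-- Jensen's inequality for the angular mean. -/
theorem angMean_sq (hω : IsOpenInSphere ω) (hpos : 0 < angMass ω)
    {F : EuclideanSpace ℝ (Fin N) → ℝ} (hF : Measurable F)
    (hi : IntegrableOn (fun x => F x ^ 2) (openCone ω)) :
    Integrable (fun r => angMean ω F r ^ 2) (radMeas N) ∧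
      angMass ω * ∫ r, angMean ω F r ^ 2 ∂(radMeas N) ≤ ∫ x in openCone ω, F x ^ 2 := by
  have hp := measurePreserving_polar hω
  have hi' : Integrable (fun p : ℝ × EuclideanSpace ℝ (Fin N) => F (p.1 • p.2) ^ 2)
      ((radMeas N).prod (angMeas ω)) := (hp.integrable_comp hi.1).2 hi
  have h1 : ∫ x in openCone ω, F x ^ 2 =
      ∫ p, F (p.1 • p.2) ^ 2 ∂((radMeas N).prod (angMeas ω)) := by
    rw [← hp.map_eq, integral_map hp.aemeasurable (by rw [hp.map_eq]; exact hi.1)]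
  rw [integral_prod _ hi'] at h1
  have hle : ∀ᵐ r ∂(radMeas N), angMass ω * angMean ω F r ^ 2 ≤
      ∫ θ, F (r • θ) ^ 2 ∂(angMeas ω) := by
    filter_upwards [hi'.prod_right_ae] with r hr
    have hm : AEStronglyMeasurable (fun θ => F (r • θ)) (angMeas ω) :=
      (hF.comp (by fun_prop)).aestronglyMeasurable
    have hi1 : Integrable (fun θ => F (r • θ)) (angMeas ω) :=
      ((memLp_two_iff_integrable_sq hm).2 hr).integrable one_le_two
    set m := angMean ω F r with hmdef
    have h2 : 0 ≤ ∫ θ, (F (r • θ) - m) ^ 2 ∂(angMeas ω) := integral_nonneg fun θ => sq_nonneg _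
    have h3 : ∫ θ, (F (r • θ) - m) ^ 2 ∂(angMeas ω) =
        (∫ θ, F (r • θ) ^ 2 ∂(angMeas ω)) - 2 * m * (angMass ω * m) + angMass ω * m ^ 2 := by
      have e : ∀ θ, (F (r • θ) - m) ^ 2 = F (r • θ) ^ 2 - 2 * m * F (r • θ) + m ^ 2 :=
        fun θ => by ring
      simp_rw [e]
      have hi2 : Integrable (fun θ => F (r • θ) ^ 2 - 2 * m * F (r • θ)) (angMeas ω) :=
        hr.sub (hi1.const_mul _)
      rw [integral_add hi2 (integrable_const _), integral_sub hr (hi1.const_mul _),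
        integral_const_mul, hmdef, angMass_mul_angMean hpos]
      simp [angMass]
    rw [h3] at h2
    linarith
  have hint : Integrable (fun r => ∫ θ, F (r • θ) ^ 2 ∂(angMeas ω)) (radMeas N) :=
    hi'.integral_prod_left
  have hint2 : Integrable (fun r => angMass ω * angMean ω F r ^ 2) (radMeas N) := by
    refine hint.mono' ((measurable_angMean hF).pow_const 2 |>.const_mul _).aestronglyMeasurable ?_
    filter_upwards [hle] with r hr
    rwa [Real.norm_of_nonneg (by positivity)]
  refine ⟨?_, ?_⟩
  · refine (hint2.const_mul (angMass ω)⁻¹).congr (ae_of_all _ fun r => ?_)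
    simp only
    rw [inv_mul_cancel_left₀ hpos.ne']
  · rw [h1, ← integral_const_mul]
    exact integral_mono_ae hint2 hint hle

/-- The profile of a measurable radial function can be chosen measurable. -/
theorem exists_measurable_profile (hω : IsOpenInSphere ω) (hpos : 0 < angMass ω)
    {u : EuclideanSpace ℝ (Fin N) → ℝ}
    (hu : AEStronglyMeasurable u (volume.restrict (openCone ω)))
    (hr : IsRadialOn (openCone ω) u) :
    ∃ f : ℝ → ℝ, Measurable f ∧ ∀ᵐ x ∂(volume.restrict (openCone ω)), u x = f ‖x‖ := by
  obtain ⟨f, hf⟩ := hr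
  have hp := measurePreserving_polar hω
  have hm := hu.stronglyMeasurable_mk.measurable
  set v := hu.mk u with hv
  have h1 : ∀ᵐ p ∂((radMeas N).prod (angMeas ω)), v (p.1 • p.2) = f p.1 := by
    have h2 := hp.quasiMeasurePreserving.ae (hu.ae_eq_mk.symm.trans hf)
    filter_upwards [h2, ae_norm_polar hω] with p hp1 hp2
    exact hp1.trans (by rw [hp2])
  have h3 : ∀ᵐ q ∂((angMeas ω).prod (radMeas N)), v (q.2 • q.1) = f q.2 := by
    have := (Measure.measurePreserving_swap (μ := angMeas ω)
      (ν := radMeas N)).quasiMeasurePreserving.ae h1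
    exact this
  have h4 := Measure.ae_ae_of_ae_prod h3
  have hne : (ae (angMeas ω)).NeBot := by
    rw [ae_neBot]
    intro h0
    rw [angMass, h0] at hpos
    simp at hpos
  obtain ⟨θ, hθ⟩ := h4.exists
  refine ⟨fun r => v (r • θ), hm.comp (by fun_prop), ?_⟩
  have h5 : ∀ᵐ x ∂(volume.restrict (openCone ω)), v (‖x‖ • θ) = f ‖x‖ := by
    have h6 : ∀ᵐ r ∂(ENNReal.ofReal (angMass ω) • radMeas N), v (r • θ) = f r :=
      Measure.ae_smul_measure hθ _
    rw [← map_norm_openCone hω] at h6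
    exact ae_of_ae_map measurable_norm.aemeasurable h6
  filter_upwards [hf, h5] with x hx1 hx2
  rw [hx1, hx2]

theorem locallyIntegrableOn_of_integrable_rpow {f : ℝ → ℝ} (hf : Measurable f) {q : ℝ} (hq : 1 ≤ q)
    (hi : Integrable (fun r => |f r| ^ q) (radMeas N)) : LocallyIntegrableOn f (Ioi 0) := by
  rw [integrable_radMeas_iff] at hi
  refine (locallyIntegrableOn_iff isOpen_Ioi.isLocallyClosed).2 fun K hK hKc => ?_
  rcases K.eq_empty_or_nonempty with rfl | hne
  · simp
  obtain ⟨a, ha, ha'⟩ := hKc.exists_isLeast hne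
  have ha0 : 0 < a := hK ha
  have h1 : IntegrableOn (fun r => (a ^ (N - 1))⁻¹ * (r ^ (N - 1) * |f r| ^ q) + 1) K :=
    ((hi.mono_set hK).const_mul _).add (integrableOn_const hKc.measure_lt_top.ne)
  refine h1.mono' hf.aestronglyMeasurable ?_
  filter_upwards [ae_restrict_mem hKc.measurableSet] with r hr
  have h2 : a ^ (N - 1) ≤ r ^ (N - 1) := pow_le_pow_left₀ ha0.le (ha' hr) _
  have h3 : (0 : ℝ) ≤ |f r| ^ q := by positivity
  have h4 : |f r| ^ q ≤ (a ^ (N - 1))⁻¹ * (r ^ (N - 1) * |f r| ^ q) := by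
    rw [← mul_assoc]
    refine le_mul_of_one_le_left h3 ?_
    rw [inv_mul_eq_div, one_le_div (by positivity)]
    exact h2
  rw [Real.norm_eq_abs]
  rcases le_total |f r| 1 with h | h
  · linarith
  · have := Real.self_le_rpow_of_one_le h hq
    linarith

theorem hasCompactSupport_comp_norm {k : ℝ → ℝ} (hk : HasCompactSupport k) :
    HasCompactSupport fun x : EuclideanSpace ℝ (Fin N) => k ‖x‖ := by
  obtain ⟨R, hR⟩ := hk.isCompact.isBounded.subset_closedBall 0
  refine HasCompactSupport.of_support_subset_isCompact (isCompact_closedBall 0 R) fun x hx => ?_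
  have := hR (subset_closure (s := Function.support k) hx)
  simpa using this

theorem ae_openCone_ne_zero (hω : IsOpenInSphere ω) :
    ∀ᵐ x ∂(volume.restrict (openCone ω)), x ≠ 0 := by
  filter_upwards [ae_restrict_mem hω.isOpen_openCone.measurableSet] with x hx
  exact ((mem_openCone_iff hω.subset_sphere).1 hx).1

/-- The angular mean `H` of the radial component of the weak gradient. By Jensen's inequality its
Dirichlet integral does not exceed that of the function. -/
theorem exists_radial_component (hω : IsOpenInSphere ω) (hpos : 0 < angMass ω)
    {G : EuclideanSpace ℝ (Fin N) → EuclideanSpace ℝ (Fin N)}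
    (hG2 : MemLp G 2 (volume.restrict (openCone ω))) :
    ∃ H : ℝ → ℝ, Measurable H ∧ Integrable (fun r => H r ^ 2) (radMeas N) ∧
      angMass ω * ∫ r, H r ^ 2 ∂(radMeas N) ≤ ∫ x in openCone ω, ‖G x‖ ^ 2 ∧
      ∀ k : ℝ → ℝ, IntegrableOn (fun x => inner ℝ (G x) x * k ‖x‖) (openCone ω) →
        ∫ x in openCone ω, inner ℝ (G x) x * k ‖x‖ =
          angMass ω * ∫ r, r * H r * k r ∂(radMeas N) := by
  set G' := hG2.1.mk G with hG'
  have hG'm : Measurable G' := hG2.1.stronglyMeasurable_mk.measurable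
  have hGG' : G =ᵐ[volume.restrict (openCone ω)] G' := hG2.1.ae_eq_mk
  set F : EuclideanSpace ℝ (Fin N) → ℝ := fun x => inner ℝ (G' x) (‖x‖⁻¹ • x) with hF
  have hFm : Measurable F := hG'm.inner (by fun_prop)
  have hFG : ∀ x, x ≠ 0 → inner ℝ (G' x) x = F x * ‖x‖ := fun x hx => by
    rw [hF]
    simp only
    rw [inner_smul_right, mul_comm, mul_inv_cancel_left₀ (norm_ne_zero_iff.2 hx)]
  have hGi : IntegrableOn (fun x => ‖G x‖ ^ 2) (openCone ω) :=
    (memLp_two_iff_integrable_sq_norm hG2.1).1 hG2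
  have hFle : ∀ᵐ x ∂(volume.restrict (openCone ω)), F x ^ 2 ≤ ‖G x‖ ^ 2 := by
    filter_upwards [hGG'] with x hx
    rw [hx, ← sq_abs (F x)]
    refine pow_le_pow_left₀ (abs_nonneg _) ?_ 2
    refine (abs_real_inner_le_norm _ _).trans (mul_le_of_le_one_right (norm_nonneg _) ?_)
    rw [norm_smul, norm_inv, norm_norm]
    exact inv_mul_le_one
  have hFi : IntegrableOn (fun x => F x ^ 2) (openCone ω) := by
    refine hGi.mono' (hFm.pow_const 2).aestronglyMeasurable ?_
    filter_upwards [hFle] with x hx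
    rwa [Real.norm_of_nonneg (sq_nonneg _)]
  obtain ⟨hHi, hHle⟩ := angMean_sq hω hpos hFm hFi
  refine ⟨angMean ω F, measurable_angMean hFm, hHi,
    hHle.trans (integral_mono_ae hFi hGi hFle), fun k hk => ?_⟩
  have e : (fun x => inner ℝ (G x) x * k ‖x‖) =ᵐ[volume.restrict (openCone ω)]
      fun x => F x * (fun r => r * k r) ‖x‖ := by
    filter_upwards [hGG', ae_openCone_ne_zero hω] with x hx h0
    rw [hx, hFG x h0]
    ring
  rw [integral_congr_ae e,
    integral_mul_radial hω hpos (F := F) (k := fun r => r * k r) (hk.congr e)]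
  congr 1
  exact integral_congr_ae (ae_of_all _ fun r => by simp only; ring)

theorem integrable_inner_mul_radial {G : EuclideanSpace ℝ (Fin N) → EuclideanSpace ℝ (Fin N)}
    {Ω : Set (EuclideanSpace ℝ (Fin N))} (hG2 : MemLp G 2 (volume.restrict Ω)) {g : ℝ → ℝ}
    (hg : Continuous g) (hgc : HasCompactSupport g) :
    IntegrableOn (fun x => inner ℝ (G x) x * g ‖x‖) Ω := by
  have hgx : MemLp (fun x : EuclideanSpace ℝ (Fin N) => g ‖x‖ • x) 2 (volume.restrict Ω) := by
    have h1 : Continuous fun x : EuclideanSpace ℝ (Fin N) => g ‖x‖ • x := by fun_prop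
    refine h1.memLp_of_hasCompactSupport ?_
    exact (hasCompactSupport_comp_norm hgc).smul_right (f' := fun x => x)
  refine (integrable_inner_of_memLp_two hG2 hgx).congr (ae_of_all _ fun x => ?_)
  simp only
  rw [inner_smul_right, mul_comm]

theorem contDiff_inv_pow_mul {ψ : ℝ → ℝ} (hψ : ContDiff ℝ ((⊤ : ℕ∞) : WithTop ℕ∞) ψ)
    (hψs : tsupport ψ ⊆ Ioi 0) (n : ℕ) :
    ContDiff ℝ ((⊤ : ℕ∞) : WithTop ℕ∞) (fun r => (r ^ n)⁻¹ * ψ r) := by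
  refine contDiff_iff_contDiffAt.2 fun r => ?_
  by_cases hr : r = 0
  · have h1 : ψ =ᶠ[𝓝 r] 0 := notMem_tsupport_iff_eventuallyEq.1
      fun h => (ne_of_gt (hψs h)) hr
    have h2 : (fun r => (r ^ n)⁻¹ * ψ r) =ᶠ[𝓝 r] fun _ => 0 := by
      filter_upwards [h1] with t ht
      rw [ht, Pi.zero_apply, mul_zero]
    exact contDiffAt_const.congr_of_eventuallyEq h2
  · exact ((contDiffAt_id.pow n).inv (pow_ne_zero _ hr)).mul hψ.contDiffAt

/-- The divergence identity for the fields `|x|^{-N} ψ(|x|) x`: the radial profile `f` of `u` has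
weak derivative `H`. -/
theorem integral_profile_mul_deriv (hN : 3 ≤ N) (hω : IsOpenInSphere ω) (hpos : 0 < angMass ω)
    {u : EuclideanSpace ℝ (Fin N) → ℝ} {G : EuclideanSpace ℝ (Fin N) → EuclideanSpace ℝ (Fin N)}
    (hG : IsWeakGradient (openCone ω) u G)
    (hu : MemLp u (ENNReal.ofReal (critExp N)) (volume.restrict (openCone ω)))
    (hG2 : MemLp G 2 (volume.restrict (openCone ω))) {f H : ℝ → ℝ} (hf : Measurable f)
    (huf : ∀ᵐ x ∂(volume.restrict (openCone ω)), u x = f ‖x‖)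
    (hkey : ∀ k : ℝ → ℝ, IntegrableOn (fun x => inner ℝ (G x) x * k ‖x‖) (openCone ω) →
        ∫ x in openCone ω, inner ℝ (G x) x * k ‖x‖ =
          angMass ω * ∫ r, r * H r * k r ∂(radMeas N))
    {ψ : ℝ → ℝ} (hψ : ContDiff ℝ ((⊤ : ℕ∞) : WithTop ℕ∞) ψ) (hψc : HasCompactSupport ψ)
    (hψs : tsupport ψ ⊆ Ioi 0) :
    ∫ r in Ioi 0, f r * deriv ψ r = -∫ r in Ioi 0, H r * ψ r := by
  have hgd := contDiff_inv_pow_mul hψ hψs N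
  have hgs : tsupport (fun r => (r ^ N)⁻¹ * ψ r) ⊆ Ioi 0 := tsupport_mul_subset_right.trans hψs
  have hgc : HasCompactSupport (fun r => (r ^ N)⁻¹ * ψ r) := hψc.mul_left
  have h1 := integral_div_radial hN hω hG hu hG2 hgd hgc hgs
  have hpow : ∀ r : ℝ, r ^ N = r ^ (N - 1) * r := fun r => by
    rw [← pow_succ]; congr 1; omega
  have hgd' : ∀ r, 0 < r → N * ((r ^ N)⁻¹ * ψ r) + r * deriv (fun r => (r ^ N)⁻¹ * ψ r) r =
      r * (r ^ N)⁻¹ * deriv ψ r := fun r hr => by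
    have h2 := ((hasDerivAt_pow N r).fun_inv (pow_ne_zero N hr.ne')).fun_mul
      ((hψ.differentiable (by simp) r).hasDerivAt)
    rw [h2.deriv, hpow]
    field_simp
    ring
  have hm : Measurable (fun r => f r * (r * (r ^ N)⁻¹ * deriv ψ r)) := by
    have := hψ.continuous_deriv (by simp)
    fun_prop
  have e1 : ∫ x in openCone ω, u x * (N * ((‖x‖ ^ N)⁻¹ * ψ ‖x‖) +
      ‖x‖ * deriv (fun r => (r ^ N)⁻¹ * ψ r) ‖x‖) =
      angMass ω * ∫ r in Ioi 0, f r * deriv ψ r := by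
    have e2 := integral_openCone_norm hω hm.aestronglyMeasurable
    rw [integral_radMeas] at e2
    have e3 : ∫ r in Ioi 0, r ^ (N - 1) * (f r * (r * (r ^ N)⁻¹ * deriv ψ r)) =
        ∫ r in Ioi 0, f r * deriv ψ r := by
      refine setIntegral_congr_fun measurableSet_Ioi fun r hr => ?_
      have hr0 : r ≠ 0 := ne_of_gt hr
      rw [hpow]
      field_simp
    rw [← e3, ← e2]
    refine integral_congr_ae ?_
    filter_upwards [huf, ae_openCone_ne_zero hω] with x hx h0
    rw [hx, hgd' _ (norm_pos_iff.2 h0)]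
  have e2 : ∫ x in openCone ω, inner ℝ (G x) x * ((‖x‖ ^ N)⁻¹ * ψ ‖x‖) =
      angMass ω * ∫ r in Ioi 0, H r * ψ r := by
    have e3 := hkey _ (integrable_inner_mul_radial hG2 hgd.continuous hgc)
    rw [integral_radMeas] at e3
    rw [e3]
    congr 1
    refine setIntegral_congr_fun measurableSet_Ioi fun r hr => ?_
    have hr0 : r ≠ 0 := ne_of_gt hr
    rw [hpow]
    field_simp
  rw [e1, e2] at h1
  have h5 : angMass ω * ((∫ r in Ioi 0, f r * deriv ψ r) + ∫ r in Ioi 0, H r * ψ r) = 0 := by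
    linarith
  have h6 := (mul_eq_zero.1 h5).resolve_left hpos.ne'
  linarith

/-- The data attached to a radial function `u ∈ D^{1,2}` of the cone over `ω`: it is `f(|x|)` with
`f(r) = c + ∫_1^r H`, where `H` is the angular mean of the radial component of the weak gradient. -/
theorem exists_radial_data (hN : 3 ≤ N) (hω : IsOpenInSphere ω) (hne : ω.Nonempty)
    {u : EuclideanSpace ℝ (Fin N) → ℝ} (hu : u ∈ D12 (openCone ω))
    (hr : IsRadialOn (openCone ω) u) :
    ∃ (f H : ℝ → ℝ) (c : ℝ), Measurable H ∧ LocallyIntegrableOn H (Ioi 0) ∧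
      (∀ r, f r = c + ∫ t in (1 : ℝ)..r, H t) ∧
      (∀ᵐ x ∂(volume.restrict (openCone ω)), u x = f ‖x‖) ∧
      Integrable (fun r => |f r| ^ critExp N) (radMeas N) ∧
      Integrable (fun r => H r ^ 2) (radMeas N) ∧
      angMass ω * ∫ r, H r ^ 2 ∂(radMeas N) ≤
        ∫ x in openCone ω, ‖weakGrad (openCone ω) u x‖ ^ 2 ∧
      ∀ k : ℝ → ℝ, IntegrableOn (fun x => inner ℝ (weakGrad (openCone ω) u x) x * k ‖x‖)
          (openCone ω) →
        ∫ x in openCone ω, inner ℝ (weakGrad (openCone ω) u x) x * k ‖x‖ =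
          angMass ω * ∫ r, r * H r * k r ∂(radMeas N) := by
  have hpos := angMass_pos (by omega) hω hne
  have hp := critExp_pos hN
  have h2p := two_lt_critExp hN
  obtain ⟨f₀, hf₀, huf⟩ := exists_measurable_profile hω hpos hu.1.1 hr
  obtain ⟨H, hHm, hHi, hHle, hkey⟩ := exists_radial_component hω hpos hu.2.2
  have hf₀i : Integrable (fun r => |f₀ r| ^ critExp N) (radMeas N) := by
    have h1 := hu.1.integrable_norm_rpow (by simpa using hp) ENNReal.ofReal_ne_top
    rw [ENNReal.toReal_ofReal hp.le] at h1
    refine integrable_of_integrable_openCone_norm hω hpos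
      (Measurable.aestronglyMeasurable (by fun_prop)) (h1.congr ?_)
    filter_upwards [huf] with x hx
    rw [hx, Real.norm_eq_abs]
  have hf₀l : LocallyIntegrableOn f₀ (Ioi 0) :=
    locallyIntegrableOn_of_integrable_rpow hf₀ (by linarith) hf₀i
  have hHl : LocallyIntegrableOn H (Ioi 0) :=
    locallyIntegrableOn_of_integrable_rpow hHm one_le_two (by simpa using hHi)
  obtain ⟨c, hc⟩ := exists_ae_eq_primitive hf₀l hHl fun ψ hψ hψc hψs =>
    integral_profile_mul_deriv hN hω hpos (IsWeakGradient.weakGrad hu.2.1) hu.1 hu.2.2 hf₀ huf hkey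
      hψ hψc hψs
  have hc' : ∀ᵐ r ∂(radMeas N), f₀ r = c + ∫ t in (1 : ℝ)..r, H t := by
    refine (withDensity_absolutelyContinuous _ _).ae_le ?_
    exact (ae_restrict_iff' measurableSet_Ioi).2 hc
  refine ⟨fun r => c + ∫ t in (1 : ℝ)..r, H t, H, c, hHm, hHl, fun r => rfl, ?_, ?_, hHi, hHle,
    hkey⟩
  · have h6 : ∀ᵐ r ∂(ENNReal.ofReal (angMass ω) • radMeas N), f₀ r = c + ∫ t in (1 : ℝ)..r, H t :=
      Measure.ae_smul_measure hc' _
    rw [← map_norm_openCone hω] at h6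
    filter_upwards [huf, ae_of_ae_map measurable_norm.aemeasurable h6] with x h1 h2
    rw [h1, h2]
  · refine hf₀i.congr ?_
    filter_upwards [hc'] with r hr
    rw [hr]

end

/-! ### The radial Sobolev inequality -/

section

/-- Fatou's lemma in a form convenient for convergence of integrals of real functions. -/
theorem integral_le_of_tendsto {X : Type*} [MeasurableSpace X] {μ : Measure X} {g : X → ℝ}
    {G : ℕ → X → ℝ} {B : ℕ → ℝ} {b : ℝ} (hg : AEStronglyMeasurable g μ)
    (hG : ∀ k, Integrable (G k) μ) (h0 : ∀ k x, 0 ≤ G k x)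
    (hlim : ∀ᵐ x ∂μ, Tendsto (fun k => G k x) atTop (𝓝 (g x)))
    (hB : ∀ k, ∫ x, G k x ∂μ ≤ B k) (hb : Tendsto B atTop (𝓝 b)) :
    Integrable g μ ∧ ∫ x, g x ∂μ ≤ b := by
  have hg0 : ∀ᵐ x ∂μ, 0 ≤ g x := by
    filter_upwards [hlim] with x hx
    exact ge_of_tendsto' hx fun k => h0 k x
  have hb0 : 0 ≤ b := ge_of_tendsto' hb fun k => (integral_nonneg (h0 k)).trans (hB k)
  have h1 : ∫⁻ x, ENNReal.ofReal (g x) ∂μ ≤ ENNReal.ofReal b := by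
    have e : ∫⁻ x, ENNReal.ofReal (g x) ∂μ =
        ∫⁻ x, liminf (fun k => ENNReal.ofReal (G k x)) atTop ∂μ := by
      refine lintegral_congr_ae ?_
      filter_upwards [hlim] with x hx
      exact ((ENNReal.continuous_ofReal.tendsto _).comp hx).liminf_eq.symm
    rw [e]
    refine (lintegral_liminf_le' fun k => (hG k).1.aemeasurable.ennreal_ofReal).trans ?_
    have h2 : Tendsto (fun k => ENNReal.ofReal (B k)) atTop (𝓝 (ENNReal.ofReal b)) :=
      (ENNReal.continuous_ofReal.tendsto _).comp hb
    rw [← h2.liminf_eq]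
    refine liminf_le_liminf (Eventually.of_forall fun k => ?_)
    rw [← ofReal_integral_eq_lintegral_ofReal (hG k) (ae_of_all _ (h0 k))]
    exact ENNReal.ofReal_le_ofReal (hB k)
  have hi : Integrable g μ := by
    refine ⟨hg, ?_⟩
    rw [hasFiniteIntegral_iff_ofReal hg0]
    exact h1.trans_lt ENNReal.ofReal_lt_top
  refine ⟨hi, ?_⟩
  rw [← ofReal_integral_eq_lintegral_ofReal hi hg0] at h1
  exact (ENNReal.ofReal_le_ofReal_iff hb0).1 h1

variable {N : ℕ}

theorem integrableOn_inv_pow (hN : 3 ≤ N) {a : ℝ} (ha : 0 < a) :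
    IntegrableOn (fun r : ℝ => (r ^ (N - 1))⁻¹) (Ioi a) := by
  have h3 : (3 : ℝ) ≤ N := by exact_mod_cast hN
  have hc : ((N - 1 : ℕ) : ℝ) = (N : ℝ) - 1 := by push_cast [Nat.cast_sub (by omega : 1 ≤ N)]; ring
  refine (integrableOn_Ioi_rpow_of_lt (a := -((N - 1 : ℕ) : ℝ)) (by rw [hc]; linarith) ha).congr_fun
    (fun r hr => ?_) measurableSet_Ioi
  simp only
  rw [Real.rpow_neg (ha.trans hr).le, Real.rpow_natCast]

/-- The arithmetic–geometric form of the Cauchy–Schwarz inequality controlling the tail integral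
of a function by its weighted `L²` norm. -/
theorem abs_integral_Ioi_le (hN : 3 ≤ N) {h : ℝ → ℝ} (hm : Measurable h)
    (hi : Integrable (fun r => h r ^ 2) (radMeas N)) {a : ℝ} (ha : 0 < a) :
    IntegrableOn h (Ioi a) ∧ ∀ t, 0 < t → |∫ r in Ioi a, h r| ≤
      (t * ∫ r, h r ^ 2 ∂(radMeas N)) + t⁻¹ * ∫ r in Ioi a, (r ^ (N - 1))⁻¹ := by
  have hi' := integrable_radMeas_iff.1 hi
  have hia : IntegrableOn (fun r => r ^ (N - 1) * h r ^ 2) (Ioi a) :=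
    hi'.mono_set (Ioi_subset_Ioi ha.le)
  have hw := integrableOn_inv_pow hN ha
  have hbound : ∀ t : ℝ, 0 < t → ∀ r ∈ Ioi a,
      ‖h r‖ ≤ t * (r ^ (N - 1) * h r ^ 2) + t⁻¹ * (r ^ (N - 1))⁻¹ := by
    intro t ht r hr
    have hr0 : 0 < r := ha.trans hr
    have hw0 : 0 < t * r ^ (N - 1) := by positivity
    set y := t * r ^ (N - 1) with hy
    have e : t * (r ^ (N - 1) * h r ^ 2) + t⁻¹ * (r ^ (N - 1))⁻¹ = y * |h r| ^ 2 + y⁻¹ := by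
      rw [hy, sq_abs, mul_inv]; ring
    rw [e, Real.norm_eq_abs]
    have h2 : y * (|h r| - y⁻¹) ^ 2 ≥ 0 := by positivity
    have h3 : y * (|h r| - y⁻¹) ^ 2 = y * |h r| ^ 2 - 2 * |h r| + y⁻¹ := by
      field_simp
      ring
    have := abs_nonneg (h r)
    linarith
  have hmain : IntegrableOn h (Ioi a) := by
    refine ((hia.const_mul 1).add (hw.const_mul 1⁻¹)).mono' hm.aestronglyMeasurable ?_
    filter_upwards [ae_restrict_mem measurableSet_Ioi] with r hr
    exact hbound 1 one_pos r hr
  refine ⟨hmain, fun t ht => ?_⟩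
  have hsum : IntegrableOn (fun r => t * (r ^ (N - 1) * h r ^ 2) + t⁻¹ * (r ^ (N - 1))⁻¹) (Ioi a) :=
    (hia.const_mul t).add (hw.const_mul t⁻¹)
  calc |∫ r in Ioi a, h r| ≤ ∫ r in Ioi a, ‖h r‖ := by
        rw [← Real.norm_eq_abs]
        exact norm_integral_le_integral_norm _
    _ ≤ ∫ r in Ioi a, (t * (r ^ (N - 1) * h r ^ 2) + t⁻¹ * (r ^ (N - 1))⁻¹) :=
        setIntegral_mono_on hmain.norm hsum measurableSet_Ioi (hbound t ht)
    _ = (t * ∫ r in Ioi a, r ^ (N - 1) * h r ^ 2) + t⁻¹ * ∫ r in Ioi a, (r ^ (N - 1))⁻¹ := by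
        rw [integral_add (hia.const_mul t) (hw.const_mul t⁻¹), integral_const_mul,
          integral_const_mul]
    _ ≤ _ := by
        rw [integral_radMeas]
        have : ∫ r in Ioi a, r ^ (N - 1) * h r ^ 2 ≤ ∫ r in Ioi 0, r ^ (N - 1) * h r ^ 2 := by
          refine setIntegral_mono_set hi' ?_ (Ioi_subset_Ioi ha.le).eventuallyLE
          filter_upwards [ae_restrict_mem measurableSet_Ioi] with r hr
          have hr0 : (0 : ℝ) < r := hr
          have : 0 ≤ r ^ (N - 1) * h r ^ 2 := by positivity
          exact this
        gcongr

instance : IsLocallyFiniteMeasure (radMeas N) := by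
  unfold radMeas
  exact IsLocallyFiniteMeasure.withDensity_ofReal (continuous_pow _)

/-- Density of `C_c((0,∞))` in the weighted `L²` space. -/
theorem exists_compactSupport_approx {h : ℝ → ℝ} (hm : Measurable h)
    (hi : Integrable (fun r => h r ^ 2) (radMeas N)) {δ : ℝ} (hδ : 0 < δ) :
    ∃ g : ℝ → ℝ, Continuous g ∧ HasCompactSupport g ∧ tsupport g ⊆ Ioi 0 ∧
      Integrable (fun r => g r ^ 2) (radMeas N) ∧
      Integrable (fun r => (h r - g r) ^ 2) (radMeas N) ∧
      ∫ r, (h r - g r) ^ 2 ∂(radMeas N) ≤ δ := by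
  have hh : MemLp h (ENNReal.ofReal 2) (radMeas N) := by
    simpa using (memLp_two_iff_integrable_sq hm.aestronglyMeasurable).2 hi
  obtain ⟨g₀, hg₀c, hg₀, hg₀cont, hg₀m⟩ := hh.exists_hasCompactSupport_integral_rpow_sub_le two_pos
    (ε := δ / 4) (by positivity)
  obtain ⟨χ, hχd, hχc, hχs, hχ1, hχlim, -⟩ := exists_radial_cutoff
  have hto : ∀ f : ℝ → ℝ, MemLp f (ENNReal.ofReal 2) (radMeas N) →
      Integrable (fun r => f r ^ 2) (radMeas N) := fun f hf => by
    have hf' : MemLp f 2 (radMeas N) := by simpa using hf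
    exact (memLp_two_iff_integrable_sq hf'.1).1 hf'
  have hi1 := hto _ (hh.sub hg₀m)
  have hi2 := hto _ hg₀m
  have hb1 : ∀ k r, (1 - χ k r) ^ 2 ≤ 4 := fun k r => by
    have := abs_le.1 (hχ1 k r)
    nlinarith
  have hlim : Tendsto (fun k => ∫ r, ((1 - χ k r) * g₀ r) ^ 2 ∂(radMeas N)) atTop
      (𝓝 (∫ r, (0 : ℝ) ∂(radMeas N))) := by
    refine tendsto_integral_of_dominated_convergence (fun r => 4 * g₀ r ^ 2) (fun k => ?_)
      (hi2.const_mul 4) (fun k => ae_of_all _ fun r => ?_) ?_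
    · have := (hχd k).continuous
      exact Continuous.aestronglyMeasurable (by fun_prop)
    · rw [Real.norm_of_nonneg (sq_nonneg _), mul_pow]
      exact mul_le_mul_of_nonneg_right (hb1 k r) (sq_nonneg _)
    · filter_upwards [ae_radMeas N] with r hr
      refine tendsto_const_nhds.congr' ?_
      filter_upwards [hχlim r hr] with k hk
      rw [hk.eq_of_nhds]
      simp
  rw [integral_zero] at hlim
  obtain ⟨k, hk⟩ := (hlim.eventually (gt_mem_nhds (show (0 : ℝ) < δ / 4 by positivity))).exists
  have hχk := (hχd k).continuous
  have hi3 : Integrable (fun r => ((1 - χ k r) * g₀ r) ^ 2) (radMeas N) := by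
    refine (hi2.const_mul 4).mono' (Continuous.aestronglyMeasurable (by fun_prop))
      (ae_of_all _ fun r => ?_)
    rw [Real.norm_of_nonneg (sq_nonneg _), mul_pow]
    exact mul_le_mul_of_nonneg_right (hb1 k r) (sq_nonneg _)
  have hi4 : Integrable (fun r => 2 * (h r - g₀ r) ^ 2 + 2 * ((1 - χ k r) * g₀ r) ^ 2)
      (radMeas N) := (hi1.const_mul 2).add (hi3.const_mul 2)
  have hle : ∀ r, (h r - χ k r * g₀ r) ^ 2 ≤
      2 * (h r - g₀ r) ^ 2 + 2 * ((1 - χ k r) * g₀ r) ^ 2 := fun r => by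
    nlinarith [sq_nonneg ((h r - g₀ r) - (1 - χ k r) * g₀ r)]
  have hi5 : Integrable (fun r => (h r - χ k r * g₀ r) ^ 2) (radMeas N) := by
    refine hi4.mono' (Measurable.aestronglyMeasurable (by fun_prop)) (ae_of_all _ fun r => ?_)
    rw [Real.norm_of_nonneg (sq_nonneg _)]
    exact hle r
  refine ⟨fun r => χ k r * g₀ r, by fun_prop, hg₀c.mul_left,
    tsupport_mul_subset_left.trans (hχs k), ?_, hi5, ?_⟩
  · refine hi2.mono' (Continuous.aestronglyMeasurable (by fun_prop)) (ae_of_all _ fun r => ?_)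
    rw [Real.norm_of_nonneg (sq_nonneg _), mul_pow, ← sq_abs (χ k r)]
    refine mul_le_of_le_one_left (sq_nonneg _) ?_
    exact pow_le_one₀ (abs_nonneg _) (hχ1 k r)
  · refine (integral_mono hi5 hi4 hle).trans ?_
    have hi1' : Integrable (fun r => (h r - g₀ r) ^ 2) (radMeas N) := hi1
    rw [integral_add (hi1'.const_mul 2) (hi3.const_mul 2), integral_const_mul, integral_const_mul]
    have e : ∫ r, ‖h r - g₀ r‖ ^ (2 : ℝ) ∂(radMeas N) = ∫ r, (h r - g₀ r) ^ 2 ∂(radMeas N) := by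
      refine integral_congr_ae (ae_of_all _ fun r => ?_)
      simp
    rw [e] at hg₀
    linarith

/-- The surface area of the unit sphere. -/
def sphereMass (N : ℕ) : ℝ := angMass (Metric.sphere (0 : EuclideanSpace ℝ (Fin N)) 1)

theorem integral_norm_eq (hN : 3 ≤ N) {g : ℝ → ℝ} (hg : AEStronglyMeasurable g (radMeas N)) :
    ∫ x : EuclideanSpace ℝ (Fin N), g ‖x‖ = sphereMass N * ∫ r, g r ∂(radMeas N) := by
  have h := integral_openCone_norm isOpenInSphere_sphere hg
  rwa [restrict_openCone_sphere hN] at h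

theorem contDiff_primitive_norm {g : ℝ → ℝ} (hg : Continuous g)
    (hs : tsupport g ⊆ Ioi 0) (b : ℝ) :
    ContDiff ℝ 1 (fun x : EuclideanSpace ℝ (Fin N) => ∫ t in b..‖x‖, g t) ∧
      ∀ x : EuclideanSpace ℝ (Fin N),
        ‖fderiv ℝ (fun x : EuclideanSpace ℝ (Fin N) => ∫ t in b..‖x‖, g t) x‖ ^ 2 = g ‖x‖ ^ 2 := by
  have hd : ∀ r, HasDerivAt (fun r => ∫ t in b..r, g t) (g r) r := fun r =>
    intervalIntegral.integral_hasDerivAt_right (hg.intervalIntegrable _ _)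
      (hg.stronglyMeasurableAtFilter _ _) hg.continuousAt
  have hde : deriv (fun r => ∫ t in b..r, g t) = g := funext fun r => (hd r).deriv
  have hF : ContDiff ℝ 1 (fun r => ∫ t in b..r, g t) := by
    rw [contDiff_one_iff_deriv]
    exact ⟨fun r => (hd r).differentiableAt, by rw [hde]; exact hg⟩
  have h0 : (0 : ℝ) ∉ tsupport g := fun h => lt_irrefl (0 : ℝ) (hs h)
  obtain ⟨η, hη, hη'⟩ := Metric.eventually_nhds_iff.1 (notMem_tsupport_iff_eventuallyEq.1 h0)
  have hloc : (fun x : EuclideanSpace ℝ (Fin N) => ∫ t in b..‖x‖, g t) =ᶠ[𝓝 0]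
      fun _ => ∫ t in b..0, g t := by
    filter_upwards [Metric.ball_mem_nhds (0 : EuclideanSpace ℝ (Fin N)) hη] with x hx
    have hx' : ‖x‖ < η := by simpa using hx
    rw [← intervalIntegral.integral_add_adjacent_intervals (hg.intervalIntegrable b 0)
      (hg.intervalIntegrable 0 ‖x‖)]
    have : ∫ t in (0 : ℝ)..‖x‖, g t = 0 := by
      refine intervalIntegral.integral_zero_ae (ae_of_all _ fun t ht => ?_)
      rw [uIoc_of_le (norm_nonneg x)] at ht
      refine hη' ?_
      rw [Real.dist_eq, sub_zero, abs_of_pos ht.1]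
      exact ht.2.trans_lt hx'
    rw [this, add_zero]
  constructor
  · refine contDiff_iff_contDiffAt.2 fun x => ?_
    by_cases hx : x = 0
    · subst hx
      exact contDiffAt_const.congr_of_eventuallyEq hloc
    · exact hF.contDiffAt.comp x (contDiffAt_norm ℝ hx)
  · intro x
    by_cases hx : x = 0
    · subst hx
      rw [hloc.fderiv_eq, norm_zero, image_eq_zero_of_notMem_tsupport h0]
      simp
    · have h1 : DifferentiableAt ℝ (fun x : EuclideanSpace ℝ (Fin N) => ‖x‖) x :=
        (contDiffAt_norm ℝ hx (n := 1)).differentiableAt one_ne_zero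
      have h2 := (hd ‖x‖).comp_hasFDerivAt x h1.hasFDerivAt
      have h3 : fderiv ℝ (fun x : EuclideanSpace ℝ (Fin N) => ∫ t in b..‖x‖, g t) x = _ := h2.fderiv
      have : _root_.Nontrivial (EuclideanSpace ℝ (Fin N)) := ⟨x, 0, hx⟩
      have h4 : ‖fderiv ℝ (fun x : EuclideanSpace ℝ (Fin N) => ‖x‖) x‖ = 1 := norm_fderiv_norm h1
      rw [h3, norm_smul, h4, mul_one, Real.norm_eq_abs, sq_abs]

/-- The radial Sobolev inequality for profiles with derivative in `C_c((0,∞))`: the corresponding radial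
functions on `ℝ^N` are of class `C¹`, being constant near the origin. -/
theorem radial_sobolev_of_hasCompactSupport (hN : 3 ≤ N) {g : ℝ → ℝ} (hg : Continuous g)
    (hc : HasCompactSupport g) (hs : tsupport g ⊆ Ioi 0) :
    Integrable (fun r => |∫ t in Ioi r, g t| ^ critExp N) (radMeas N) ∧
    sobolevConst N * (sphereMass N * ∫ r, |∫ t in Ioi r, g t| ^ critExp N ∂(radMeas N)) ^
      (2 / critExp N) ≤ sphereMass N * ∫ r, g r ^ 2 ∂(radMeas N) := by
  have hp := critExp_pos hN
  obtain ⟨a, b, ha, ha1, hb1, hab⟩ := exists_Ioo_of_tsupport hc hs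
  have hgi : Integrable g := hg.integrable_of_hasCompactSupport hc
  have hzb : ∀ r, b ≤ r → g r = 0 := fun r hr =>
    image_eq_zero_of_notMem_tsupport fun h => not_lt.2 hr (hab h).2
  have htail : ∀ r, b ≤ r → ∫ t in Ioi r, g t = 0 := fun r hr => by
    refine setIntegral_eq_zero_of_forall_eq_zero fun t ht => hzb t (hr.trans (le_of_lt ht))
  have hF : ∀ r, ∫ t in Ioi r, g t = -∫ t in b..r, g t := fun r => by
    have := intervalIntegral.integral_interval_add_Ioi (a := r) (b := b) (f := g) (μ := volume)
      hgi.integrableOn hgi.integrableOn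
    rw [← this, htail b le_rfl, add_zero, intervalIntegral.integral_symm]
  obtain ⟨hV, hV'⟩ := contDiff_primitive_norm (N := N) hg hs b
  have hVc : HasCompactSupport fun x : EuclideanSpace ℝ (Fin N) => ∫ t in b..‖x‖, g t := by
    refine HasCompactSupport.intro (isCompact_closedBall 0 b) fun x hx => ?_
    have hx' : b < ‖x‖ := by simpa using hx
    rw [← neg_eq_zero, ← hF, htail _ hx'.le]
  have key := sobolev_of_hasCompactSupport hN hV hVc
  simp_rw [hV'] at key
  have hFcont : Continuous fun r => ∫ t in b..r, g t :=
    intervalIntegral.continuous_primitive (fun _ _ => hg.intervalIntegrable _ _) b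
  have hm : Continuous fun r => |∫ t in b..r, g t| ^ critExp N :=
    hFcont.abs.rpow_const fun _ => Or.inr hp.le
  simp_rw [hF, abs_neg]
  constructor
  · refine integrable_of_integrable_openCone_norm isOpenInSphere_sphere (angMass_sphere_pos hN)
      hm.aestronglyMeasurable ?_
    refine Integrable.integrableOn (Continuous.integrable_of_hasCompactSupport ?_ ?_)
    · exact hm.comp continuous_norm
    · refine HasCompactSupport.intro (isCompact_closedBall 0 b) fun x hx => ?_
      have hx' : b < ‖x‖ := by simpa using hx
      have h0 : ∫ t in b..‖x‖, g t = 0 := by rw [← neg_eq_zero, ← hF, htail _ hx'.le]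
      rw [h0, abs_zero, Real.zero_rpow hp.ne']
  · have hm2 : Continuous fun r => g r ^ 2 := hg.pow 2
    rw [← integral_norm_eq hN hm.aestronglyMeasurable,
      ← integral_norm_eq hN hm2.aestronglyMeasurable]
    exact key

/-- A profile with critically integrable power and square integrable derivative vanishes at
infinity. -/
theorem profile_eq_neg_integral_Ioi (hN : 3 ≤ N) {f H : ℝ → ℝ} {c : ℝ} (hm : Measurable H)
    (hf : ∀ r, f r = c + ∫ t in (1 : ℝ)..r, H t)
    (hfi : Integrable (fun r => |f r| ^ critExp N) (radMeas N))
    (hHi : Integrable (fun r => H r ^ 2) (radMeas N)) {r : ℝ} (hr : 0 < r) :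
    f r = -∫ t in Ioi r, H t := by
  have hp := critExp_pos hN
  have h1 := (abs_integral_Ioi_le hN hm hHi (a := 1) one_pos).1
  have h2 := (abs_integral_Ioi_le hN hm hHi hr).1
  set L := c + ∫ t in Ioi 1, H t with hL
  have hlim : Tendsto f atTop (𝓝 L) := by
    rw [show f = _ from funext hf]
    exact (intervalIntegral_tendsto_integral_Ioi 1 h1 tendsto_id).const_add c
  have hL0 : L = 0 := by
    by_contra h
    have hl : 0 < |L| := abs_pos.2 h
    have h3 : ∀ᶠ r in atTop, |L| / 2 < |f r| := hlim.abs.eventually (lt_mem_nhds (by linarith))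
    obtain ⟨R, hR⟩ := eventually_atTop.1 h3
    have h4 := (integrable_radMeas_iff.1 hfi).mono_set
      (Ioi_subset_Ioi (zero_le_one.trans (le_max_right R 1)))
    have h5 : IntegrableOn (fun _ : ℝ => (|L| / 2) ^ critExp N) (Ioi (max R 1)) := by
      refine h4.mono' aestronglyMeasurable_const ?_
      filter_upwards [ae_restrict_mem measurableSet_Ioi] with r hr
      have hr' : max R 1 < r := hr
      have hrR : R ≤ r := (le_max_left _ _).trans hr'.le
      have hr1 : 1 ≤ r := (le_max_right _ _).trans hr'.le
      rw [Real.norm_of_nonneg (by positivity)]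
      calc (|L| / 2) ^ critExp N ≤ |f r| ^ critExp N :=
            Real.rpow_le_rpow (by positivity) (hR r hrR).le hp.le
        _ ≤ _ := le_mul_of_one_le_left (by positivity) (one_le_pow₀ hr1)
    rw [integrableOn_const_iff] at h5
    rcases h5 with h5 | h5
    · have : (|L| / 2) ^ critExp N ≠ 0 := by positivity
      exact this (enorm_eq_zero.1 h5)
    · simp at h5
  have h6 := intervalIntegral.integral_interval_add_Ioi h1 h2
  rw [hf, eq_neg_iff_add_eq_zero, add_assoc, h6]
  exact hL0

/-- The sharp Sobolev inequality in the radial variable, by approximation of the derivative `H` in the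
weighted `L²` space. The profiles then converge pointwise and Fatou's lemma applies. -/
theorem radial_sobolev (hN : 3 ≤ N) {f H : ℝ → ℝ} {c : ℝ} (hm : Measurable H)
    (hf : ∀ r, f r = c + ∫ t in (1 : ℝ)..r, H t)
    (hfi : Integrable (fun r => |f r| ^ critExp N) (radMeas N))
    (hHi : Integrable (fun r => H r ^ 2) (radMeas N)) :
    sobolevConst N * (sphereMass N * ∫ r, |f r| ^ critExp N ∂(radMeas N)) ^ (2 / critExp N) ≤
      sphereMass N * ∫ r, H r ^ 2 ∂(radMeas N) := by
  have hp := critExp_pos hN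
  have hσ : 0 < sphereMass N := angMass_sphere_pos hN
  have hS := sobolevConst_pos hN
  have happ : ∀ k : ℕ, _ := fun k => exists_compactSupport_approx hm hHi
    (δ := (((k : ℝ) + 1) ^ 2)⁻¹) (by positivity)
  choose g hgc hgs hgt hgi hdi hgd using happ
  set Q := ∫ r, H r ^ 2 ∂(radMeas N) with hQ
  have hQ0 : 0 ≤ Q := integral_nonneg fun r => sq_nonneg _
  have hk0 : ∀ k : ℕ, (0 : ℝ) < k + 1 := fun k => by positivity
  have hinv : Tendsto (fun k : ℕ => ((k : ℝ) + 1)⁻¹) atTop (𝓝 0) :=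
    (tendsto_atTop_add_const_right _ _ tendsto_natCast_atTop_atTop).inv_tendsto_atTop
  set q : ℕ → ℝ := fun k => (1 + ((k : ℝ) + 1)⁻¹) * Q + (((k : ℝ) + 1)⁻¹ ^ 2 + ((k : ℝ) + 1)⁻¹)
    with hq
  have hqlim : Tendsto q atTop (𝓝 Q) := by
    have := ((hinv.const_add 1).mul_const Q).add ((hinv.pow 2).add hinv)
    norm_num at this
    simpa [hq] using this
  have hgq : ∀ k, ∫ r, g k r ^ 2 ∂(radMeas N) ≤ q k := by
    intro k
    have hle : ∀ r, g k r ^ 2 ≤ (1 + ((k : ℝ) + 1)⁻¹) * H r ^ 2 +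
        (1 + ((k : ℝ) + 1)) * (H r - g k r) ^ 2 := by
      intro r
      set s := (k : ℝ) + 1 with hs
      have hs0 : 0 < s := hk0 k
      have h1 : 0 ≤ s⁻¹ * (H r + s * (H r - g k r)) ^ 2 := by positivity
      have h2 : s⁻¹ * (H r + s * (H r - g k r)) ^ 2 = s⁻¹ * H r ^ 2 +
          2 * H r * (H r - g k r) + s * (H r - g k r) ^ 2 := by
        field_simp
        ring
      nlinarith
    have h1 := integral_mono (hgi k)
      ((hHi.const_mul (1 + ((k : ℝ) + 1)⁻¹)).add ((hdi k).const_mul (1 + ((k : ℝ) + 1)))) hle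
    have h2 : ∫ r, ((1 + ((k : ℝ) + 1)⁻¹) * H r ^ 2 +
        (1 + ((k : ℝ) + 1)) * (H r - g k r) ^ 2) ∂(radMeas N) = (1 + ((k : ℝ) + 1)⁻¹) * Q +
        (1 + ((k : ℝ) + 1)) * ∫ r, (H r - g k r) ^ 2 ∂(radMeas N) := by
      rw [integral_add (hHi.const_mul _) ((hdi k).const_mul _), integral_const_mul,
        integral_const_mul]
    have h3 : (1 + ((k : ℝ) + 1)) * ∫ r, (H r - g k r) ^ 2 ∂(radMeas N) ≤
        (1 + ((k : ℝ) + 1)) * (((k : ℝ) + 1) ^ 2)⁻¹ :=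
      mul_le_mul_of_nonneg_left (hgd k) (by positivity)
    have h4 : (1 + ((k : ℝ) + 1)) * (((k : ℝ) + 1) ^ 2)⁻¹ =
        ((k : ℝ) + 1)⁻¹ ^ 2 + ((k : ℝ) + 1)⁻¹ := by
      have := (hk0 k).ne'
      field_simp
    refine h1.trans (h2.le.trans ?_)
    rw [hq]
    simp only
    linarith
  have hpt : ∀ᵐ r ∂(radMeas N), Tendsto (fun k => |∫ t in Ioi r, g k t| ^ critExp N) atTop
      (𝓝 (|f r| ^ critExp N)) := by
    filter_upwards [ae_radMeas N] with r hr
    have hr0 : (0 : ℝ) < r := hr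
    have h1 : Tendsto (fun k => (∫ t in Ioi r, H t) - ∫ t in Ioi r, g k t) atTop (𝓝 0) := by
      set W := ∫ r in Ioi r, (r ^ (N - 1))⁻¹ with hW
      refine squeeze_zero_norm (a := fun k : ℕ => ((k : ℝ) + 1)⁻¹ + ((k : ℝ) + 1)⁻¹ * W)
        (fun k => ?_) ?_
      · have h2 := (abs_integral_Ioi_le hN (hm.sub (hgc k).measurable) (hdi k) hr0).2 (k + 1) (hk0 k)
        have h3 : ((k : ℝ) + 1) * ∫ r, (H r - g k r) ^ 2 ∂(radMeas N) ≤ ((k : ℝ) + 1)⁻¹ := by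
          refine (mul_le_mul_of_nonneg_left (hgd k) (hk0 k).le).trans (le_of_eq ?_)
          have := (hk0 k).ne'
          field_simp
        have h4 : (∫ t in Ioi r, (H - g k) t) = (∫ t in Ioi r, H t) - ∫ t in Ioi r, g k t :=
          integral_sub (abs_integral_Ioi_le hN hm hHi hr0).1
            ((hgc k).integrable_of_hasCompactSupport (hgs k)).integrableOn
        rw [← h4, Real.norm_eq_abs]
        exact h2.trans (add_le_add h3 le_rfl)
      · simpa using hinv.add (hinv.mul_const W)
    have h2 : Tendsto (fun k => ∫ t in Ioi r, g k t) atTop (𝓝 (∫ t in Ioi r, H t)) := by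
      have := h1.const_sub (∫ t in Ioi r, H t)
      simpa using this
    have h3 := (h2.abs.rpow_const (p := critExp N) (Or.inr hp.le))
    rwa [profile_eq_neg_integral_Ioi hN hm hf hfi hHi hr0, abs_neg]
  have hkey := fun k => radial_sobolev_of_hasCompactSupport hN (hgc k) (hgs k) (hgt k)
  have hconv : ∀ I q : ℝ, 0 ≤ I → sobolevConst N * (sphereMass N * I) ^ (2 / critExp N) ≤
      sphereMass N * q → I ≤ (sphereMass N * q / sobolevConst N) ^ (critExp N / 2) / sphereMass N := by
    intro I q hI h
    have h1 : (sphereMass N * I) ^ (2 / critExp N) ≤ sphereMass N * q / sobolevConst N := by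
      rw [le_div_iff₀ hS]; linarith
    have h2 := Real.rpow_le_rpow (by positivity) h1 (show 0 ≤ critExp N / 2 by positivity)
    rw [← Real.rpow_mul (by positivity), show 2 / critExp N * (critExp N / 2) = 1 by field_simp,
      Real.rpow_one] at h2
    rw [le_div_iff₀ hσ]
    linarith
  have hfat := (integral_le_of_tendsto hfi.1 (fun k => (hkey k).1) (fun k r => by positivity) hpt
    (B := fun k => (sphereMass N * q k / sobolevConst N) ^ (critExp N / 2) / sphereMass N)
    (fun k => hconv _ _ (integral_nonneg fun r => by positivity)
      ((hkey k).2.trans (mul_le_mul_of_nonneg_left (hgq k) hσ.le)))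
    (b := (sphereMass N * Q / sobolevConst N) ^ (critExp N / 2) / sphereMass N)
    ((((hqlim.const_mul _).div_const _).rpow_const (Or.inr (by positivity))).div_const _)).2
  rw [le_div_iff₀ hσ] at hfat
  have h5 := Real.rpow_le_rpow (by positivity) hfat (show 0 ≤ 2 / critExp N by positivity)
  rw [← Real.rpow_mul (by positivity), show critExp N / 2 * (2 / critExp N) = 1 by field_simp,
    Real.rpow_one, le_div_iff₀ hS] at h5
  rw [mul_comm (sphereMass N), mul_comm (sobolevConst N)]
  exact h5

end

/-! ### Minimality of the bubbles among radial functions -/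

section

variable {N : ℕ} {ω : Set (EuclideanSpace ℝ (Fin N))}

/-- On the Nehari manifold the two sides of the Sobolev inequality are powers of the same integral,
which is therefore at least that of a bubble. -/
theorem bubbleEnergy_le_of_sobolev (hN : 3 ≤ N) {X : ℝ} (hX : 0 < X)
    (h : sobolevConst N * X ^ (2 / critExp N) ≤ X) : bubbleEnergy N ≤ X := by
  have hp := critExp_pos hN
  have h2 := two_lt_critExp hN
  have hE := bubbleEnergy_pos hN
  have ht : 0 < 1 - 2 / critExp N := by
    rw [sub_pos, div_lt_one hp]; exact h2
  rw [sobolevConst_eq hN, ← le_div_iff₀ (by positivity)] at h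
  have e : X / X ^ (2 / critExp N) = X ^ (1 - 2 / critExp N) := by
    rw [Real.rpow_sub hX, Real.rpow_one]
  rw [e] at h
  exact (Real.rpow_le_rpow_iff hE.le hX.le ht).1 h

theorem integral_rpow_pos_of_nontrivial (hN : 3 ≤ N) {Ω : Set (EuclideanSpace ℝ (Fin N))}
    {u : EuclideanSpace ℝ (Fin N) → ℝ}
    (hu : MemLp u (ENNReal.ofReal (critExp N)) (volume.restrict Ω)) (h0 : Nontrivial Ω u) :
    0 < ∫ x in Ω, |u x| ^ critExp N := by
  have hp := critExp_pos hN
  have hi := hu.integrable_norm_rpow (by simpa using hp) ENNReal.ofReal_ne_top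
  rw [ENNReal.toReal_ofReal hp.le] at hi
  refine lt_of_le_of_ne (integral_nonneg fun x => by positivity) fun h => h0 ?_
  have h1 := (integral_eq_zero_iff_of_nonneg (fun x => by positivity) hi).1 h.symm
  filter_upwards [h1] with x hx
  have := (Real.rpow_eq_zero (abs_nonneg _) hp.ne').1 hx
  simpa using this

theorem le_integral_of_mem_radialNehari (hN : 3 ≤ N) (hω : IsOpenInSphere ω) (hne : ω.Nonempty)
    {v : EuclideanSpace ℝ (Fin N) → ℝ} (hv : v ∈ radialNehari (openCone ω)) :
    angMass ω * radialBubbleMass N ≤ ∫ x in openCone ω, |v x| ^ critExp N := by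
  obtain ⟨⟨hD, h0, hNe⟩, hr⟩ := hv
  have hpos := angMass_pos (by omega) hω hne
  have hσ : 0 < sphereMass N := angMass_sphere_pos hN
  obtain ⟨f, H, c, hm, -, hf, huf, hfi, hHi, hle, -⟩ := exists_radial_data hN hω hne hD hr
  have hI0 := integral_rpow_pos_of_nontrivial hN hD.1 h0
  have e : ∫ x in openCone ω, |v x| ^ critExp N =
      angMass ω * ∫ r, |f r| ^ critExp N ∂(radMeas N) := by
    rw [← integral_openCone_norm hω hfi.1]
    refine integral_congr_ae ?_
    filter_upwards [huf] with x hx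
    rw [hx]
  rw [hNe, e] at hle
  rw [e] at hI0 ⊢
  have hKI := le_of_mul_le_mul_left hle hpos
  have hI := pos_of_mul_pos_right hI0 hpos.le
  have h1 := (radial_sobolev hN hm hf hfi hHi).trans (mul_le_mul_of_nonneg_left hKI hσ.le)
  have h2 := bubbleEnergy_le_of_sobolev hN (mul_pos hσ hI) h1
  refine mul_le_mul_of_nonneg_left ?_ hpos.le
  rw [radialBubbleMass, div_le_iff₀ (angMass_sphere_pos hN), mul_comm]
  exact h2

theorem energy_bubble_le (hN : 3 ≤ N) (hω : IsOpenInSphere ω) (hne : ω.Nonempty) {ε : ℝ}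
    (hε : 0 < ε) {v : EuclideanSpace ℝ (Fin N) → ℝ} (hv : v ∈ radialNehari (openCone ω)) :
    energy (openCone ω) (bubble ε) ≤ energy (openCone ω) v := by
  rw [energy_bubble_openCone hN hω hne hε, energy_eq_of_mem_nehari hN hv.1]
  exact mul_le_mul_of_nonneg_left (le_integral_of_mem_radialNehari hN hω hne hv) (by positivity)

theorem radialLeastEnergy_openCone (hN : 3 ≤ N) (hω : IsOpenInSphere ω) (hne : ω.Nonempty) :
    radialLeastEnergy (openCone ω) = 1 / N * (angMass ω * radialBubbleMass N) := by
  rw [← energy_bubble_openCone hN hω hne one_pos]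
  refine IsLeast.csInf_eq ⟨⟨_, bubble_mem_radialNehari hN hω hne one_pos, rfl⟩, ?_⟩
  rintro _ ⟨v, hv, rfl⟩
  exact energy_bubble_le hN hω hne one_pos hv

end

/-! ### The radial equation -/

section

variable {N : ℕ} {f y : ℝ → ℝ}

/-- `(f, y)` solves the radial equation on the half-line in the form `f' = r^{1-N} y`,
`y' = -r^{N-1} |f|^{2*-2} f`, so that `y = r^{N-1} f'`. -/
structure IsRadialSolution (N : ℕ) (f y : ℝ → ℝ) : Prop where
  hasDerivAt_fun : ∀ r, 0 < r → HasDerivAt f ((r ^ (N - 1))⁻¹ * y r) r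
  hasDerivAt_flux : ∀ r, 0 < r → HasDerivAt y (-(r ^ (N - 1) * (|f r| ^ (critExp N - 2) * f r))) r

theorem IsRadialSolution.neg (h : IsRadialSolution N f y) :
    IsRadialSolution N (fun r => -f r) (fun r => -y r) := by
  refine ⟨fun r hr => ?_, fun r hr => ?_⟩
  · exact (h.hasDerivAt_fun r hr).fun_neg.congr_deriv (by ring)
  · exact (h.hasDerivAt_flux r hr).fun_neg.congr_deriv (by rw [abs_neg]; ring)

/-- The Pohozaev quantity `r^N f'²/2 + (N-2)/2 r^{N-1} f f' + r^N |f|^{2*}/2*` of the radial equation,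
written in terms of `y = r^{N-1} f'`. -/
def pohozaev (N : ℕ) (f y : ℝ → ℝ) (r : ℝ) : ℝ :=
  r ^ 2 * (r ^ N)⁻¹ * y r ^ 2 / 2 + ((N : ℝ) - 2) / 2 * (f r * y r) +
    r ^ N * |f r| ^ critExp N / critExp N

theorem hasDerivAt_pohozaev (hN : 3 ≤ N) (h : IsRadialSolution N f y) {r : ℝ} (hr : 0 < r) :
    HasDerivAt (pohozaev N f y) 0 r := by
  have h3 : (3 : ℝ) ≤ N := by exact_mod_cast hN
  have h2 : (N : ℝ) - 2 ≠ 0 := by linarith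
  have hN0 : (N : ℝ) ≠ 0 := by linarith
  have hp := critExp_pos hN
  have h2p := two_lt_critExp hN
  have hf := h.hasDerivAt_fun r hr
  have hy := h.hasDerivAt_flux r hr
  have hpow : r ^ N = r ^ (N - 1) * r := by
    rw [← pow_succ]; congr 1; omega
  have d1 := (((hasDerivAt_pow 2 r).fun_mul ((hasDerivAt_pow N r).fun_inv
    (pow_ne_zero N hr.ne'))).fun_mul (hy.fun_pow 2)).div_const 2
  have d2 := (hf.fun_mul hy).const_mul (((N : ℝ) - 2) / 2)
  have d3 := (((hasDerivAt_pow N r).fun_mul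
    ((hasDerivAt_abs_rpow (f r) (by linarith : 1 < critExp N)).comp r hf)).div_const (critExp N))
  have d := (d1.fun_add d2).fun_add d3
  refine d.congr_deriv ?_
  have hP : (0 : ℝ) < r ^ (N - 1) := by positivity
  simp only [Function.comp]
  rw [← abs_rpow_mul_self hN (f r), hpow]
  set P := r ^ (N - 1) with hPdef
  set A := |f r| ^ (critExp N - 2) with hA
  have hpN : critExp N * ((N : ℝ) - 2) = 2 * N := by
    rw [critExp]; field_simp
  have hp' : critExp N = 2 * N / ((N : ℝ) - 2) := rfl
  push_cast
  field_simp
  rw [hp']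
  field_simp
  ring

end

/-! ### Classification of the solutions of the radial equation -/

section

variable {N : ℕ} {f y : ℝ → ℝ}

theorem sq_le_add_mul_rpow {p δ Y : ℝ} (hp : 2 < p) (hδ : 0 < δ) (hY : 0 ≤ Y) :
    Y ^ 2 ≤ δ + √δ ^ (2 - p) * Y ^ p := by
  have hs : 0 < √δ := Real.sqrt_pos.2 hδ
  rcases le_total Y (√δ) with h | h
  · have h1 : Y ^ 2 ≤ δ := by
      calc Y ^ 2 ≤ √δ ^ 2 := pow_le_pow_left₀ hY h 2
        _ = δ := Real.sq_sqrt hδ.le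
    have : 0 ≤ √δ ^ (2 - p) * Y ^ p := by positivity
    linarith
  · have hY0 : 0 < Y := hs.trans_le h
    have h1 : Y ^ (2 - p) ≤ √δ ^ (2 - p) := Real.rpow_le_rpow_of_nonpos hs h (by linarith)
    have h2 : Y ^ 2 = Y ^ (2 - p) * Y ^ p := by
      rw [← Real.rpow_add hY0, sub_add_cancel, Real.rpow_two]
    have h3 : Y ^ (2 - p) * Y ^ p ≤ √δ ^ (2 - p) * Y ^ p :=
      mul_le_mul_of_nonneg_right h1 (by positivity)
    linarith

/-- The Pohozaev quantity of a solution of finite energy vanishes: it is constant, and its quotient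
by `r` is integrable up to an arbitrarily small multiple of `1/r`. -/
theorem pohozaev_eq_zero (hN : 3 ≤ N) (h : IsRadialSolution N f y)
    (hfi : Integrable (fun r => |f r| ^ critExp N) (radMeas N))
    (hyi : Integrable (fun r => ((r ^ (N - 1))⁻¹ * y r) ^ 2) (radMeas N)) {r : ℝ} (hr : 0 < r) :
    pohozaev N f y r = 0 := by
  have h3 : (3 : ℝ) ≤ N := by exact_mod_cast hN
  have h2 : (0 : ℝ) < (N : ℝ) - 2 := by linarith
  have hp := critExp_pos hN
  have h2p := two_lt_critExp hN
  by_contra hE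
  set E := pohozaev N f y r with hEdef
  have hconst : ∀ t, 0 < t → pohozaev N f y t = E := fun t ht =>
    isOpen_Ioi.is_const_of_deriv_eq_zero isPreconnected_Ioi
      (fun s hs => (hasDerivAt_pohozaev hN h hs).differentiableAt.differentiableWithinAt)
      (fun s hs => (hasDerivAt_pohozaev hN h hs).deriv) (mem_Ioi.2 ht) (mem_Ioi.2 hr)
  have hE0 : 0 < |E| := abs_pos.2 hE
  set γ := ((N : ℝ) - 2) / 2 with hγ
  have hγ0 : 0 < γ := by positivity
  set δ := |E| / γ with hδ
  have hδ0 : 0 < δ := by positivity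
  set C := √δ ^ (2 - critExp N) with hC
  have hγp : γ * critExp N = (N : ℕ) := by
    rw [critExp, hγ]; field_simp
  have hγ2 : γ * 2 = (N - 2 : ℕ) := by
    rw [hγ]; push_cast [Nat.cast_sub (by omega : 2 ≤ N)]; ring
  -- if the constant `E` were not zero, `1/t` would be integrable at infinity: the mixed term of the
  -- Pohozaev quantity is bounded by Young's inequality, with `δ` such that half of `|E|` is left
  have key : ∀ t ∈ Ioi (1 : ℝ), ‖(t : ℝ)⁻¹‖ ≤ 2 / |E| *
      ((1 / 2 + γ / 2) * (t ^ (N - 1) * ((t ^ (N - 1))⁻¹ * y t) ^ 2) +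
        (γ / 2 * C + (critExp N)⁻¹) * (t ^ (N - 1) * |f t| ^ critExp N)) := by
    intro t ht
    have ht0 : (0 : ℝ) < t := one_pos.trans ht
    have hpow : t ^ N = t ^ (N - 1) * t := by
      rw [← pow_succ]; congr 1; omega
    have hpow2 : t ^ (N - 1) = t ^ (N - 2) * t := by
      rw [← pow_succ]; congr 1; omega
    set Y := t ^ γ * |f t| with hY
    have hY0 : 0 ≤ Y := by positivity
    have e1 : Y ^ critExp N = t ^ N * |f t| ^ critExp N := by
      rw [hY, Real.mul_rpow (by positivity) (abs_nonneg _), ← Real.rpow_mul ht0.le, hγp,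
        Real.rpow_natCast]
    have e2 : Y ^ 2 = t ^ (N - 2) * f t ^ 2 := by
      rw [hY, mul_pow, sq_abs, ← Real.rpow_two, ← Real.rpow_mul ht0.le, hγ2, Real.rpow_natCast]
    have e3 := sq_le_add_mul_rpow h2p hδ0 hY0
    rw [← hC, e1, e2] at e3
    set g := (t ^ (N - 1))⁻¹ * y t with hg
    have hyg : y t = t ^ (N - 1) * g := by
      rw [hg, mul_inv_cancel_left₀ (by positivity)]
    have e4 : pohozaev N f y t = t ^ N * g ^ 2 / 2 + γ * (t ^ (N - 1) * (f t * g)) +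
        t ^ N * |f t| ^ critExp N / critExp N := by
      rw [pohozaev, hyg, hpow, ← hγ]
      field_simp
    have e5 : |t ^ (N - 1) * (f t * g)| ≤ (t ^ N * g ^ 2 + t ^ (N - 2) * f t ^ 2) / 2 := by
      have hq : (0 : ℝ) < t ^ (N - 2) := by positivity
      have e6 : t ^ (N - 1) * (f t * g) = t ^ (N - 2) * (f t * (t * g)) := by rw [hpow2]; ring
      have e7 : t ^ N * g ^ 2 = t ^ (N - 2) * (t * g) ^ 2 := by rw [hpow, hpow2]; ring
      rw [e6, e7, abs_mul, abs_of_pos hq]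
      have e8 : |f t * (t * g)| ≤ ((t * g) ^ 2 + f t ^ 2) / 2 := by
        rw [abs_le]
        constructor <;> nlinarith [sq_nonneg (f t + t * g), sq_nonneg (f t - t * g)]
      have := mul_le_mul_of_nonneg_left e8 hq.le
      linarith
    have e9 : |E| ≤ t ^ N * g ^ 2 / 2 + γ * ((t ^ N * g ^ 2 +
        (δ + C * (t ^ N * |f t| ^ critExp N))) / 2) + t ^ N * |f t| ^ critExp N / critExp N := by
      rw [← hconst t ht0, e4]
      refine (abs_add_le _ _).trans (add_le_add ((abs_add_le _ _).trans (add_le_add ?_ ?_)) ?_)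
      · rw [abs_of_nonneg (by positivity)]
      · rw [abs_mul, abs_of_pos hγ0]
        refine mul_le_mul_of_nonneg_left (e5.trans ?_) hγ0.le
        linarith
      · rw [abs_of_nonneg (by positivity)]
    have e10 : γ * δ = |E| := by rw [hδ]; field_simp
    have e11 : |E| / 2 ≤ ((1 / 2 + γ / 2) * (t ^ (N - 1) * g ^ 2) +
        (γ / 2 * C + (critExp N)⁻¹) * (t ^ (N - 1) * |f t| ^ critExp N)) * t := by
      rw [hpow] at e9
      have : t ^ (N - 1) * t * |f t| ^ critExp N / critExp N =
        (critExp N)⁻¹ * (t ^ (N - 1) * |f t| ^ critExp N) * t := by field_simp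
      rw [this] at e9
      linarith
    rw [Real.norm_of_nonneg (by positivity)]
    rw [inv_le_iff_one_le_mul₀ ht0]
    calc (1 : ℝ) = 2 / |E| * (|E| / 2) := by field_simp
      _ ≤ _ := mul_le_mul_of_nonneg_left e11 (by positivity)
      _ = _ := by ring
  have hsub : Ioi (1 : ℝ) ⊆ Ioi 0 := Ioi_subset_Ioi zero_le_one
  have hi1 := (integrable_radMeas_iff.1 hfi).mono_set hsub
  have hi2 := (integrable_radMeas_iff.1 hyi).mono_set hsub
  refine not_integrableOn_Ioi_inv (a := 1) ?_
  refine (((hi2.const_mul (1 / 2 + γ / 2)).add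
    (hi1.const_mul (γ / 2 * C + (critExp N)⁻¹))).const_mul (2 / |E|)).mono'
    (Measurable.aestronglyMeasurable (by fun_prop)) ?_
  filter_upwards [ae_restrict_mem measurableSet_Ioi] with t ht
  exact key t ht

/-- Where a solution is positive, `f^{-2/(N-2)}` is a quadratic polynomial in `r`; this is the
(constant) coefficient of `r²`, up to a constant factor. -/
def quadCoeff (N : ℕ) (f y : ℝ → ℝ) (r : ℝ) : ℝ :=
  f r ^ (-(critExp N / 2)) * y r * (r ^ N)⁻¹

theorem hasDerivAt_quadCoeff (hN : 3 ≤ N) (h : IsRadialSolution N f y) {r : ℝ} (hr : 0 < r)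
    (hE : pohozaev N f y r = 0) (hf0 : 0 < f r) : HasDerivAt (quadCoeff N f y) 0 r := by
  have h3 : (3 : ℝ) ≤ N := by exact_mod_cast hN
  have h2 : (N : ℝ) - 2 ≠ 0 := by linarith
  have hN0 : (N : ℝ) ≠ 0 := by linarith
  have hf := h.hasDerivAt_fun r hr
  have hy := h.hasDerivAt_flux r hr
  have hpow : r ^ N = r ^ (N - 1) * r := by
    rw [← pow_succ]; congr 1; omega
  have d := ((hf.rpow_const (p := -(critExp N / 2)) (Or.inl hf0.ne')).fun_mul hy).fun_mul
    ((hasDerivAt_pow N r).fun_inv (pow_ne_zero N hr.ne'))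
  refine d.congr_deriv ?_
  have e1 : f r ^ (-(critExp N / 2)) = f r ^ (-(critExp N / 2) - 1) * f r := by
    nth_rw 3 [← Real.rpow_one (f r)]
    rw [← Real.rpow_add hf0, sub_add_cancel]
  have hp' : critExp N = 2 * N / ((N : ℝ) - 2) := rfl
  rw [pohozaev, ← abs_rpow_mul_self hN (f r), hpow] at hE
  rw [e1, hpow]
  set P := r ^ (N - 1) with hP
  have hP0 : 0 < P := by positivity
  set A := |f r| ^ (critExp N - 2) with hA
  set Z := f r ^ (-(critExp N / 2) - 1) with hZ
  -- the derivative of `quadCoeff` is a multiple of the Pohozaev quantity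
  have e2 : (((P⁻¹ * y r) * -(critExp N / 2) * Z) * y r + Z * f r * -(P * (A * f r))) *
      (P * r)⁻¹ + Z * f r * y r * (-(N * P) / (P * r) ^ 2) =
      -(Z * critExp N * (P * r * r)⁻¹) * (r ^ 2 * (P * r)⁻¹ * y r ^ 2 / 2 +
        ((N : ℝ) - 2) / 2 * (f r * y r) + P * r * (A * f r * f r) / critExp N) := by
    rw [hp']
    field_simp
    ring
  rw [e2, hE, mul_zero]

/-- Where a solution is positive, the vanishing of the Pohozaev quantity determines it through its
coefficient `quadCoeff`. -/
theorem eq_bubbleProfile_of_quadCoeff (hN : 3 ≤ N) {r : ℝ} (hr : 0 < r)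
    (hE : pohozaev N f y r = 0) (hf0 : 0 < f r) :
    quadCoeff N f y r < 0 ∧
      f r = bubbleProfile N (-√(N * ((N : ℝ) - 2)) / (N * quadCoeff N f y r)) r := by
  have h3 : (3 : ℝ) ≤ N := by exact_mod_cast hN
  have h2 : (0 : ℝ) < (N : ℝ) - 2 := by linarith
  have hp := critExp_pos hN
  have hp' : critExp N = 2 * N / ((N : ℝ) - 2) := rfl
  have hN0 : (0 : ℝ) < N := by linarith
  set s := critExp N / 2 with hs
  have hs' : s = N / ((N : ℝ) - 2) := by rw [hs, hp']; field_simp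
  set κ := quadCoeff N f y r with hκ
  have hQ0 : (0 : ℝ) < r ^ N := by positivity
  have hy : y r = κ * r ^ N * f r ^ s := by
    rw [hκ, quadCoeff, ← hs, Real.rpow_neg hf0.le]
    have : 0 < f r ^ s := by positivity
    field_simp
  set F := f r ^ s with hF
  have hF0 : 0 < F := by positivity
  set W := f r ^ (1 - s) with hW
  have hW0 : 0 < W := by positivity
  have hWF : f r = W * F := by
    rw [hW, hF, ← Real.rpow_add hf0, sub_add_cancel, Real.rpow_one]
  have hFF : |f r| ^ critExp N = F ^ 2 := by
    rw [abs_of_pos hf0, hF, ← Real.rpow_two, ← Real.rpow_mul hf0.le]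
    congr 1; rw [hs]; ring
  -- the Pohozaev identity divided by `r^N f^{2*}`, affine in `W = f^{-2/(N-2)}` and in `r²`
  have e1 : r ^ 2 * κ ^ 2 / 2 + ((N : ℝ) - 2) / 2 * (κ * W) + (critExp N)⁻¹ = 0 := by
    rw [pohozaev, hFF, hy] at hE
    have e2 : r ^ 2 * (r ^ N)⁻¹ * (κ * r ^ N * F) ^ 2 / 2 +
        ((N : ℝ) - 2) / 2 * (f r * (κ * r ^ N * F)) + r ^ N * F ^ 2 / critExp N =
        r ^ N * F ^ 2 * (r ^ 2 * κ ^ 2 / 2 + ((N : ℝ) - 2) / 2 * (κ * W) + (critExp N)⁻¹) := by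
      rw [hWF]
      field_simp
    rw [e2] at hE
    exact (mul_eq_zero.1 hE).resolve_left (by positivity)
  have hκ0 : κ < 0 := by
    by_contra hge
    have hge' : 0 ≤ κ := not_lt.1 hge
    have : 0 < r ^ 2 * κ ^ 2 / 2 + ((N : ℝ) - 2) / 2 * (κ * W) + (critExp N)⁻¹ := by positivity
    exact this.ne' e1
  refine ⟨hκ0, ?_⟩
  set q := √(N * ((N : ℝ) - 2)) with hq
  have hq0 : 0 < q := Real.sqrt_pos.2 (by positivity)
  have hqq : q ^ 2 = N * ((N : ℝ) - 2) := Real.sq_sqrt (by positivity)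
  set ε := -q / (N * κ) with hε
  have hε0 : 0 < ε := div_pos_of_neg_of_neg (by linarith) (mul_neg_of_pos_of_neg hN0 hκ0)
  have hb : 0 < ε ^ 2 + r ^ 2 := by positivity
  have ha := bubbleConst_pos hN
  have hB0 : 0 < bubbleProfile N ε r := by
    unfold bubbleProfile; positivity
  have e3 : bubbleProfile N ε r ^ (1 - s) = (ε ^ 2 + r ^ 2) / (q * ε) := by
    have h1s : 1 - s = -(2 / ((N : ℝ) - 2)) := by rw [hs']; field_simp; ring
    have hM : (0 : ℝ) < N * ((N : ℝ) - 2) := by positivity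
    rw [bubbleProfile, Real.mul_rpow (by positivity) (by positivity),
      Real.mul_rpow ha.le (by positivity), ← Real.rpow_mul hε0.le, ← Real.rpow_mul hb.le,
      bubbleConst, ← Real.rpow_mul hM.le]
    have t1 : ((N : ℝ) - 2) / 4 * (1 - s) = -(1 / 2) := by rw [h1s]; field_simp; norm_num
    have t2 : ((N : ℝ) - 2) / 2 * (1 - s) = -1 := by rw [h1s]; field_simp
    have t3 : -((N : ℝ) - 2) / 2 * (1 - s) = 1 := by rw [h1s]; field_simp
    rw [t1, t2, t3, Real.rpow_one, Real.rpow_neg_one, Real.rpow_neg hM.le, ← Real.sqrt_eq_rpow,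
      ← hq]
    field_simp
  have e4 : W = (ε ^ 2 + r ^ 2) / (q * ε) := by
    have e5 : κ * W = -(2 / ((N : ℝ) - 2)) * (r ^ 2 * κ ^ 2 / 2 + (critExp N)⁻¹) := by
      field_simp
      field_simp at e1
      linarith
    have e6 : (ε ^ 2 + r ^ 2) / (q * ε) = -(q ^ 2 + r ^ 2 * (N * κ) ^ 2) / (q ^ 2 * (N * κ)) := by
      rw [hε]
      have := hκ0.ne
      field_simp
    rw [e6, hqq]
    refine mul_left_cancel₀ hκ0.ne ?_
    rw [e5, hp']
    have := hκ0.ne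
    field_simp
    ring
  rw [← e4, hW] at e3
  have h1s : 1 - s ≠ 0 := by
    have : 1 - s = -(2 / ((N : ℝ) - 2)) := by rw [hs']; field_simp; ring
    rw [this]
    exact neg_ne_zero.2 (by positivity)
  exact ((Real.rpow_left_inj hB0.le hf0.le h1s).1 e3).symm

/-- A solution of the radial equation whose Pohozaev quantity vanishes and which is positive somewhere
is a bubble. -/
theorem IsRadialSolution.eq_bubbleProfile (hN : 3 ≤ N) (h : IsRadialSolution N f y)
    (hE : ∀ r, 0 < r → pohozaev N f y r = 0) {r₀ : ℝ} (hr₀ : 0 < r₀) (hf₀ : 0 < f r₀) :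
    ∃ ε, 0 < ε ∧ ∀ r, 0 < r → f r = bubbleProfile N ε r := by
  have h3 : (3 : ℝ) ≤ N := by exact_mod_cast hN
  have h2 : (0 : ℝ) < (N : ℝ) - 2 := by linarith
  have hN0 : (0 : ℝ) < N := by linarith
  have ha := bubbleConst_pos hN
  set κ := quadCoeff N f y r₀ with hκ
  have hκ0 : κ < 0 := (eq_bubbleProfile_of_quadCoeff hN hr₀ (hE r₀ hr₀) hf₀).1
  set ε := -√(N * ((N : ℝ) - 2)) / (N * κ) with hε
  have hε0 : 0 < ε := div_pos_of_neg_of_neg (neg_lt_zero.2 (Real.sqrt_pos.2 (by positivity)))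
    (mul_neg_of_pos_of_neg hN0 hκ0)
  set S : Set ℝ := {r | 0 < r ∧ 0 < f r ∧ quadCoeff N f y r = κ} with hS
  have hfc : ∀ r, 0 < r → ContinuousAt f r := fun r hr => (h.hasDerivAt_fun r hr).continuousAt
  have hval : ∀ r ∈ S, f r = bubbleProfile N ε r := fun r hr => by
    have := (eq_bubbleProfile_of_quadCoeff hN hr.1 (hE r hr.1) hr.2.1).2
    rwa [hr.2.2] at this
  -- `S` is open since `quadCoeff` is locally constant, and relatively closed since the bubble does
  -- not vanish
  have hopen : IsOpen S := by
    rw [Metric.isOpen_iff]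
    intro r hr
    have h4 : ∀ᶠ t in 𝓝 r, 0 < t ∧ 0 < f t :=
      (lt_mem_nhds hr.1).and ((hfc r hr.1).eventually (lt_mem_nhds hr.2.1))
    obtain ⟨η, hη, hηs⟩ := Metric.eventually_nhds_iff_ball.1 h4
    refine ⟨η, hη, fun t ht => ⟨(hηs t ht).1, (hηs t ht).2, ?_⟩⟩
    have hd : ∀ s ∈ Metric.ball r η, HasDerivAt (quadCoeff N f y) 0 s := fun s hs =>
      hasDerivAt_quadCoeff hN h (hηs s hs).1 (hE s (hηs s hs).1) (hηs s hs).2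
    rw [← hr.2.2]
    exact Metric.isOpen_ball.is_const_of_deriv_eq_zero (convex_ball r η).isPreconnected
      (fun s hs => (hd s hs).differentiableAt.differentiableWithinAt)
      (fun s hs => (hd s hs).deriv) ht (Metric.mem_ball_self hη)
  have hclosed : closure S ∩ Ioi 0 ⊆ S := by
    rintro r ⟨hrc, hr⟩
    obtain ⟨t, ht, htr⟩ := mem_closure_iff_seq_limit.1 hrc
    have hbc : ContinuousAt (bubbleProfile N ε) r := by
      have hb : ε ^ 2 + r ^ 2 ≠ 0 := by positivity
      exact continuousAt_const.mul ((continuousAt_const.add (continuousAt_id.pow 2)).rpow_const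
        (Or.inl hb))
    have h5 : f r = bubbleProfile N ε r := by
      refine tendsto_nhds_unique ((hfc r hr).tendsto.comp htr) ?_
      refine (hbc.tendsto.comp htr).congr fun n => ?_
      exact (hval _ (ht n)).symm
    have h6 : 0 < f r := by
      rw [h5]; unfold bubbleProfile; positivity
    refine ⟨hr, h6, ?_⟩
    have h7 := (hasDerivAt_quadCoeff hN h hr (hE r hr) h6).continuousAt
    refine tendsto_nhds_unique (h7.tendsto.comp htr) ?_
    refine tendsto_const_nhds.congr fun n => ?_
    exact (ht n).2.2.symm
  have hall : Ioi 0 ⊆ S := isPreconnected_Ioi.subset_of_closure_inter_subset hopen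
    ⟨r₀, hr₀, hr₀, hf₀, rfl⟩ hclosed
  exact ⟨ε, hε0, fun r hr => hval r (hall hr)⟩

end

/-! ### Radial solutions of the Neumann problem -/

section

variable {N : ℕ} {ω : Set (EuclideanSpace ℝ (Fin N))}

theorem contDiff_comp_norm {ψ : ℝ → ℝ} (hψ : ContDiff ℝ ((⊤ : ℕ∞) : WithTop ℕ∞) ψ)
    (hs : tsupport ψ ⊆ Ioi 0) :
    ContDiff ℝ 1 (fun x : EuclideanSpace ℝ (Fin N) => ψ ‖x‖) := by
  have h := contDiff_conicTest (N := N) (n := 1) (η := fun _ => 1) contDiff_const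
    (hψ.of_le (by simp)) hs
  have e : conicTest (fun _ => 1) ψ = fun x : EuclideanSpace ℝ (Fin N) => ψ ‖x‖ := by
    ext x; simp [conicTest]
  rwa [e] at h

theorem gradient_comp_norm {ψ : ℝ → ℝ} (hψ : ContDiff ℝ ((⊤ : ℕ∞) : WithTop ℕ∞) ψ)
    {x : EuclideanSpace ℝ (Fin N)} (hx : x ≠ 0) :
    gradient (fun x : EuclideanSpace ℝ (Fin N) => ψ ‖x‖) x = ((‖x‖ ^ 1)⁻¹ * deriv ψ ‖x‖) • x := by
  have hn : 0 < ‖x‖ := norm_pos_iff.2 hx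
  have h1 : HasDerivAt (fun s => ψ (√s)) (deriv ψ ‖x‖ * (1 / (2 * ‖x‖))) (‖x‖ ^ 2) := by
    have h2 := Real.hasDerivAt_sqrt (x := ‖x‖ ^ 2) (by positivity)
    rw [Real.sqrt_sq hn.le] at h2
    have h3 : HasDerivAt ψ (deriv ψ ‖x‖) (√(‖x‖ ^ 2)) := by
      rw [Real.sqrt_sq hn.le]
      exact (hψ.differentiable (by simp) _).hasDerivAt
    exact h3.comp (‖x‖ ^ 2) h2
  have h4 := hasFDerivAt_comp_norm_sq h1
  have e : (fun y : EuclideanSpace ℝ (Fin N) => ψ (√(‖y‖ ^ 2))) = fun y => ψ ‖y‖ := by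
    ext y; rw [Real.sqrt_sq (norm_nonneg y)]
  simp only [e] at h4
  refine ext_inner_right ℝ fun v => ?_
  rw [inner_gradient, h4.fderiv, inner_smul_left]
  simp only [_root_.smul_apply, innerSL_apply_apply, smul_eq_mul,
    RCLike.conj_to_real]
  field_simp

theorem mem_D12_of_contDiff {Ω : Set (EuclideanSpace ℝ (Fin N))} (hΩ : IsOpen Ω)
    {u : EuclideanSpace ℝ (Fin N) → ℝ} (hu : ContDiff ℝ 1 u) (hc : HasCompactSupport u) :
    u ∈ D12 Ω := by
  have hgc : HasCompactSupport (gradient u) :=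
    (hc.fderiv (𝕜 := ℝ)).comp_left (map_zero _)
  exact mem_D12_of_isWeakGradient hΩ ((hu.continuous.memLp_of_hasCompactSupport hc).restrict _)
    (isWeakGradient_of_contDiff hu)
    (((continuous_gradient hu).memLp_of_hasCompactSupport hgc).restrict _)

/-- Radial solutions of the Neumann problem on a cone solve the radial equation. -/
theorem IsNeumannSolution.exists_radialSolution (hN : 3 ≤ N) (hω : IsOpenInSphere ω)
    (hne : ω.Nonempty) {u : EuclideanSpace ℝ (Fin N) → ℝ} (hu : IsNeumannSolution (openCone ω) u)
    (hr : IsRadialOn (openCone ω) u) :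
    ∃ f y : ℝ → ℝ, IsRadialSolution N f y ∧
      (∀ᵐ x ∂(volume.restrict (openCone ω)), u x = f ‖x‖) ∧
      Integrable (fun r => |f r| ^ critExp N) (radMeas N) ∧
      Integrable (fun r => ((r ^ (N - 1))⁻¹ * y r) ^ 2) (radMeas N) := by
  have hpos := angMass_pos (by omega) hω hne
  have h2p := two_lt_critExp hN
  obtain ⟨f, H, c, hm, hHl, hf, huf, hfi, hHi, -, hkey⟩ := exists_radial_data hN hω hne hu.1 hr
  have hac : radMeas N ≪ volume.restrict (Ioi 0) := withDensity_absolutelyContinuous _ _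
  have hfc : ContinuousOn f (Ioi 0) := by
    rw [show f = _ from funext hf]
    exact continuousOn_const.add (continuousOn_primitive_Ioi hHl)
  have hNc : ContinuousOn (fun r => |f r| ^ (critExp N - 2) * f r) (Ioi 0) :=
    (hfc.abs.rpow_const fun _ _ => Or.inr (by linarith)).mul hfc
  have hqc : ContinuousOn (fun r => -(r ^ (N - 1) * (|f r| ^ (critExp N - 2) * f r))) (Ioi 0) :=
    ((continuousOn_id.pow _).mul hNc).neg
  have hpl : LocallyIntegrableOn (fun r => r ^ (N - 1) * H r) (Ioi 0) :=
    hHl.continuousOn_mul (continuousOn_id.pow _) isOpen_Ioi.isLocallyClosed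
  -- the flux `r^{N-1} H` is a primitive of the nonlinearity: test with radial functions `ψ(|x|)`
  obtain ⟨c', hc'⟩ := exists_ae_eq_primitive hpl (hqc.locallyIntegrableOn measurableSet_Ioi)
    fun ψ hψ hψc hψs => by
    have hφd := contDiff_comp_norm (N := N) hψ hψs
    have hφc := hasCompactSupport_comp_norm (N := N) hψc
    have h1 := hu.2 _ (mem_D12_of_contDiff hω.isOpen_openCone hφd hφc)
    have hkd := contDiff_inv_pow_mul (contDiff_infty_iff_deriv.1 hψ).2
      (tsupport_deriv_subset.trans hψs) 1
    have hkc : HasCompactSupport (fun r => (r ^ 1)⁻¹ * deriv ψ r) := hψc.deriv.mul_left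
    have e1 : ∫ x in openCone ω, inner ℝ (weakGrad (openCone ω) u x)
        (weakGrad (openCone ω) (fun x => ψ ‖x‖) x) =
        angMass ω * ∫ r in Ioi 0, r ^ (N - 1) * H r * deriv ψ r := by
      have e2 := hkey _ (integrable_inner_mul_radial hu.1.2.2 hkd.continuous hkc)
      rw [integral_radMeas] at e2
      have e3 : ∫ r in Ioi 0, r ^ (N - 1) * (r * H r * ((r ^ 1)⁻¹ * deriv ψ r)) =
          ∫ r in Ioi 0, r ^ (N - 1) * H r * deriv ψ r := by
        refine setIntegral_congr_fun measurableSet_Ioi fun r hr => ?_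
        have hr0 : r ≠ 0 := ne_of_gt hr
        field_simp
      rw [← e3, ← e2]
      refine integral_congr_ae ?_
      filter_upwards [(isWeakGradient_of_contDiff hφd).weakGrad_ae_eq hω.isOpen_openCone,
        ae_openCone_ne_zero hω] with x hx h0
      rw [hx, gradient_comp_norm hψ h0, inner_smul_right, mul_comm]
    have e2 : ∫ x in openCone ω, |u x| ^ (critExp N - 2) * u x * ψ ‖x‖ =
        angMass ω * ∫ r in Ioi 0, r ^ (N - 1) * (|f r| ^ (critExp N - 2) * f r) * ψ r := by
      have hm2 : AEStronglyMeasurable (fun r => |f r| ^ (critExp N - 2) * f r * ψ r) (radMeas N) :=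
        ((hNc.mul hψ.continuous.continuousOn).aestronglyMeasurable measurableSet_Ioi).mono_ac hac
      have e3 := integral_openCone_norm hω hm2
      rw [integral_radMeas] at e3
      have e4 : ∫ r in Ioi 0, r ^ (N - 1) * (|f r| ^ (critExp N - 2) * f r * ψ r) =
          ∫ r in Ioi 0, r ^ (N - 1) * (|f r| ^ (critExp N - 2) * f r) * ψ r :=
        integral_congr_ae (ae_of_all _ fun r => by ring)
      rw [← e4, ← e3]
      refine integral_congr_ae ?_
      filter_upwards [huf] with x hx
      rw [hx]
    rw [e1, e2] at h1
    have h2 := mul_left_cancel₀ hpos.ne' h1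
    rw [h2, ← integral_neg]
    exact integral_congr_ae (ae_of_all _ fun r => by ring)
  set y : ℝ → ℝ := fun r =>
    c' + ∫ t in (1 : ℝ)..r, -(t ^ (N - 1) * (|f t| ^ (critExp N - 2) * f t)) with hy
  have hyd : ∀ r, 0 < r →
      HasDerivAt y (-(r ^ (N - 1) * (|f r| ^ (critExp N - 2) * f r))) r := fun r hr =>
    (hasDerivAt_primitive_Ioi hqc hr).const_add c'
  have hHy : ∀ᵐ r, r ∈ Ioi (0 : ℝ) → H r = (r ^ (N - 1))⁻¹ * y r := by
    filter_upwards [hc'] with r h1 hr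
    have hr0 : (0 : ℝ) < r := hr
    rw [hy]
    simp only
    rw [← h1 hr, inv_mul_cancel_left₀ (by positivity)]
  have hgc : ContinuousOn (fun r => (r ^ (N - 1))⁻¹ * y r) (Ioi 0) := fun r hr => by
    have hr0 : (0 : ℝ) < r := hr
    exact (((continuousAt_id.pow (N - 1)).inv₀ (by simp [hr0.ne'])).mul
      (hyd r hr).continuousAt).continuousWithinAt
  have hf' : ∀ r, 0 < r → f r = c + ∫ t in (1 : ℝ)..r, (t ^ (N - 1))⁻¹ * y t := fun r hr => by
    rw [hf]
    congr 1
    refine intervalIntegral.integral_congr_ae ?_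
    filter_upwards [hHy] with t ht ht'
    exact ht ((lt_min one_pos hr).trans ht'.1)
  refine ⟨f, y, ⟨fun r hr => ?_, hyd⟩, huf, hfi, hHi.congr ?_⟩
  · refine ((hasDerivAt_primitive_Ioi hgc hr).const_add c).congr_of_eventuallyEq ?_
    filter_upwards [Ioi_mem_nhds hr] with t ht using hf' t ht
  · refine hac.ae_le ?_
    refine (ae_restrict_iff' measurableSet_Ioi).2 ?_
    filter_upwards [hHy] with r h1 hr
    rw [h1 hr]

theorem IsNeumannSolution.congr {Ω : Set (EuclideanSpace ℝ (Fin N))} (hΩ : IsOpen Ω)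
    {u v : EuclideanSpace ℝ (Fin N) → ℝ} (hu : IsNeumannSolution Ω u)
    (huv : u =ᵐ[volume.restrict Ω] v) : IsNeumannSolution Ω v := by
  have hw := (IsWeakGradient.weakGrad hu.1.2.1).congr huv
  have hg := hw.weakGrad_ae_eq hΩ
  refine ⟨mem_D12_of_isWeakGradient hΩ ((memLp_congr_ae huv).1 hu.1.1) hw hu.1.2.2, fun φ hφ => ?_⟩
  have e1 : ∫ x in Ω, inner ℝ (weakGrad Ω v x) (weakGrad Ω φ x) =
      ∫ x in Ω, inner ℝ (weakGrad Ω u x) (weakGrad Ω φ x) := by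
    refine integral_congr_ae ?_
    filter_upwards [hg] with x hx
    rw [hx]
  rw [e1, hu.2 φ hφ]
  refine integral_congr_ae ?_
  filter_upwards [huv] with x hx
  rw [hx]

theorem IsWeakGradient.neg {Ω : Set (EuclideanSpace ℝ (Fin N))}
    {u : EuclideanSpace ℝ (Fin N) → ℝ} {G : EuclideanSpace ℝ (Fin N) → EuclideanSpace ℝ (Fin N)}
    (h : IsWeakGradient Ω u G) : IsWeakGradient Ω (fun x => -u x) (fun x => -G x) := by
  refine ⟨h.locallyIntegrable_fun.neg, h.locallyIntegrable_grad.neg, fun φ h1 h2 h3 v => ?_⟩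
  simp only [neg_mul, inner_neg_left, integral_neg]
  rw [h.integral_by_parts φ h1 h2 h3 v]

theorem IsNeumannSolution.neg {Ω : Set (EuclideanSpace ℝ (Fin N))} (hΩ : IsOpen Ω)
    {u : EuclideanSpace ℝ (Fin N) → ℝ} (hu : IsNeumannSolution Ω u) :
    IsNeumannSolution Ω (fun x => -u x) := by
  have hw := (IsWeakGradient.weakGrad hu.1.2.1).neg
  have hg := hw.weakGrad_ae_eq hΩ
  refine ⟨mem_D12_of_isWeakGradient hΩ hu.1.1.neg hw hu.1.2.2.neg, fun φ hφ => ?_⟩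
  have e1 : ∫ x in Ω, inner ℝ (weakGrad Ω (fun x => -u x) x) (weakGrad Ω φ x) =
      ∫ x in Ω, -inner ℝ (weakGrad Ω u x) (weakGrad Ω φ x) := by
    refine integral_congr_ae ?_
    filter_upwards [hg] with x hx
    rw [hx, inner_neg_left]
  rw [e1, integral_neg, hu.2 φ hφ, ← integral_neg]
  refine integral_congr_ae (ae_of_all _ fun x => ?_)
  simp only [abs_neg]
  ring

/-- The nontrivial radial solutions of the Neumann problem are the bubbles, up to sign. -/
theorem isNeumannSolution_radial_iff (hN : 3 ≤ N) (hω : IsOpenInSphere ω) (hne : ω.Nonempty)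
    (u : EuclideanSpace ℝ (Fin N) → ℝ) :
    (IsNeumannSolution (openCone ω) u ∧ IsRadialOn (openCone ω) u ∧ Nontrivial (openCone ω) u) ↔
      ∃ ε : ℝ, 0 < ε ∧
        ((∀ᵐ x ∂(volume.restrict (openCone ω)), u x = bubble ε x) ∨
          (∀ᵐ x ∂(volume.restrict (openCone ω)), u x = - bubble ε x)) := by
  have ho := hω.isOpen_openCone
  constructor
  · rintro ⟨hu, hr, h0⟩
    obtain ⟨f, y, hsol, huf, hfi, hyi⟩ := hu.exists_radialSolution hN hω hne hr
    obtain ⟨r₀, hr₀, hfr₀⟩ : ∃ r, 0 < r ∧ f r ≠ 0 := by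
      by_contra! hcon
      refine h0 ?_
      filter_upwards [huf, ae_openCone_ne_zero hω] with x hx hx0
      rw [hx, hcon _ (norm_pos_iff.2 hx0)]
      rfl
    rcases lt_or_gt_of_ne hfr₀ with hlt | hgt
    · have hE := fun r hr => pohozaev_eq_zero hN hsol.neg (by simpa using hfi)
        (by simpa using hyi) (r := r) hr
      obtain ⟨ε, hε, h⟩ := hsol.neg.eq_bubbleProfile hN hE hr₀ (neg_pos.2 hlt)
      refine ⟨ε, hε, Or.inr ?_⟩
      filter_upwards [huf, ae_openCone_ne_zero hω] with x hx hx0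
      rw [hx, bubble_eq_profile hε, ← h _ (norm_pos_iff.2 hx0), neg_neg]
    · have hE := fun r hr => pohozaev_eq_zero hN hsol hfi hyi (r := r) hr
      obtain ⟨ε, hε, h⟩ := hsol.eq_bubbleProfile hN hE hr₀ hgt
      refine ⟨ε, hε, Or.inl ?_⟩
      filter_upwards [huf, ae_openCone_ne_zero hω] with x hx hx0
      rw [hx, bubble_eq_profile hε, h _ (norm_pos_iff.2 hx0)]
  · rintro ⟨ε, hε, h⟩
    have hb := isNeumannSolution_bubble hN hω hε
    have hb0 := nontrivial_bubble hN (volume_openCone_ne_zero hω hne) hε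
    rcases h with h | h
    · have h' : bubble ε =ᵐ[volume.restrict (openCone ω)] u := by
        filter_upwards [h] with x hx using hx.symm
      refine ⟨hb.congr ho h', ⟨bubbleProfile N ε, ?_⟩, fun hz => hb0 (h'.trans hz)⟩
      filter_upwards [h] with x hx
      rw [hx, bubble_eq_profile hε]
    · have h' : (fun x => -bubble ε x) =ᵐ[volume.restrict (openCone ω)] u := by
        filter_upwards [h] with x hx using hx.symm
      refine ⟨(hb.neg ho).congr ho h', ⟨fun r => -bubbleProfile N ε r, ?_⟩, fun hz => hb0 ?_⟩
      · filter_upwards [h] with x hx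
        rw [hx, bubble_eq_profile hε]
      · filter_upwards [h, hz] with x hx hx0
        rw [hx] at hx0
        simpa using hx0

end

/-! ### The Sobolev inequality on `D^{1,2}(ℝ^N)` -/

section

variable {N : ℕ} {v : EuclideanSpace ℝ (Fin N) → ℝ}
  {G : EuclideanSpace ℝ (Fin N) → EuclideanSpace ℝ (Fin N)}

/-- Jensen's inequality for a probability density. -/
theorem sq_integral_mul_le {X : Type*} [MeasurableSpace X] {μ : Measure X} {w g : X → ℝ}
    (hw0 : ∀ t, 0 ≤ w t) (hw : Integrable w μ) (hw1 : ∫ t, w t ∂μ = 1)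
    (h1 : Integrable (fun t => w t * g t) μ) (h2 : Integrable (fun t => w t * g t ^ 2) μ) :
    (∫ t, w t * g t ∂μ) ^ 2 ≤ ∫ t, w t * g t ^ 2 ∂μ := by
  set m := ∫ t, w t * g t ∂μ with hm
  have h3 : 0 ≤ ∫ t, w t * (g t - m) ^ 2 ∂μ :=
    integral_nonneg fun t => mul_nonneg (hw0 t) (sq_nonneg _)
  have e : ∀ t, w t * (g t - m) ^ 2 = w t * g t ^ 2 - 2 * m * (w t * g t) + m ^ 2 * w t :=
    fun t => by ring
  simp_rw [e] at h3
  have h4 : Integrable (fun t => w t * g t ^ 2 - 2 * m * (w t * g t)) μ := h2.sub (h1.const_mul _)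
  rw [integral_add h4 (hw.const_mul _), integral_sub h2 (h1.const_mul _), integral_const_mul,
    integral_const_mul, hw1, ← hm] at h3
  linarith

/-- The mollification of `v` by the kernel `ρ`. -/
def mollify (ρ v : EuclideanSpace ℝ (Fin N) → ℝ) : EuclideanSpace ℝ (Fin N) → ℝ :=
  convolution v ρ (ContinuousLinearMap.lsmul ℝ ℝ) volume

theorem mollify_apply (ρ v : EuclideanSpace ℝ (Fin N) → ℝ) (x : EuclideanSpace ℝ (Fin N)) :
    mollify ρ v x = ∫ t, v t * ρ (x - t) := rfl

/-- The gradient of a mollification is bounded by the mollification of the norm of the gradient. -/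
theorem norm_fderiv_mollify_le (hG : IsWeakGradient univ v G)
    {ρ : EuclideanSpace ℝ (Fin N) → ℝ} (hρ : ContDiff ℝ ((⊤ : ℕ∞) : WithTop ℕ∞) ρ)
    (hρc : HasCompactSupport ρ) (hρ0 : ∀ x, 0 ≤ ρ x) (x : EuclideanSpace ℝ (Fin N)) :
    ‖fderiv ℝ (mollify ρ v) x‖ ≤ ∫ t, ρ (x - t) * ‖G t‖ := by
  have hv : LocallyIntegrable v volume := locallyIntegrableOn_univ.1 hG.locallyIntegrable_fun
  have hGl : LocallyIntegrable G volume := locallyIntegrableOn_univ.1 hG.locallyIntegrable_grad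
  have h1 : HasFDerivAt (mollify ρ v) _ x :=
    hρc.hasFDerivAt_convolution_right (ContinuousLinearMap.lsmul ℝ ℝ) hv (hρ.of_le (by simp)) x
  set φ : EuclideanSpace ℝ (Fin N) → ℝ := fun t => ρ (x - t) with hφ
  have hφd : ContDiff ℝ ((⊤ : ℕ∞) : WithTop ℕ∞) φ := hρ.comp (contDiff_const.sub contDiff_id)
  have hφc : HasCompactSupport φ := hρc.comp_homeomorph (Homeomorph.subLeft x)
  have hi : Integrable (fun t => ρ (x - t) * ‖G t‖) := by
    have := (locallyIntegrableOn_univ.1 hG.locallyIntegrable_grad.norm).integrable_smul_left_of_hasCompactSupport hφd.continuous hφc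
    exact this
  rw [h1.fderiv]
  refine ContinuousLinearMap.opNorm_le_bound _
    (integral_nonneg fun t => mul_nonneg (hρ0 _) (norm_nonneg _)) fun w => ?_
  rw [convolution_precompR_apply _ hv (hρc.fderiv (𝕜 := ℝ)) (hρ.continuous_fderiv (by simp))]
  have h2 := hG.integral_by_parts φ hφd hφc (subset_univ _) w
  rw [setIntegral_univ, setIntegral_univ] at h2
  have h3 : ∀ t, fderiv ℝ φ t w = -fderiv ℝ ρ (x - t) w := fun t => by
    have h4 := (hρ.differentiable (by simp) (x - t)).hasFDerivAt.comp t
      ((hasFDerivAt_id t).const_sub x)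
    have h5 : fderiv ℝ φ t = _ := h4.fderiv
    rw [h5]
    simp
  have h6 : convolution v (fun a => fderiv ℝ ρ a w) (ContinuousLinearMap.lsmul ℝ ℝ) volume x =
      ∫ t, inner ℝ (G t) w * φ t := by
    rw [convolution_def]
    simp only [ContinuousLinearMap.lsmul_apply, smul_eq_mul]
    simp_rw [h3, mul_neg, integral_neg] at h2
    linarith
  rw [h6, ← integral_mul_const]
  refine (norm_integral_le_integral_norm _).trans (integral_mono_of_nonneg
    (ae_of_all _ fun t => norm_nonneg _) (hi.mul_const _) (ae_of_all _ fun t => ?_))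
  simp only
  rw [norm_mul, hφ]
  simp only
  rw [Real.norm_of_nonneg (hρ0 _), mul_comm, mul_assoc]
  exact mul_le_mul_of_nonneg_left (norm_inner_le_norm _ _) (hρ0 _)

/-- Mollification does not increase the Dirichlet integral. -/
theorem integral_norm_fderiv_mollify_sq_le (hG : IsWeakGradient univ v G)
    (hG2 : Integrable fun x => ‖G x‖ ^ 2) {ρ : EuclideanSpace ℝ (Fin N) → ℝ}
    (hρ : ContDiff ℝ ((⊤ : ℕ∞) : WithTop ℕ∞) ρ) (hρc : HasCompactSupport ρ) (hρ0 : ∀ x, 0 ≤ ρ x)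
    (hρ1 : ∫ x, ρ x = 1) :
    ∫ x, ‖fderiv ℝ (mollify ρ v) x‖ ^ 2 ≤ ∫ x, ‖G x‖ ^ 2 := by
  have hGl : LocallyIntegrable G volume := locallyIntegrableOn_univ.1 hG.locallyIntegrable_grad
  have hρi : Integrable ρ := hρ.continuous.integrable_of_hasCompactSupport hρc
  have h1 := integral_convolution (ContinuousLinearMap.lsmul ℝ ℝ) hG2 hρi
  have h2 := hG2.integrable_convolution (ContinuousLinearMap.lsmul ℝ ℝ) hρi
  rw [hρ1] at h1
  simp only [ContinuousLinearMap.lsmul_apply, smul_eq_mul, mul_one] at h1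
  rw [← h1]
  refine integral_mono_of_nonneg (ae_of_all _ fun x => sq_nonneg _) h2 (ae_of_all _ fun x => ?_)
  have hφd : Continuous fun t => ρ (x - t) := hρ.continuous.comp (by fun_prop)
  have hφc : HasCompactSupport fun t => ρ (x - t) := hρc.comp_homeomorph (Homeomorph.subLeft x)
  have h3 := norm_fderiv_mollify_le hG hρ hρc hρ0 x
  have h4 := sq_integral_mul_le (μ := volume) (w := fun t => ρ (x - t)) (g := fun t => ‖G t‖)
    (fun t => hρ0 _) (hφd.integrable_of_hasCompactSupport hφc)
    (by rw [integral_sub_left_eq_self ρ, hρ1])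
    ((locallyIntegrableOn_univ.1 hG.locallyIntegrable_grad.norm).integrable_smul_left_of_hasCompactSupport hφd hφc)
    (hG2.locallyIntegrable.integrable_smul_left_of_hasCompactSupport hφd hφc)
  refine (pow_le_pow_left₀ (norm_nonneg _) h3 2).trans (h4.trans (le_of_eq ?_))
  rw [convolution_def]
  refine integral_congr_ae (ae_of_all _ fun t => ?_)
  simp only [ContinuousLinearMap.lsmul_apply, smul_eq_mul]
  ring

theorem le_rpow_of_sobolev (hN : 3 ≤ N) {I Q : ℝ} (hI : 0 ≤ I)
    (h : sobolevConst N * I ^ (2 / critExp N) ≤ Q) : I ≤ (Q / sobolevConst N) ^ (critExp N / 2) := by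
  have hp := critExp_pos hN
  have hS := sobolevConst_pos hN
  have h1 : I ^ (2 / critExp N) ≤ Q / sobolevConst N := by
    rw [le_div_iff₀ hS]; linarith
  have h2 := Real.rpow_le_rpow (by positivity) h1 (show 0 ≤ critExp N / 2 by positivity)
  rwa [← Real.rpow_mul hI, show 2 / critExp N * (critExp N / 2) = 1 by field_simp,
    Real.rpow_one] at h2

theorem sobolev_of_le_rpow (hN : 3 ≤ N) {I Q : ℝ} (hI : 0 ≤ I) (hQ : 0 ≤ Q)
    (h : I ≤ (Q / sobolevConst N) ^ (critExp N / 2)) :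
    sobolevConst N * I ^ (2 / critExp N) ≤ Q := by
  have hp := critExp_pos hN
  have hS := sobolevConst_pos hN
  have h2 := Real.rpow_le_rpow hI h (show 0 ≤ 2 / critExp N by positivity)
  rw [← Real.rpow_mul (by positivity), show critExp N / 2 * (2 / critExp N) = 1 by field_simp,
    Real.rpow_one, le_div_iff₀ hS] at h2
  linarith

/-- The Sobolev inequality for weakly differentiable functions with compact support. -/
theorem sobolev_of_isWeakGradient_of_hasCompactSupport (hN : 3 ≤ N) (hG : IsWeakGradient univ v G)
    (hc : HasCompactSupport v) (hG2 : Integrable fun x => ‖G x‖ ^ 2) :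
    Integrable (fun x => |v x| ^ critExp N) ∧
      ∫ x, |v x| ^ critExp N ≤ ((∫ x, ‖G x‖ ^ 2) / sobolevConst N) ^ (critExp N / 2) := by
  have hp := critExp_pos hN
  have hv : LocallyIntegrable v volume := locallyIntegrableOn_univ.1 hG.locallyIntegrable_fun
  have hinv : Tendsto (fun k : ℕ => ((k : ℝ) + 1)⁻¹) atTop (𝓝 0) :=
    (tendsto_atTop_add_const_right _ _ tendsto_natCast_atTop_atTop).inv_tendsto_atTop
  let φ : ℕ → ContDiffBump (0 : EuclideanSpace ℝ (Fin N)) := fun k =>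
    ⟨((k : ℝ) + 1)⁻¹, 2 * ((k : ℝ) + 1)⁻¹, by positivity,
      lt_two_mul_self (by positivity)⟩
  have hlim := ContDiffBump.ae_convolution_tendsto_right_of_locallyIntegrable (φ := φ) (K := 2)
    (l := atTop) (by simpa [φ] using hinv.const_mul 2) (Eventually.of_forall fun k => le_rfl) hv
  have hVd : ∀ k, ContDiff ℝ 1 (mollify ((φ k).normed volume) v) := fun k =>
    (φ k).hasCompactSupport_normed.contDiff_convolution_right _ hv (φ k).contDiff_normed
  have hVc : ∀ k, HasCompactSupport (mollify ((φ k).normed volume) v) := fun k =>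
    hc.convolution _ (φ k).hasCompactSupport_normed
  refine integral_le_of_tendsto (G := fun k x => |mollify ((φ k).normed volume) v x| ^ critExp N)
    (B := fun _ => ((∫ x, ‖G x‖ ^ 2) / sobolevConst N) ^ (critExp N / 2)) ?_ (fun k => ?_)
    (fun k x => by positivity) ?_ (fun k => ?_) tendsto_const_nhds
  · exact (hv.aestronglyMeasurable.norm.aemeasurable.pow_const _).aestronglyMeasurable
  · refine Continuous.integrable_of_hasCompactSupport
      ((hVd k).continuous.abs.rpow_const fun x => Or.inr hp.le) ?_
    exact (hVc k).comp_left (g := fun t => |t| ^ critExp N) (by simp [hp.ne'])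
  · filter_upwards [hlim] with x hx
    have h1 : Tendsto (fun k => mollify ((φ k).normed volume) v x) atTop (𝓝 (v x)) := by
      refine hx.congr fun k => ?_
      rw [convolution_lsmul_swap, mollify_apply]
      refine integral_congr_ae (ae_of_all _ fun t => ?_)
      simp only [smul_eq_mul]
      ring
    exact h1.abs.rpow_const (Or.inr hp.le)
  · refine le_rpow_of_sobolev hN (integral_nonneg fun x => by positivity) ?_
    refine (sobolev_of_hasCompactSupport hN (hVd k) (hVc k)).trans ?_
    exact integral_norm_fderiv_mollify_sq_le hG hG2 (φ k).contDiff_normed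
      (φ k).hasCompactSupport_normed (φ k).nonneg_normed (φ k).integral_normed

/-- The product rule for weak gradients. -/
theorem IsWeakGradient.mul_contDiff (hG : IsWeakGradient univ v G)
    {χ : EuclideanSpace ℝ (Fin N) → ℝ} (hχ : ContDiff ℝ ((⊤ : ℕ∞) : WithTop ℕ∞) χ) :
    IsWeakGradient univ (fun x => χ x * v x) (fun x => χ x • G x + v x • gradient χ x) := by
  have hv : LocallyIntegrable v volume := locallyIntegrableOn_univ.1 hG.locallyIntegrable_fun
  have hGl : LocallyIntegrable G volume := locallyIntegrableOn_univ.1 hG.locallyIntegrable_grad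
  have hχ1 : ContDiff ℝ 1 χ := hχ.of_le (by simp)
  have hgc := continuous_gradient hχ1
  have hl1 : LocallyIntegrable (fun x => χ x * v x) volume := by
    have := hv.locallyIntegrableOn univ |>.continuousOn_mul (g := χ) hχ.continuous.continuousOn
      isOpen_univ.isLocallyClosed
    exact locallyIntegrableOn_univ.1 this
  have hl2 : LocallyIntegrable (fun x => χ x • G x) volume := by
    have := hGl.locallyIntegrableOn univ |>.continuousOn_smul isOpen_univ.isLocallyClosed
      (g := χ) hχ.continuous.continuousOn
    exact locallyIntegrableOn_univ.1 this
  have hl3 : LocallyIntegrable (fun x => v x • gradient χ x) volume := by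
    have := hv.locallyIntegrableOn univ |>.smul_continuousOn isOpen_univ.isLocallyClosed
      (g := gradient χ) hgc.continuousOn
    exact locallyIntegrableOn_univ.1 this
  refine ⟨hl1.locallyIntegrableOn _, (hl2.add hl3).locallyIntegrableOn _, fun φ h1 h2 _ w => ?_⟩
  have h := hG.integral_by_parts (fun x => χ x * φ x) (hχ.mul h1) h2.mul_left (subset_univ _) w
  simp only [setIntegral_univ] at h ⊢
  have hd : ∀ x, fderiv ℝ (fun x => χ x * φ x) x w =
      χ x * fderiv ℝ φ x w + φ x * fderiv ℝ χ x w := fun x => by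
    rw [fderiv_fun_mul (hχ.differentiable (by simp) x) (h1.differentiable (by simp) x)]
    simp
  have hi1 : Integrable fun x => fderiv ℝ φ x w * (χ x * v x) :=
    hl1.integrable_smul_left_of_hasCompactSupport
      ((h1.continuous_fderiv (by simp)).clm_apply continuous_const)
      (h2.fderiv_apply (𝕜 := ℝ) w)
  have hi2 : Integrable fun x => (φ x * fderiv ℝ χ x w) * v x :=
    hv.integrable_smul_left_of_hasCompactSupport
      (h1.continuous.mul ((hχ.continuous_fderiv (by simp)).clm_apply continuous_const)) h2.mul_right
  have hi3 : Integrable fun x => inner ℝ (G x) w * (χ x * φ x) := by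
    have h3 := hGl.integrable_smul_left_of_hasCompactSupport (hχ.continuous.mul h1.continuous)
      (h2.mul_left (f := χ))
    refine (h3.inner_const w).congr (ae_of_all _ fun x => ?_)
    simp only [inner_smul_left, RCLike.conj_to_real, Pi.mul_apply]
    ring
  have e1 : ∫ x, v x * fderiv ℝ (fun x => χ x * φ x) x w =
      (∫ x, fderiv ℝ φ x w * (χ x * v x)) + ∫ x, (φ x * fderiv ℝ χ x w) * v x := by
    rw [← integral_add hi1 hi2]
    refine integral_congr_ae (ae_of_all _ fun x => ?_)
    simp only
    rw [hd]
    ring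
  have e2 : ∫ x, inner ℝ (χ x • G x + v x • gradient χ x) w * φ x =
      (∫ x, inner ℝ (G x) w * (χ x * φ x)) + ∫ x, (φ x * fderiv ℝ χ x w) * v x := by
    rw [← integral_add hi3 hi2]
    refine integral_congr_ae (ae_of_all _ fun x => ?_)
    simp only
    rw [inner_add_left, inner_smul_left, inner_smul_left, inner_gradient]
    simp only [RCLike.conj_to_real]
    ring
  have e3 : ∫ x, χ x * v x * fderiv ℝ φ x w = ∫ x, fderiv ℝ φ x w * (χ x * v x) :=
    integral_congr_ae (ae_of_all _ fun x => by ring)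
  rw [e1] at h
  rw [e2, e3]
  linarith

end

/-! ### Truncation and the Sobolev inequality for weak gradients -/

section

variable {N : ℕ} {v : EuclideanSpace ℝ (Fin N) → ℝ}
  {G : EuclideanSpace ℝ (Fin N) → EuclideanSpace ℝ (Fin N)}

/-- Cutoff functions `χ(x/(k+1))`, whose gradients are of size `1/(k+1)` and live on an annulus. -/
theorem exists_dilated_cutoff (N : ℕ) : ∃ χ : ℕ → EuclideanSpace ℝ (Fin N) → ℝ,
    (∀ k, ContDiff ℝ ((⊤ : ℕ∞) : WithTop ℕ∞) (χ k)) ∧ (∀ k, HasCompactSupport (χ k)) ∧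
    (∀ k x, |χ k x| ≤ 1) ∧ (∀ x, ∀ᶠ k in atTop, χ k x = 1) ∧
    ∃ C, (∀ k x, ‖fderiv ℝ (χ k) x‖ ≤ C * ((k : ℝ) + 1)⁻¹) ∧
      ∀ (k : ℕ) (x : EuclideanSpace ℝ (Fin N)), (‖x‖ < (k : ℝ) + 1 ∨ 2 * ((k : ℝ) + 1) < ‖x‖) →
        fderiv ℝ (χ k) x = 0 := by
  let φ : ContDiffBump (0 : EuclideanSpace ℝ (Fin N)) := ⟨1, 2, one_pos, one_lt_two⟩
  have hφ : ContDiff ℝ ((⊤ : ℕ∞) : WithTop ℕ∞) φ := φ.contDiff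
  obtain ⟨C, hC⟩ := (hφ.continuous_fderiv (by simp)).bounded_above_of_compact_support
    (φ.hasCompactSupport.fderiv (𝕜 := ℝ))
  have hk : ∀ k : ℕ, (0 : ℝ) < (k : ℝ) + 1 := fun k => by positivity
  have hn : ∀ (k : ℕ) (x : EuclideanSpace ℝ (Fin N)),
      ‖((k : ℝ) + 1)⁻¹ • x‖ = ((k : ℝ) + 1)⁻¹ * ‖x‖ := fun k x => by
    rw [norm_smul, Real.norm_of_nonneg (inv_pos.2 (hk k)).le]
  have hone : ∀ (k : ℕ) (x : EuclideanSpace ℝ (Fin N)), ‖x‖ ≤ (k : ℝ) + 1 →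
      φ (((k : ℝ) + 1)⁻¹ • x) = 1 := fun k x hx => by
    refine φ.one_of_mem_closedBall ?_
    rw [mem_closedBall_zero_iff, hn, inv_mul_le_iff₀ (hk k)]
    simpa [φ] using hx
  have hzero : ∀ (k : ℕ) (x : EuclideanSpace ℝ (Fin N)), 2 * ((k : ℝ) + 1) ≤ ‖x‖ →
      φ (((k : ℝ) + 1)⁻¹ • x) = 0 := fun k x hx => by
    refine φ.zero_of_le_dist ?_
    rw [dist_zero_right, hn, le_inv_mul_iff₀ (hk k)]
    simpa [φ, mul_comm] using hx
  refine ⟨fun k x => φ (((k : ℝ) + 1)⁻¹ • x), fun k => hφ.comp (contDiff_const_smul _),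
    fun k => ?_, fun k x => ?_, fun x => ?_, C, fun k x => ?_, fun k x hx => ?_⟩
  · refine HasCompactSupport.intro (isCompact_closedBall 0 (2 * ((k : ℝ) + 1))) fun x hx => ?_
    rw [mem_closedBall_zero_iff, not_le] at hx
    exact hzero k x hx.le
  · rw [abs_of_nonneg φ.nonneg]
    exact φ.le_one
  · filter_upwards [(tendsto_natCast_atTop_atTop (R := ℝ)).eventually_ge_atTop ‖x‖] with k hkx
    exact hone k x (hkx.trans (by linarith))
  · have h1 : HasFDerivAt (fun x : EuclideanSpace ℝ (Fin N) => ((k : ℝ) + 1)⁻¹ • x)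
        (((k : ℝ) + 1)⁻¹ • ContinuousLinearMap.id ℝ _) x := (hasFDerivAt_id x).fun_const_smul _
    have h2 := (hφ.differentiable (by simp) (((k : ℝ) + 1)⁻¹ • x)).hasFDerivAt.comp x h1
    have h3 : fderiv ℝ (fun x : EuclideanSpace ℝ (Fin N) => φ (((k : ℝ) + 1)⁻¹ • x)) x = _ :=
      h2.fderiv
    rw [h3, ContinuousLinearMap.comp_smul, ContinuousLinearMap.comp_id, norm_smul,
      Real.norm_of_nonneg (inv_pos.2 (hk k)).le, mul_comm]
    exact mul_le_mul_of_nonneg_right (hC _) (inv_pos.2 (hk k)).le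
  · rcases hx with hx | hx
    · have : (fun x : EuclideanSpace ℝ (Fin N) => φ (((k : ℝ) + 1)⁻¹ • x)) =ᶠ[𝓝 x] fun _ => 1 := by
        filter_upwards [continuous_norm.continuousAt.eventually (gt_mem_nhds hx)] with z hz
        exact hone k z hz.le
      rw [this.fderiv_eq]
      simp
    · have : (fun x : EuclideanSpace ℝ (Fin N) => φ (((k : ℝ) + 1)⁻¹ • x)) =ᶠ[𝓝 x] fun _ => 0 := by
        filter_upwards [continuous_norm.continuousAt.eventually (lt_mem_nhds hx)] with z hz
        exact hzero k z hz.le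
      rw [this.fderiv_eq]
      simp

/-- The error made in the Dirichlet integral of a critically integrable function by a dilated cutoff
tends to zero: by Young's inequality `k^{-2} v² ≤ δ k^{-N} + C_δ |v|^{2*}` for every `δ > 0`. -/
theorem tendsto_integral_cutoff_error (hN : 3 ≤ N)
    (hm : AEStronglyMeasurable v volume) (hv : Integrable fun x => |v x| ^ critExp N)
    {χ : ℕ → EuclideanSpace ℝ (Fin N) → ℝ} (hχ : ∀ k, ContDiff ℝ ((⊤ : ℕ∞) : WithTop ℕ∞) (χ k))
    {C : ℝ} (hC : ∀ k x, ‖fderiv ℝ (χ k) x‖ ≤ C * ((k : ℝ) + 1)⁻¹)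
    (hs : ∀ (k : ℕ) (x : EuclideanSpace ℝ (Fin N)),
      (‖x‖ < (k : ℝ) + 1 ∨ 2 * ((k : ℝ) + 1) < ‖x‖) → fderiv ℝ (χ k) x = 0) :
    (∀ k, Integrable fun x => v x ^ 2 * ‖fderiv ℝ (χ k) x‖ ^ 2) ∧
      Tendsto (fun k => ∫ x, v x ^ 2 * ‖fderiv ℝ (χ k) x‖ ^ 2) atTop (𝓝 0) := by
  have h3 : (3 : ℝ) ≤ N := by exact_mod_cast hN
  have h2 : (0 : ℝ) < (N : ℝ) - 2 := by linarith
  have hp := critExp_pos hN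
  have h2p := two_lt_critExp hN
  have hk : ∀ k : ℕ, (0 : ℝ) < (k : ℝ) + 1 := fun k => by positivity
  set tail : ℕ → EuclideanSpace ℝ (Fin N) → ℝ := fun k =>
    {x | (k : ℝ) + 1 ≤ ‖x‖}.indicator fun x => |v x| ^ critExp N with htail
  have hms : ∀ k : ℕ, MeasurableSet {x : EuclideanSpace ℝ (Fin N) | (k : ℝ) + 1 ≤ ‖x‖} := fun k =>
    measurableSet_le measurable_const measurable_norm
  have hti : ∀ k, Integrable (tail k) := fun k => hv.indicator (hms k)
  have htlim : Tendsto (fun k => ∫ x, tail k x) atTop (𝓝 0) := by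
    have := tendsto_integral_of_dominated_convergence (F := tail) (f := fun _ => (0 : ℝ))
      (fun x => |v x| ^ critExp N) (fun k => (hti k).1) hv (fun k => ae_of_all _ fun x => ?_)
      (ae_of_all _ fun x => ?_)
    · simpa using this
    · simp only [htail]
      refine (norm_indicator_le_norm_self _ _).trans ?_
      rw [Real.norm_of_nonneg (by positivity)]
    · refine tendsto_const_nhds.congr' ?_
      filter_upwards [(tendsto_natCast_atTop_atTop (R := ℝ)).eventually_ge_atTop ‖x‖] with k hkx
      simp only [htail]
      rw [indicator_of_notMem]
      rw [mem_ofPred_eq, not_le]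
      linarith
  set V := volume.real (Metric.ball (0 : EuclideanSpace ℝ (Fin N)) 1) with hV
  have hball : ∀ k : ℕ, volume.real (Metric.closedBall (0 : EuclideanSpace ℝ (Fin N))
      (2 * ((k : ℝ) + 1))) = (2 * ((k : ℝ) + 1)) ^ N * V := fun k => by
    rw [Measure.addHaar_real_closedBall _ _ (by positivity), finrank_euclideanSpace_fin]
  set box : ℕ → EuclideanSpace ℝ (Fin N) → ℝ := fun k =>
    (Metric.closedBall 0 (2 * ((k : ℝ) + 1))).indicator fun _ => ((((k : ℝ) + 1) ^ N)⁻¹ : ℝ) with hbox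
  have hbi : ∀ k, Integrable (box k) := fun k =>
    (integrable_indicator_iff Metric.isClosed_closedBall.measurableSet).2
      (integrableOn_const measure_closedBall_lt_top.ne)
  have hbint : ∀ k, ∫ x, box k x = 2 ^ N * V := fun k => by
    simp only [hbox]
    rw [integral_indicator_const _ Metric.isClosed_closedBall.measurableSet, hball, smul_eq_mul,
      mul_pow]
    have := (hk k).ne'
    field_simp
  have hle : ∀ δ, 0 < δ → ∀ k x, v x ^ 2 * ‖fderiv ℝ (χ k) x‖ ^ 2 ≤
      C ^ 2 * δ * box k x + C ^ 2 * √δ ^ (2 - critExp N) * tail k x := by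
    intro δ hδ k x
    have hb0 : 0 ≤ box k x := by
      simp only [hbox]
      exact indicator_nonneg (fun _ _ => by positivity) _
    have ht0 : 0 ≤ tail k x := by
      simp only [htail]
      exact indicator_nonneg (fun _ _ => by positivity) _
    by_cases hx : ‖x‖ < (k : ℝ) + 1 ∨ 2 * ((k : ℝ) + 1) < ‖x‖
    · have h0 : v x ^ 2 * (0 : ℝ) ^ 2 = 0 := by ring
      rw [hs k x hx, norm_zero, h0]
      positivity
    · rw [not_or, not_lt, not_lt] at hx
      have e1 : box k x = (((k : ℝ) + 1) ^ N)⁻¹ := by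
        simp only [hbox]
        rw [indicator_of_mem (by rw [mem_closedBall_zero_iff]; exact hx.2)]
      have e2 : tail k x = |v x| ^ critExp N := by
        simp only [htail]
        exact indicator_of_mem (s := {x : EuclideanSpace ℝ (Fin N) | (k : ℝ) + 1 ≤ ‖x‖}) hx.1 _
      rw [e1, e2]
      set κ := (k : ℝ) + 1 with hκ
      have hκ0 : 0 < κ := hk k
      have e3 := sq_le_add_mul_rpow h2p hδ
        (show 0 ≤ κ ^ (((N : ℝ) - 2) / 2) * |v x| by positivity)
      have e4 : (κ ^ (((N : ℝ) - 2) / 2) * |v x|) ^ critExp N = κ ^ N * |v x| ^ critExp N := by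
        rw [Real.mul_rpow (by positivity) (abs_nonneg _), ← Real.rpow_mul hκ0.le,
          show ((N : ℝ) - 2) / 2 * critExp N = (N : ℕ) by rw [critExp]; field_simp,
          Real.rpow_natCast]
      have e5 : (κ ^ (((N : ℝ) - 2) / 2) * |v x|) ^ 2 = κ ^ (N - 2) * v x ^ 2 := by
        rw [mul_pow, sq_abs, ← Real.rpow_two, ← Real.rpow_mul hκ0.le,
          show ((N : ℝ) - 2) / 2 * 2 = (N - 2 : ℕ) by
            push_cast [Nat.cast_sub (by omega : 2 ≤ N)]; ring, Real.rpow_natCast]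
      rw [e4, e5] at e3
      have hpow : κ ^ N = κ ^ (N - 2) * κ ^ 2 := by
        rw [← pow_add]; congr 1; omega
      have e6 : v x ^ 2 * (κ⁻¹) ^ 2 = (κ ^ N)⁻¹ * (κ ^ (N - 2) * v x ^ 2) := by
        rw [hpow]
        field_simp
      have e7 : ‖fderiv ℝ (χ k) x‖ ^ 2 ≤ (C * κ⁻¹) ^ 2 :=
        pow_le_pow_left₀ (norm_nonneg _) (hC k x) 2
      calc v x ^ 2 * ‖fderiv ℝ (χ k) x‖ ^ 2 ≤ v x ^ 2 * (C * κ⁻¹) ^ 2 :=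
            mul_le_mul_of_nonneg_left e7 (sq_nonneg _)
        _ = C ^ 2 * ((κ ^ N)⁻¹ * (κ ^ (N - 2) * v x ^ 2)) := by rw [← e6]; ring
        _ ≤ C ^ 2 * ((κ ^ N)⁻¹ * (δ + √δ ^ (2 - critExp N) * (κ ^ N * |v x| ^ critExp N))) := by
            gcongr
        _ = _ := by field_simp
  have hi : ∀ δ k, Integrable fun x =>
      C ^ 2 * δ * box k x + C ^ 2 * √δ ^ (2 - critExp N) * tail k x := fun δ k =>
    ((hbi k).const_mul _).add ((hti k).const_mul _)
  have hei : ∀ k, Integrable fun x => v x ^ 2 * ‖fderiv ℝ (χ k) x‖ ^ 2 := fun k => by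
    refine (hi 1 k).mono' ?_ (ae_of_all _ fun x => ?_)
    · have := (hχ k).continuous_fderiv (by simp)
      exact (hm.pow 2).mul (Continuous.aestronglyMeasurable (by fun_prop))
    · rw [Real.norm_of_nonneg (by positivity)]
      exact hle 1 one_pos k x
  refine ⟨hei, ?_⟩
  have hbound : ∀ δ, 0 < δ → ∀ k, ∫ x, v x ^ 2 * ‖fderiv ℝ (χ k) x‖ ^ 2 ≤
      C ^ 2 * δ * (2 ^ N * V) + C ^ 2 * √δ ^ (2 - critExp N) * ∫ x, tail k x := fun δ hδ k => by
    refine (integral_mono (hei k) (hi δ k) (hle δ hδ k)).trans (le_of_eq ?_)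
    rw [integral_add ((hbi k).const_mul _) ((hti k).const_mul _), integral_const_mul,
      integral_const_mul, hbint]
  refine tendsto_order.2 ⟨fun a ha => Eventually.of_forall fun k =>
    ha.trans_le (integral_nonneg fun x => by positivity), fun η hη => ?_⟩
  have hV0 : 0 ≤ V := measureReal_nonneg
  set A := C ^ 2 * (2 ^ N * V) with hA
  have hA0 : 0 ≤ A := by positivity
  have hδ : 0 < η / (2 * (A + 1)) := by positivity
  have h5 : C ^ 2 * (η / (2 * (A + 1))) * (2 ^ N * V) ≤ η / 2 := by
    have : C ^ 2 * (η / (2 * (A + 1))) * (2 ^ N * V) = η / 2 * (A / (A + 1)) := by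
      rw [hA]; field_simp
    rw [this]
    refine mul_le_of_le_one_right (by positivity) ?_
    rw [div_le_one (by positivity)]
    linarith
  have h6 := htlim.const_mul (C ^ 2 * √(η / (2 * (A + 1))) ^ (2 - critExp N))
  rw [mul_zero] at h6
  filter_upwards [h6.eventually (gt_mem_nhds (show (0 : ℝ) < η / 2 by positivity))] with k hk6
  have := hbound _ hδ k
  linarith

/-- The sharp Sobolev inequality on `D^{1,2}(ℝ^N)`, from the compactly supported case applied to the
truncations `χ_k v`. -/
theorem sobolev_of_isWeakGradient (hN : 3 ≤ N) (hG : IsWeakGradient univ v G)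
    (hv : Integrable fun x => |v x| ^ critExp N) (hG2 : Integrable fun x => ‖G x‖ ^ 2) :
    sobolevConst N * (∫ x, |v x| ^ critExp N) ^ (2 / critExp N) ≤ ∫ x, ‖G x‖ ^ 2 := by
  have hp := critExp_pos hN
  have hm : AEStronglyMeasurable v volume :=
    (locallyIntegrableOn_univ.1 hG.locallyIntegrable_fun).aestronglyMeasurable
  have hGm : AEStronglyMeasurable G volume :=
    (locallyIntegrableOn_univ.1 hG.locallyIntegrable_grad).aestronglyMeasurable
  obtain ⟨χ, hχ, hχc, hχ1, hχlim, C, hC, hs⟩ := exists_dilated_cutoff N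
  obtain ⟨hei, helim⟩ := tendsto_integral_cutoff_error hN hm hv hχ hC hs
  set Q := ∫ x, ‖G x‖ ^ 2 with hQ
  have hQ0 : 0 ≤ Q := integral_nonneg fun x => sq_nonneg _
  have hI0 : 0 ≤ ∫ x, |v x| ^ critExp N := integral_nonneg fun x => by positivity
  have main : ∀ δ, 0 < δ →
      sobolevConst N * (∫ x, |v x| ^ critExp N) ^ (2 / critExp N) ≤ (1 + δ) * Q := by
    intro δ hδ
    have hle : ∀ k x, ‖χ k x • G x + v x • gradient (χ k) x‖ ^ 2 ≤
        (1 + δ) * ‖G x‖ ^ 2 + (1 + δ⁻¹) * (v x ^ 2 * ‖fderiv ℝ (χ k) x‖ ^ 2) := by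
      intro k x
      have h1 : ‖χ k x • G x + v x • gradient (χ k) x‖ ≤ ‖G x‖ + |v x| * ‖fderiv ℝ (χ k) x‖ := by
        refine (norm_add_le _ _).trans (add_le_add ?_ ?_)
        · rw [norm_smul]
          exact mul_le_of_le_one_left (norm_nonneg _) (hχ1 k x)
        · rw [norm_smul, norm_gradient, Real.norm_eq_abs]
      refine (pow_le_pow_left₀ (norm_nonneg _) h1 2).trans ?_
      have e : v x ^ 2 * ‖fderiv ℝ (χ k) x‖ ^ 2 = (|v x| * ‖fderiv ℝ (χ k) x‖) ^ 2 := by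
        rw [mul_pow, sq_abs]
      rw [e]
      set a := ‖G x‖
      set b := |v x| * ‖fderiv ℝ (χ k) x‖
      have h2 : 0 ≤ δ⁻¹ * (δ * a - b) ^ 2 := by positivity
      have h3 : δ⁻¹ * (δ * a - b) ^ 2 = δ * a ^ 2 - 2 * a * b + δ⁻¹ * b ^ 2 := by
        field_simp
        ring
      nlinarith
    have hbi : ∀ k, Integrable fun x =>
        (1 + δ) * ‖G x‖ ^ 2 + (1 + δ⁻¹) * (v x ^ 2 * ‖fderiv ℝ (χ k) x‖ ^ 2) := fun k =>
      (hG2.const_mul _).add ((hei k).const_mul _)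
    have hGi : ∀ k, Integrable fun x => ‖χ k x • G x + v x • gradient (χ k) x‖ ^ 2 := fun k => by
      refine (hbi k).mono' ?_ (ae_of_all _ fun x => ?_)
      · have h1 := (continuous_gradient ((hχ k).of_le (by simp) : ContDiff ℝ 1 (χ k)))
        exact ((((hχ k).continuous.aestronglyMeasurable.smul hGm).add
          (hm.smul h1.aestronglyMeasurable)).norm).pow 2
      · rw [Real.norm_of_nonneg (sq_nonneg _)]
        exact hle k x
    have hGle : ∀ k, ∫ x, ‖χ k x • G x + v x • gradient (χ k) x‖ ^ 2 ≤
        (1 + δ) * Q + (1 + δ⁻¹) * ∫ x, v x ^ 2 * ‖fderiv ℝ (χ k) x‖ ^ 2 := fun k => by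
      refine (integral_mono (hGi k) (hbi k) (hle k)).trans (le_of_eq ?_)
      rw [integral_add (hG2.const_mul _) ((hei k).const_mul _), integral_const_mul,
        integral_const_mul]
    have hk := fun k => sobolev_of_isWeakGradient_of_hasCompactSupport hN
      (hG.mul_contDiff (hχ k)) ((hχc k).mul_right) (hGi k)
    have hS := sobolevConst_pos hN
    refine sobolev_of_le_rpow hN hI0 (by positivity) ?_
    refine (integral_le_of_tendsto (G := fun k x => |χ k x * v x| ^ critExp N)
      (B := fun k => (((1 + δ) * Q + (1 + δ⁻¹) * ∫ x, v x ^ 2 * ‖fderiv ℝ (χ k) x‖ ^ 2) /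
        sobolevConst N) ^ (critExp N / 2)) hv.1 (fun k => (hk k).1) (fun k x => by positivity)
      (ae_of_all _ fun x => ?_) (fun k => (hk k).2.trans ?_) ?_).2
    · refine tendsto_const_nhds.congr' ?_
      filter_upwards [hχlim x] with k hkx
      rw [hkx, one_mul]
    · refine Real.rpow_le_rpow ?_ ?_ (by positivity)
      · exact div_nonneg (integral_nonneg fun x => sq_nonneg _) hS.le
      · exact div_le_div_of_nonneg_right (hGle k) hS.le
    · have h1 := (((helim.const_mul (1 + δ⁻¹)).const_add ((1 + δ) * Q)).div_const
        (sobolevConst N)).rpow_const (p := critExp N / 2) (Or.inr (by positivity))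
      rwa [mul_zero, add_zero] at h1
  refine le_of_forall_pos_le_add fun η hη => ?_
  refine (main (η / (Q + 1)) (by positivity)).trans ?_
  have : η / (Q + 1) * Q ≤ η := by
    rw [div_mul_eq_mul_div, div_le_iff₀ (by positivity)]
    nlinarith
  linarith

/-! ### The energy levels -/

theorem bubbleEnergy_le_of_mem_nehari_univ (hN : 3 ≤ N)
    (hv : v ∈ nehari (univ : Set (EuclideanSpace ℝ (Fin N)))) :
    bubbleEnergy N ≤ ∫ x in univ, |v x| ^ critExp N := by
  have hp := critExp_pos hN
  obtain ⟨⟨hv1, hv2, hv3⟩, h0, hNe⟩ := hv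
  have hX := integral_rpow_pos_of_nontrivial hN hv1 h0
  have hi := hv1.integrable_norm_rpow (by simpa using hp) ENNReal.ofReal_ne_top
  rw [ENNReal.toReal_ofReal hp.le] at hi
  have hGi := (memLp_two_iff_integrable_sq_norm hv3.1).1 hv3
  rw [Measure.restrict_univ] at *
  refine bubbleEnergy_le_of_sobolev hN hX ?_
  refine (sobolev_of_isWeakGradient hN (IsWeakGradient.weakGrad hv2) hi hGi).trans (le_of_eq hNe)

theorem cInfty_eq (hN : 3 ≤ N) : cInfty N = bubbleEnergy N / N := by
  have e : energy univ (bubble 1 : EuclideanSpace ℝ (Fin N) → ℝ) = bubbleEnergy N / N := by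
    rw [energy_eq_of_mem_nehari hN (bubble_mem_nehari_univ hN one_pos), Measure.restrict_univ,
      integral_abs_bubble_rpow hN one_pos]
    ring
  rw [cInfty, leastEnergy, ← e]
  refine IsLeast.csInf_eq ⟨⟨_, bubble_mem_nehari_univ hN one_pos, rfl⟩, ?_⟩
  rintro _ ⟨v, hv, rfl⟩
  rw [e, energy_eq_of_mem_nehari hN hv, div_eq_inv_mul, ← one_div]
  exact mul_le_mul_of_nonneg_left (bubbleEnergy_le_of_mem_nehari_univ hN hv) (by positivity)

theorem volume_boundedCone_sphere (hN : 3 ≤ N) :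
    volume.real (boundedCone (Metric.sphere (0 : EuclideanSpace ℝ (Fin N)) 1)) =
      volume.real (Metric.ball (0 : EuclideanSpace ℝ (Fin N)) 1) := by
  have h : volume (openCone (Metric.sphere (0 : EuclideanSpace ℝ (Fin N)) 1) ∩ Metric.ball 0 1) =
      volume (Metric.ball (0 : EuclideanSpace ℝ (Fin N)) 1) := by
    rw [inter_comm, ← Measure.restrict_apply Metric.isOpen_ball.measurableSet,
      restrict_openCone_sphere hN]
  rw [boundedCone_eq isOpenInSphere_sphere, Measure.real, h, Measure.real]

theorem volume_ball_pos (N : ℕ) : 0 < volume.real (Metric.ball (0 : EuclideanSpace ℝ (Fin N)) 1) :=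
  ENNReal.toReal_pos (Metric.measure_ball_pos _ _ one_pos).ne' measure_ball_lt_top.ne

theorem bConst_pos (hN : 3 ≤ N) : 0 < bConst N := by
  have hN0 : (0 : ℝ) < N := by exact_mod_cast (by omega : 0 < N)
  have := bubbleEnergy_pos hN
  have := volume_ball_pos N
  rw [bConst, cInfty_eq hN]
  positivity

theorem radialLeastEnergy_eq (hN : 3 ≤ N) {ω : Set (EuclideanSpace ℝ (Fin N))}
    (hω : IsOpenInSphere ω) (hne : ω.Nonempty) :
    radialLeastEnergy (openCone ω) = bConst N * volume.real (boundedCone ω) := by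
  have hN0 : (0 : ℝ) < N := by exact_mod_cast (by omega : 0 < N)
  have := volume_ball_pos N
  rw [radialLeastEnergy_openCone hN hω hne, radialBubbleMass, angMass_eq (by omega) hω,
    angMass_eq (by omega) isOpenInSphere_sphere, volume_boundedCone_sphere hN, bConst,
    cInfty_eq hN]
  field_simp

end

end CriticalCone

end

theorem proposition3p4 (N : ℕ) (hN : 3 ≤ N) :
    (∀ ω : Set (EuclideanSpace ℝ (Fin N)), CriticalCone.IsSphereDomain ω →
      -- the bubbles minimize the energy on the radial Nehari manifold
      (∀ ε : ℝ, 0 < ε →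
        CriticalCone.bubble ε ∈ CriticalCone.radialNehari (CriticalCone.openCone ω) ∧
        ∀ v ∈ CriticalCone.radialNehari (CriticalCone.openCone ω),
          CriticalCone.energy (CriticalCone.openCone ω) (CriticalCone.bubble ε) ≤
            CriticalCone.energy (CriticalCone.openCone ω) v) ∧
      -- up to sign they are exactly the nontrivial radial solutions
      (∀ u : EuclideanSpace ℝ (Fin N) → ℝ,
        (CriticalCone.IsNeumannSolution (CriticalCone.openCone ω) u ∧
          CriticalCone.IsRadialOn (CriticalCone.openCone ω) u ∧
          CriticalCone.Nontrivial (CriticalCone.openCone ω) u) ↔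
        ∃ ε : ℝ, 0 < ε ∧
          ((∀ᵐ x ∂(volume.restrict (CriticalCone.openCone ω)), u x = CriticalCone.bubble ε x) ∨
           (∀ᵐ x ∂(volume.restrict (CriticalCone.openCone ω)), u x = - CriticalCone.bubble ε x))) ∧
      -- the radial energy level
      CriticalCone.radialLeastEnergy (CriticalCone.openCone ω) =
        CriticalCone.bConst N * volume.real (CriticalCone.boundedCone ω)) ∧
    -- the level is strictly increasing in the volume of the bounded cone
    (∀ ω₁ ω₂ : Set (EuclideanSpace ℝ (Fin N)),
      CriticalCone.IsSphereDomain ω₁ → CriticalCone.IsSphereDomain ω₂ →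
      volume.real (CriticalCone.boundedCone ω₁) < volume.real (CriticalCone.boundedCone ω₂) →
      CriticalCone.radialLeastEnergy (CriticalCone.openCone ω₁) <
        CriticalCone.radialLeastEnergy (CriticalCone.openCone ω₂)) := by
  refine ⟨fun ω hω => ?_, fun ω₁ ω₂ h₁ h₂ hlt => ?_⟩
  · have ho := hω.isOpenInSphere
    have hne := hω.isConnected.nonempty
    exact ⟨fun ε hε => ⟨CriticalCone.bubble_mem_radialNehari hN ho hne hε,
        fun v hv => CriticalCone.energy_bubble_le hN ho hne hε hv⟩,
      CriticalCone.isNeumannSolution_radial_iff hN ho hne,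
      CriticalCone.radialLeastEnergy_eq hN ho hne⟩
  · rw [CriticalCone.radialLeastEnergy_eq hN h₁.isOpenInSphere h₁.isConnected.nonempty,
      CriticalCone.radialLeastEnergy_eq hN h₂.isOpenInSphere h₂.isConnected.nonempty]
    exact mul_lt_mul_of_pos_left hlt (CriticalCone.bConst_pos hN)
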